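/- **Setting.** Let $\mathcal S$ be a finite set and let $(X,S,Y)\sim\mathbb P$ on $\mathbb R^d\times\mathcal S\times\mathbb R$ with $Y=f^*(X,S)+\varepsilon$, where $\varepsilon$ has a finite second moment and $\mathbb E[\varepsilon\mid X,S]=0$. Put $p_s=\mathbb P(S=s)>0$. Let $\nu_{f^*|s}$, $F_{f^*|s}$, $Q_{f^*|s}$ be the law, CDF and quantile function of $f^*(X,S)$ given $S=s$. Quantile functions are $Q(t)=\inf\{y:F(y)\ge t\}$ for $t\in(0,1]$ and $Q(0)=Q(0+)$. For $\alpha\in\mathbb R$ and $p\in[0,1]$ let $$g^*_{\alpha,p}(x,s)=Q^*_s\big(F_{f^*|s}(f^*(x,s))\big),\qquad Q^*_s(t)=\begin{cases}\min\{\alpha,Q_{f^*|s}(t)\},&t\in[0,p],\\ \max\{\alpha,\sum_{s'}p_{s'}Q_{f^*|s'}(t)\},&t\in(p,1].\end{cases}$$ **Estimator.** Let $\hat f=\hat f_n$ be a (jointly measurable) estimator of $f^*$ built from $n$ i.i.d. observations with law $\mathbb P$. Independently, $N$ unlabeled points are available: their group labels are i.i.d. copies of $S$, $N_s$ is the number of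 labels equal to $s$, and the features $X^s_1,\dots,X^s_{N_s}$ of group $s$ are i.i.d. from $\mathbb P_{X\mid S=s}$. Each $\{1,\dots,N_s\}$ is split by a fixed rule into two halves (of sizes differing by one if $N_s$ is odd). Let $\varepsilon_{is}$ and $\varepsilon_s$ be i.i.d. uniform on $[-\sigma,\sigma]$, independent of the rest; here $\sigma>0$ may depend on the group sizes. Let $\hat F_{\hat f|s}$ be the empirical CDF of $\hat f(X_i^s,s)+\varepsilon_{is}$ over the first half and $\hat Q_{\hat f|s}$ the empirical quantile function over the second half (both are $0$ for an empty half). With $\hat p_s=N_s/N$ and $\xi>0$ let $$\hat g^{\xi}_{\alpha,p}(x,s)=\hat Q^\xi_s\big(\hat F_{\hat f|s}(\hat f(x,s)+\varepsilon_s)\big),\qquad \hat Q^\xi_s(t)=\begin{cases}\min\{\alpha,\hat Q_{\hat f|s}(t)\},&t\in[0,p],\\ \max\{\alpha+\xi,\sum_{s'}\hat p_{s'}\hat Q_{\hat f|s'}(t)\},&t\in(p,1].\end{cases}$$ **Assumptions.** 1. For each $s$, $\nu_{f^*|s}$ has a density $q_s$ with $q_s\le\bar\lambda_s$ almost everywhere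 and $q_s\ge\underline\lambda_s>0$ $\nu_{f^*|s}$-almost everywhere. 2. For each $s$, $x\mapsto f^*(x,s)$ is Lipschitz; $X$ belongs almost surely to a compact set; and $\mathbb P_{X\mid S=s}$ has a density that is bounded above, and bounded below by a positive constant $\mathbb P_{X\mid S=s}$-almost everywhere. In particular $|f^*(X,S)|\le M$ almost surely for some $M$. 3. There are constants $c,C_0>0$ and a positive sequence $(b_n)$ such that, for all $n\ge1$ and $\delta>0$ and for $\mathbb P_{X,S}$-almost all $(x,s)$, $\mathbf P(|f^*(x,s)-\hat f_n(x,s)|\ge\delta)\le c\,e^{-C_0b_n\delta^2}$. **Theorem.** Given $\mathcal S$, $(\underline\lambda_s,\bar\lambda_s)_{s\in\mathcal S}$, $c$, $C_0$, $M$, $A$, $K_\sigma$, $K_\xi$, there is a constant $C$, depending on these only, such that under the assumptions above, for all $n\ge2$ and $N\ge1$, all $\sigma,\xi>0$ with $$\sigma\le K_\sigma\Big(\min_{s:\,N_s>0}N_s^{-1/2}\wedge b_n^{-1/2}\Big),\qquad \xi\le K_\xi\sqrt{1/N},$$ and all $\alpha\in[-A,A]$ and $p\in[0,1]$, the error $g^*_{\alpha,p}(X,S)-\hat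 g^{\xi}_{\alpha,p}(X,S)$ is integrable and $$\mathbf E\big|g^*_{\alpha,p}(X,S)-\hat g^{\xi}_{\alpha,p}(X,S)\big|\le C\Big(\sqrt{\tfrac1N}+\log(n)\,b_n^{-1/2}\Big),$$ where $\mathbf E$ is taken over all data, the jitter, and an independent test point $(X,S)\sim\mathbb P_{X,S}$. -/

import Mathlib

open MeasureTheory ProbabilityTheory Set
open scoped ENNReal NNReal

noncomputable section

namespace DPTails

/-- The feature space `ℝ^d`, with the Euclidean norm. -/
abbrev Feature (d : ℕ) : Type := EuclideanSpace ℝ (Fin d)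

/-- One labeled observation `(X, S, Y)`. -/
abbrev Obs (d : ℕ) (S : Type*) : Type _ := Feature d × S × ℝ

section Model

variable {d : ℕ} {S : Type*} [MeasurableSpace S]

/-- The group proportion `p_s = ℙ(S = s)`. -/
def groupProb (P : Measure (Obs d S)) (s : S) : ℝ := P.real {z | z.2.1 = s}

/-- The conditional law of `X` given `S = s`. -/
def condX (P : Measure (Obs d S)) (s : S) : Measure (Feature d) :=
  (P[|{z : Obs d S | z.2.1 = s}]).map (fun z => z.1)

/-- `ν_{f|s}`, the conditional law of `f(X, S)` given `S = s`. -/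
def condLaw (P : Measure (Obs d S)) (f : Feature d → S → ℝ) (s : S) : Measure ℝ :=
  (condX P s).map (fun x => f x s)

/-- `Y = f(X, S) + noise` where the noise has a finite second moment and is conditionally
centered given `(X, S)`. -/
structure RegressionModel (P : Measure (Obs d S)) (f : Feature d → S → ℝ) : Prop where
  memLp_noise : MemLp (fun z : Obs d S => z.2.2 - f z.1 z.2.1) 2 P
  condExp_noise :
    P[fun z : Obs d S => z.2.2 - f z.1 z.2.1 |
      MeasurableSpace.comap (fun z : Obs d S => (z.1, z.2.1)) inferInstance] =ᵐ[P] 0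

/-- The law `μ` has a density with respect to Lebesgue measure that is at most `hi` and, on the
set that carries `μ`, at least `lo`. -/
def HasBoundedDensity {E : Type*} [MeasureSpace E] (μ : Measure E) (lo hi : ℝ) : Prop :=
  ∃ q : E → ℝ, Measurable q ∧ (∀ t, 0 ≤ q t) ∧
    μ = volume.withDensity (fun t => ENNReal.ofReal (q t)) ∧
    (∀ᵐ t, q t ≤ hi) ∧ (∀ᵐ t ∂μ, lo ≤ q t)

/-- Regularity of the features: `f(·, s)` is Lipschitz, `X` lives in a compact set, and the
conditional laws of `X` given `S = s` have densities bounded above, and bounded away from zero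
where they live. -/
structure FeatureRegularity (P : Measure (Obs d S)) (f : Feature d → S → ℝ) : Prop where
  lipschitz : ∀ s, ∃ L : ℝ≥0, LipschitzWith L (fun x => f x s)
  compact : ∃ T : Set (Feature d), IsCompact T ∧ ∀ᵐ z ∂P, z.1 ∈ T
  density : ∀ s, ∃ lo hi : ℝ, 0 < lo ∧ HasBoundedDensity (condX P s) lo hi

/-- A base estimator: for every sample size, a rule which maps a labeled sample of that size to a
regressor, jointly measurable in the sample and the feature. -/
structure BaseEstimator (d : ℕ) (S : Type*) [MeasurableSpace S] where
  toFun : (n : ℕ) → (Fin n → Obs d S) → Feature d → S → ℝ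
  measurable_toFun : ∀ n s,
    Measurable (fun w : (Fin n → Obs d S) × Feature d => toFun n w.1 w.2 s)

/-- Pointwise sub-Gaussian deviation of the base estimator, at the rate `b`. -/
def PointwiseDeviation (P : Measure (Obs d S)) (f : Feature d → S → ℝ)
    (fhat : BaseEstimator d S) (b : ℕ → ℝ) (c C : ℝ) : Prop :=
  ∀ n : ℕ, 1 ≤ n → ∀ δ : ℝ, 0 < δ →
    ∀ᵐ w ∂(P.map (fun z : Obs d S => (z.1, z.2.1))),
      (Measure.pi (fun _ : Fin n => P)).real
        {D | δ ≤ |f w.1 w.2 - fhat.toFun n D w.1 w.2|} ≤ c * Real.exp (-C * b n * δ ^ 2)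

end Model

/-- The quantile function of a distribution function `F`: `inf {y | t ≤ F y}` for `t > 0`, and its
right limit `inf {y | 0 < F y}` for `t = 0`. -/
def quantile (F : ℝ → ℝ) (t : ℝ) : ℝ := sInf {y | t ≤ F y ∧ 0 < F y}

/-- The empirical distribution function of the values `v i`, `i ∈ J` (zero if `J` is empty). -/
def ecdf {ι : Type*} (J : Finset ι) (v : ι → ℝ) (t : ℝ) : ℝ :=
  ((J.filter (fun i => v i ≤ t)).card : ℝ) / (J.card : ℝ)

/-- The quantile function `t ↦ min {α, Q_s(t)}` on `[0, p]` and
`t ↦ max {a, ∑ s', w_{s'} Q_{s'}(t)}` on `(p, 1]`. -/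
def tailQuantile {S : Type*} [Fintype S] (α a p : ℝ) (w : S → ℝ) (Q : S → ℝ → ℝ) (s : S)
    (t : ℝ) : ℝ :=
  if t ≤ p then min α (Q s t) else max a (∑ s', w s' * Q s' t)

/-- The oracle `g*_{α,p}`. -/
def oracle {d : ℕ} {S : Type*} [Fintype S] [MeasurableSpace S] (P : Measure (Obs d S))
    (f : Feature d → S → ℝ) (α p : ℝ) (x : Feature d) (s : S) : ℝ :=
  tailQuantile α α p (groupProb P) (fun s' => quantile (cdf (condLaw P f s'))) s
    (cdf (condLaw P f s) (f x s))

/-- All the randomness: the labeled sample, the group labels of the `N` unlabeled points, for each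
group `s` a supply of features `X^s_1, X^s_2, …` (only the first `N_s` of them are used, where
`N_s` is the number of labels equal to `s`), the normalized jitter of these points, the normalized
jitter at prediction time for each group, and the test point `(X, S)`. -/
structure Sample (d : ℕ) (S : Type*) (n N : ℕ) where
  labeled : Fin n → Obs d S
  groups : Fin N → S
  features : S → Fin N → Feature d
  jitter : S → Fin N → ℝ
  testJitter : S → ℝ
  test : Feature d × S

/-- The same data as a tuple. -/
abbrev SampleTuple (d : ℕ) (S : Type*) (n N : ℕ) : Type _ :=
  (Fin n → Obs d S) × (Fin N → S) × (S → Fin N → Feature d) × (S → Fin N → ℝ) ×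
    (S → ℝ) × (Feature d × S)

/-- Naming the components of the tuple. -/
def SampleTuple.toSample {d : ℕ} {S : Type*} {n N : ℕ} (w : SampleTuple d S n N) :
    Sample d S n N where
  labeled := w.1
  groups := w.2.1
  features := w.2.2.1
  jitter := w.2.2.2.1
  testJitter := w.2.2.2.2.1
  test := w.2.2.2.2.2

/-- The uniform law on `[-1, 1]`. -/
def unifLaw : Measure ℝ := (volume : Measure ℝ)[|Icc (-1 : ℝ) 1]

/-- The joint law of the data and the test point: all components are independent, the labeled data
are i.i.d. from `P`, the labels of the unlabeled points are i.i.d. from the law of `S` (so that the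
group sizes are multinomial), the features of group `s` are i.i.d. from the law of `X` given
`S = s`, the normalized jitters are i.i.d. uniform on `[-1, 1]`, and `(X, S)` follows its law
under `P`. -/
def sampleLaw {d : ℕ} {S : Type*} [Fintype S] [MeasurableSpace S] (P : Measure (Obs d S))
    (n N : ℕ) : Measure (SampleTuple d S n N) :=
  (Measure.pi (fun _ : Fin n => P)).prod
    ((Measure.pi (fun _ : Fin N => P.map (fun z : Obs d S => z.2.1))).prod
      ((Measure.pi (fun s : S => Measure.pi (fun _ : Fin N => condX P s))).prod
        ((Measure.pi (fun _ : S => Measure.pi (fun _ : Fin N => unifLaw))).prod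
          ((Measure.pi (fun _ : S => unifLaw)).prod
            (P.map (fun z : Obs d S => (z.1, z.2.1)))))))

/-- A fixed rule that splits `{0, …, m - 1}`, for each group and each group size `m`, into two
halves (equal if `m` is even, and differing by one element if `m` is odd). -/
structure SplitRule (S : Type*) where
  first : S → ℕ → Finset ℕ
  first_subset : ∀ s m, first s m ⊆ Finset.range m
  card_first : ∀ s m, (first s m).card = m / 2 ∨ (first s m).card = (m + 1) / 2

/-- The second half of the split. -/
def SplitRule.second {S : Type*} (I : SplitRule S) (s : S) (m : ℕ) : Finset ℕ :=
  Finset.range m \ I.first s m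

section Estimator

variable {d : ℕ} {S : Type*} [Fintype S] [DecidableEq S] [MeasurableSpace S] {n N : ℕ}

/-- The group sizes `N_s`. -/
def Sample.count (D : Sample d S n N) (s : S) : ℕ :=
  (Finset.univ.filter (fun i => D.groups i = s)).card

/-- The jittered predictions `f̂(X_i^s, s) + ε_{is}`, where `ε_{is}` is uniform on `[-σ, σ]` and
`σ` may be tuned to the group sizes. -/
def Sample.scores (D : Sample d S n N) (fhat : BaseEstimator d S) (σ : (S → ℕ) → ℝ) (s : S)
    (i : Fin N) : ℝ :=
  fhat.toFun n D.labeled (D.features s i) s + σ D.count * D.jitter s i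

/-- `F̂_{f̂|s}`, computed from the first half of group `s`. -/
def Sample.cdfHat (D : Sample d S n N) (fhat : BaseEstimator d S) (σ : (S → ℕ) → ℝ)
    (I : SplitRule S) (s : S) : ℝ → ℝ :=
  ecdf (Finset.univ.filter (fun i : Fin N => (i : ℕ) ∈ I.first s (D.count s)))
    (D.scores fhat σ s)

/-- `Q̂_{f̂|s}`, computed from the second half of group `s`. -/
def Sample.quantileHat (D : Sample d S n N) (fhat : BaseEstimator d S) (σ : (S → ℕ) → ℝ)
    (I : SplitRule S) (s : S) : ℝ → ℝ :=
  quantile (ecdf (Finset.univ.filter (fun i : Fin N => (i : ℕ) ∈ I.second s (D.count s)))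
    (D.scores fhat σ s))

/-- The estimator `ĝ^ξ_{α,p}` at the point `(x, s)`, with `p̂_s = N_s / N`. -/
def Sample.estimator (D : Sample d S n N) (fhat : BaseEstimator d S) (σ : (S → ℕ) → ℝ)
    (I : SplitRule S) (ξ α p : ℝ) (x : Feature d) (s : S) : ℝ :=
  tailQuantile α (α + ξ) p (fun s' => (D.count s' : ℝ) / (N : ℝ)) (D.quantileHat fhat σ I) s
    (D.cdfHat fhat σ I s (fhat.toFun n D.labeled x s + σ D.count * D.testJitter s))

/-- The error `|g*_{α,p}(X, S) - ĝ^ξ_{α,p}(X, S)|` at the test point. -/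
def absError (P : Measure (Obs d S)) (f : Feature d → S → ℝ) (fhat : BaseEstimator d S)
    (σ : (S → ℕ) → ℝ) (I : SplitRule S) (ξ α p : ℝ) (w : SampleTuple d S n N) : ℝ :=
  |oracle P f α p w.toSample.test.1 w.toSample.test.2
    - w.toSample.estimator fhat σ I ξ α p w.toSample.test.1 w.toSample.test.2|

end Estimator

end DPTails

end

open MeasureTheory ProbabilityTheory Set
open scoped ENNReal NNReal

noncomputable section

namespace DPTails

set_option linter.unusedSectionVars false

/-! ### Cauchy integrals and anticoncentration -/

theorem lintegral_cauchy_kernel {a : ℝ} (ha : 0 < a) (u : ℝ) :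
    ∫⁻ z : ℝ, ENNReal.ofReal ((1 + (a * (z - u)) ^ 2)⁻¹) = ENNReal.ofReal (Real.pi / a) := by
  rw [lintegral_sub_right_eq_self (fun z : ℝ => ENNReal.ofReal ((1 + (a * z) ^ 2)⁻¹)) u,
    ← ofReal_integral_eq_lintegral_ofReal]
  · rw [Measure.integral_comp_mul_left (fun x : ℝ => (1 + x ^ 2)⁻¹) a,
      integral_univ_inv_one_add_sq, abs_of_pos (inv_pos.2 ha), smul_eq_mul, div_eq_inv_mul]
  · exact integrable_inv_one_add_sq.comp_mul_left' ha.ne'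
  · exact ae_of_all _ fun z => by positivity

theorem measure_abs_sub_le_of_sq_moment {𝒳 Ω : Type*} [MeasurableSpace 𝒳] [MeasurableSpace Ω]
    {μ : Measure 𝒳} {ρ : Measure Ω} [IsProbabilityMeasure ρ] {t : 𝒳 → ℝ} (ht : Measurable t)
    (hμt : μ.map t ≤ volume) {Z : 𝒳 → Ω → ℝ} {κ : ℝ} (hκ : 0 < κ)
    (hZ : ∀ᵐ x ∂μ, AEMeasurable (Z x) ρ)
    (hZκ : ∀ᵐ x ∂μ, ∫⁻ ω, ENNReal.ofReal (Z x ω ^ 2) ∂ρ ≤ ENNReal.ofReal (κ ^ 2)) (p : ℝ) :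
    ∫⁻ x, ρ {ω | |t x - p| ≤ |Z x ω|} ∂μ ≤ ENNReal.ofReal (2 * Real.pi * κ) := by
  have key : ∀ᵐ x ∂μ, ρ {ω | |t x - p| ≤ |Z x ω|}
      ≤ ENNReal.ofReal 2 * ENNReal.ofReal ((1 + (κ⁻¹ * (t x - p)) ^ 2)⁻¹) := by
    filter_upwards [hZκ, hZ] with x hx hm
    set q : ℝ := κ ^ 2 + (t x - p) ^ 2 with hq
    have hq0 : 0 < q := by positivity
    have h1 : {ω | |t x - p| ≤ |Z x ω|} ⊆
        {ω | ENNReal.ofReal q ≤ ENNReal.ofReal (Z x ω ^ 2) + ENNReal.ofReal (κ ^ 2)} := by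
      intro ω hω
      simp only [mem_ofPred_eq] at hω ⊢
      rw [← ENNReal.ofReal_add (by positivity) (by positivity)]
      apply ENNReal.ofReal_le_ofReal
      have := sq_le_sq.2 hω
      linarith
    have hq' : ENNReal.ofReal q ≠ 0 := by simpa using hq0
    calc ρ {ω | |t x - p| ≤ |Z x ω|} ≤ _ := measure_mono h1
      _ ≤ (∫⁻ ω, (ENNReal.ofReal (Z x ω ^ 2) + ENNReal.ofReal (κ ^ 2)) ∂ρ) / ENNReal.ofReal q :=
          meas_ge_le_lintegral_div (by fun_prop) hq' (by simp)
      _ ≤ ENNReal.ofReal (2 * κ ^ 2) / ENNReal.ofReal q := by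
          gcongr
          rw [lintegral_add_right' _ (by fun_prop), lintegral_const, measure_univ, mul_one, two_mul,
            ENNReal.ofReal_add (by positivity) (by positivity)]
          gcongr
      _ = _ := by
          rw [← ENNReal.ofReal_div_of_pos hq0, ← ENNReal.ofReal_mul (by norm_num)]
          congr 1
          rw [hq]
          field_simp
  calc ∫⁻ x, ρ {ω | |t x - p| ≤ |Z x ω|} ∂μ
      ≤ ∫⁻ x, ENNReal.ofReal 2 * ENNReal.ofReal ((1 + (κ⁻¹ * (t x - p)) ^ 2)⁻¹) ∂μ :=
        lintegral_mono_ae key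
    _ = ∫⁻ y, ENNReal.ofReal 2 * ENNReal.ofReal ((1 + (κ⁻¹ * (y - p)) ^ 2)⁻¹) ∂(μ.map t) := by
        rw [lintegral_map (by fun_prop) ht]
    _ ≤ ∫⁻ y, ENNReal.ofReal 2 * ENNReal.ofReal ((1 + (κ⁻¹ * (y - p)) ^ 2)⁻¹) :=
        lintegral_mono' hμt le_rfl
    _ = _ := by
        rw [lintegral_const_mul _ (by fun_prop), lintegral_cauchy_kernel (inv_pos.2 hκ),
          ← ENNReal.ofReal_mul (by norm_num)]
        congr 1
        field_simp

/-! ### The probability integral transform -/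

theorem continuous_cdf (ν : Measure ℝ) [IsProbabilityMeasure ν] [NullSingletonClass ν] :
    Continuous (cdf ν) := by
  rw [continuous_iff_continuousAt]
  intro x
  rw [(cdf ν).mono.continuousAt_iff_leftLim_eq_rightLim, StieltjesFunction.rightLim_eq]
  have h1 := StieltjesFunction.measure_singleton (cdf ν) x
  rw [measure_cdf, measure_singleton] at h1
  have h2 := ENNReal.ofReal_eq_zero.1 h1.symm
  have h3 := (cdf ν).mono.leftLim_le (le_refl x)
  linarith

theorem measure_cdf_le (ν : Measure ℝ) [IsProbabilityMeasure ν] [NullSingletonClass ν] {t : ℝ}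
    (ht1 : t < 1) : ν {u | cdf ν u ≤ t} ≤ ENNReal.ofReal t := by
  rcases eq_empty_or_nonempty {u | cdf ν u ≤ t} with h | h
  · simp [h]
  have hcl : IsClosed {u | cdf ν u ≤ t} := isClosed_le (continuous_cdf ν) continuous_const
  obtain ⟨w, hw⟩ := ((tendsto_order.1 (tendsto_cdf_atTop ν)).1 t ht1).exists
  have hbdd : BddAbove {u | cdf ν u ≤ t} := ⟨w, fun u hu => by
    by_contra hlt
    exact absurd ((monotone_cdf ν (not_le.1 hlt).le).trans hu) (not_le.2 hw)⟩
  have hz := hcl.csSup_mem h hbdd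
  calc ν {u | cdf ν u ≤ t} ≤ ν (Iic (sSup {u | cdf ν u ≤ t})) :=
        measure_mono fun u hu => le_csSup hbdd hu
    _ = ENNReal.ofReal (cdf ν _) := (ofReal_cdf ν _).symm
    _ ≤ _ := ENNReal.ofReal_le_ofReal hz

theorem measure_le_cdf (ν : Measure ℝ) [IsProbabilityMeasure ν] [NullSingletonClass ν] {t : ℝ}
    (ht0 : 0 < t) : ν {u | t ≤ cdf ν u} ≤ ENNReal.ofReal (1 - t) := by
  rcases eq_empty_or_nonempty {u | t ≤ cdf ν u} with h | h
  · simp [h]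
  have hcl : IsClosed {u | t ≤ cdf ν u} := isClosed_le continuous_const (continuous_cdf ν)
  obtain ⟨w, hw⟩ := ((tendsto_order.1 (tendsto_cdf_atBot ν)).2 t ht0).exists
  have hbdd : BddBelow {u | t ≤ cdf ν u} := ⟨w, fun u hu => by
    by_contra hlt
    exact absurd (le_trans hu (monotone_cdf ν (not_le.1 hlt).le)) (not_le.2 hw)⟩
  have hz := hcl.csInf_mem h hbdd
  set z := sInf {u | t ≤ cdf ν u}
  calc ν {u | t ≤ cdf ν u} ≤ ν (Ici z) := measure_mono fun u hu => csInf_le hbdd hu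
    _ = ν (Iic z)ᶜ := by rw [← Ioi_ae_eq_Ici.measure_eq, compl_Iic]
    _ = 1 - ENNReal.ofReal (cdf ν z) := by rw [prob_compl_eq_one_sub measurableSet_Iic, ofReal_cdf]
    _ = ENNReal.ofReal (1 - cdf ν z) := by
        rw [ENNReal.ofReal_sub _ (cdf_nonneg ν z), ENNReal.ofReal_one]
    _ ≤ _ := ENNReal.ofReal_le_ofReal (by have : t ≤ cdf ν z := hz; linarith)

theorem map_cdf_eq (ν : Measure ℝ) [IsProbabilityMeasure ν] [NullSingletonClass ν] :
    ν.map (cdf ν) = volume.restrict (Icc 0 1) := by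
  have hm : Measurable (cdf ν) := (monotone_cdf ν).measurable
  have : IsProbabilityMeasure (ν.map (cdf ν)) := Measure.isProbabilityMeasure_map hm.aemeasurable
  refine Measure.ext_of_Iic _ _ fun t => ?_
  rw [Measure.map_apply hm measurableSet_Iic, Measure.restrict_apply measurableSet_Iic]
  change ν {u | cdf ν u ≤ t} = _
  rcases lt_or_ge t 0 with ht | ht
  · have h1 : {u | cdf ν u ≤ t} = ∅ := by
      ext u; simpa using ht.trans_le (cdf_nonneg ν u)
    have h2 : Iic t ∩ Icc (0 : ℝ) 1 = ∅ := by
      ext u; simp only [mem_inter_iff, mem_Iic, mem_Icc, mem_empty_iff_false, iff_false]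
      intro h; linarith [h.1, h.2.1]
    simp [h1, h2]
  rcases le_or_gt 1 t with ht1 | ht1
  · have h1 : {u | cdf ν u ≤ t} = univ := by
      ext u; simpa using (cdf_le_one ν u).trans ht1
    have h2 : Iic t ∩ Icc (0 : ℝ) 1 = Icc 0 1 := by
      ext u; simp only [mem_inter_iff, mem_Iic, mem_Icc]
      constructor
      · exact fun h => h.2
      · exact fun h => ⟨h.2.trans ht1, h⟩
    simp [h1, h2]
  have h2 : Iic t ∩ Icc (0 : ℝ) 1 = Icc 0 t := by
    ext u; simp only [mem_inter_iff, mem_Iic, mem_Icc]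
    constructor
    · exact fun h => ⟨h.2.1, h.1⟩
    · exact fun h => ⟨h.2, h.1, h.2.trans ht1.le⟩
  rw [h2, Real.volume_Icc, sub_zero]
  refine le_antisymm (measure_cdf_le ν ht1) ?_
  refine le_of_forall_lt fun c hc => ?_
  obtain ⟨r, hr, hcr, hrt⟩ := ENNReal.lt_iff_exists_real_btwn.1 hc
  have hrt' : r < t := by
    rcases eq_or_lt_of_le ht with h0 | h0
    · simp [← h0] at hrt
    · exact (ENNReal.ofReal_lt_ofReal_iff h0).1 hrt
  by_cases ht0 : t = 0
  · simp [ht0] at hc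
  have ht0 : 0 < t := lt_of_le_of_ne ht (Ne.symm ht0)
  have h3 : {u | cdf ν u ≤ t}ᶜ ⊆ {u | t ≤ cdf ν u} := fun u hu => by
    simp only [mem_compl_iff, mem_ofPred_eq, not_le] at hu ⊢; exact hu.le
  have h4 := (measure_mono h3).trans (measure_le_cdf ν ht0)
  have hms : MeasurableSet {u | cdf ν u ≤ t} := measurableSet_le hm measurable_const
  rw [prob_compl_eq_one_sub hms, ENNReal.ofReal_sub _ ht, ENNReal.ofReal_one] at h4
  refine hcr.trans (hrt.trans_le ?_)
  have h5 : ENNReal.ofReal t ≤ 1 := by simpa using ht1.le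
  have h6 := (ENNReal.sub_le_sub_iff_left (a := 1) h5 ENNReal.one_ne_top).1 h4
  exact h6

/-! ### The mean of an i.i.d. sample -/

theorem integral_sq_mean_sub_le {E ι : Type*} [MeasurableSpace E] [Fintype ι] (μ : Measure E)
    [IsProbabilityMeasure μ] {φ : E → ℝ} (hφ : Measurable φ) {B : ℝ} (hB : ∀ x, |φ x| ≤ B)
    {J : Finset ι} (hJ : J.Nonempty) :
    ∫ X, ((∑ i ∈ J, φ (X i)) / J.card - ∫ x, φ x ∂μ) ^ 2 ∂(Measure.pi fun _ : ι => μ)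
      ≤ (∫ x, φ x ^ 2 ∂μ) / J.card := by
  classical
  have hm : (0 : ℝ) < J.card := by exact_mod_cast hJ.card_pos
  have hL : MemLp φ 2 μ := MemLp.of_bound hφ.aestronglyMeasurable B (ae_of_all _ hB)
  have hLi : ∀ i : ι, MemLp (fun X : ι → E => φ (X i)) 2 (Measure.pi fun _ : ι => μ) := fun i =>
    hL.comp_measurePreserving (measurePreserving_eval (fun _ : ι => μ) i)
  have hind : iIndepFun (fun (i : ι) (X : ι → E) => φ (X i)) (Measure.pi fun _ : ι => μ) :=
    iIndepFun_pi (fun _ => hφ.aemeasurable)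
  have hint : ∀ i : ι, ∫ X, φ (X i) ∂(Measure.pi fun _ : ι => μ) = ∫ x, φ x ∂μ := fun i => by
    rw [integral_comp_eval (μ := fun _ : ι => μ) (i := i) hφ.aestronglyMeasurable]
  have hv : Var[∑ i ∈ J, fun X : ι → E => φ (X i); Measure.pi fun _ : ι => μ]
      = J.card * Var[φ; μ] := by
    rw [IndepFun.variance_sum (fun i _ => hLi i) (fun i _ j _ hij => hind.indepFun hij)]
    rw [Finset.sum_congr rfl (g := fun _ => Var[φ; μ]), Finset.sum_const, nsmul_eq_mul]
    intro i _
    have h := variance_map (X := φ) (Y := fun X : ι → E => X i) (μ := Measure.pi fun _ : ι => μ)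
      hφ.aemeasurable (measurable_pi_apply i).aemeasurable
    rw [(measurePreserving_eval (fun _ : ι => μ) i).map_eq] at h
    exact h.symm
  have hmean : ∫ X, (∑ i ∈ J, fun X : ι → E => φ (X i)) X ∂(Measure.pi fun _ : ι => μ)
      = J.card * ∫ x, φ x ∂μ := by
    simp only [Finset.sum_apply]
    rw [integral_finsetSum _ (fun i _ => (hLi i).integrable (by norm_num))]
    simp [hint]
  rw [variance_eq_integral (by fun_prop)] at hv
  rw [hmean] at hv
  have h1 : ∀ X : ι → E, ((∑ i ∈ J, φ (X i)) / J.card - ∫ x, φ x ∂μ) ^ 2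
      = ((J.card : ℝ) ^ 2)⁻¹ *
        ((∑ i ∈ J, fun X : ι → E => φ (X i)) X - J.card * ∫ x, φ x ∂μ) ^ 2 := by
    intro X
    simp only [Finset.sum_apply]
    field_simp
  simp_rw [h1]
  rw [integral_const_mul, hv]
  have h2 : Var[φ; μ] ≤ ∫ x, φ x ^ 2 ∂μ := by
    have := variance_le_expectation_sq (μ := μ) (X := φ) hφ.aestronglyMeasurable
    simpa using this
  rw [div_eq_inv_mul]
  calc ((J.card : ℝ) ^ 2)⁻¹ * (J.card * Var[φ; μ]) = (J.card : ℝ)⁻¹ * Var[φ; μ] := by field_simp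
    _ ≤ _ := by gcongr

/-! ### Tails and second moments of empirical distribution functions -/

/-- A tail bound of polynomial order four at the scale `1 / √b`. -/
def PolyTail {Ω : Type*} [MeasurableSpace Ω] (ρ : Measure Ω) (W : Ω → ℝ) (b K : ℝ) : Prop :=
  ∀ δ, 0 ≤ δ → ρ.real {ω | δ ≤ |W ω|} ≤ (K * (1 + b * δ ^ 2)⁻¹) ^ 2

theorem exp_neg_le_two_mul_inv_sq {z : ℝ} (hz : 0 ≤ z) :
    Real.exp (-z) ≤ 2 * ((1 + z)⁻¹) ^ 2 := by
  have h := Real.quadratic_le_exp_of_nonneg hz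
  rw [Real.exp_neg, inv_pow, ← div_eq_mul_inv, le_div_iff₀ (by positivity),
    inv_mul_le_iff₀ (Real.exp_pos z)]
  nlinarith

/-- The constant in the polynomial tail bound of a jittered estimator. -/
def tailConst (c C Kσ : ℝ) : ℝ := 1 + 16 * Kσ ^ 2 + (1 + 2 * c) * (1 + 4 / C)

theorem polyTail_of_exp_tail {Ω : Type*} [MeasurableSpace Ω] {ρ : Measure Ω}
    [IsProbabilityMeasure ρ] {Δ : Ω → ℝ} {b c C Kσ s : ℝ} (hb : 0 < b) (hc : 0 < c) (hC : 0 < C)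
    (hs : |s| ≤ Kσ * (1 / √b))
    (hΔ : ∀ q : ℚ, 0 < q → ρ.real {ω | (q : ℝ) ≤ |Δ ω|} ≤ c * Real.exp (-C * b * (q : ℝ) ^ 2)) :
    PolyTail ρ (fun ω => s - Δ ω) b (tailConst c C Kσ) := by
  intro δ hδ
  have hsb : √b ^ 2 = b := Real.sq_sqrt hb.le
  have hbs : b * s ^ 2 ≤ Kσ ^ 2 := by
    have h1 : s ^ 2 ≤ (Kσ * (1 / √b)) ^ 2 := by
      rw [← sq_abs s]; exact pow_le_pow_left₀ (abs_nonneg s) hs 2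
    calc b * s ^ 2 ≤ b * (Kσ * (1 / √b)) ^ 2 := by gcongr
      _ = Kσ ^ 2 := by
        rw [mul_pow, div_pow, hsb]; field_simp
  have hden : 0 < 1 + b * δ ^ 2 := by positivity
  rcases le_or_gt δ (4 * |s|) with h | h
  · have h1 : b * δ ^ 2 ≤ 16 * Kσ ^ 2 := by
      have h2 : δ ^ 2 ≤ (4 * |s|) ^ 2 := pow_le_pow_left₀ hδ h 2
      rw [mul_pow, sq_abs] at h2
      nlinarith
    have h3 : 1 ≤ tailConst c C Kσ * (1 + b * δ ^ 2)⁻¹ := by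
      rw [← div_eq_mul_inv, one_le_div hden, tailConst]
      have : 0 < (1 + 2 * c) * (1 + 4 / C) := by positivity
      linarith
    exact measureReal_le_one.trans (one_le_pow₀ h3)
  · have hs0 := abs_nonneg s
    obtain ⟨q, hq1, hq2⟩ := exists_rat_btwn (show δ / 2 < 3 * δ / 4 by linarith)
    have hq0 : (0 : ℝ) < q := by linarith
    have hsub : {ω | δ ≤ |s - Δ ω|} ⊆ {ω | (q : ℝ) ≤ |Δ ω|} := by
      intro ω hω
      simp only [mem_ofPred_eq] at hω ⊢
      have := abs_sub s (Δ ω)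
      linarith
    have hz : 0 ≤ C * b * (q : ℝ) ^ 2 := by positivity
    have h1 : 1 + b * δ ^ 2 ≤ (1 + 4 / C) * (1 + C * b * (q : ℝ) ^ 2) := by
      have h2 : δ ^ 2 ≤ 4 * (q : ℝ) ^ 2 := by nlinarith
      have h3 : b * δ ^ 2 ≤ b * (4 * (q : ℝ) ^ 2) := by gcongr
      have h4 : (1 + 4 / C) * (1 + C * b * (q : ℝ) ^ 2)
        = 1 + C * b * (q : ℝ) ^ 2 + 4 / C + b * (4 * (q : ℝ) ^ 2) := by field_simp; ring
      have h5 : 0 < 4 / C := by positivity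
      rw [h4]; linarith
    have h6 : (1 + C * b * (q : ℝ) ^ 2)⁻¹ ≤ (1 + 4 / C) * (1 + b * δ ^ 2)⁻¹ := by
      rw [← div_eq_mul_inv, le_div_iff₀ hden, inv_mul_le_iff₀ (by positivity)]
      linarith
    calc ρ.real {ω | δ ≤ |s - Δ ω|} ≤ _ := measureReal_mono hsub
      _ ≤ c * Real.exp (-C * b * (q : ℝ) ^ 2) := hΔ q (by exact_mod_cast hq0)
      _ = c * Real.exp (-(C * b * (q : ℝ) ^ 2)) := by ring_nf
      _ ≤ c * (2 * ((1 + C * b * (q : ℝ) ^ 2)⁻¹) ^ 2) := by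
          gcongr; exact exp_neg_le_two_mul_inv_sq hz
      _ ≤ c * (2 * ((1 + 4 / C) * (1 + b * δ ^ 2)⁻¹) ^ 2) := by gcongr
      _ = (2 * c) * ((1 + 4 / C) * (1 + b * δ ^ 2)⁻¹) ^ 2 := by ring
      _ ≤ (1 + 2 * c) ^ 2 * ((1 + 4 / C) * (1 + b * δ ^ 2)⁻¹) ^ 2 := by
          gcongr; nlinarith
      _ = ((1 + 2 * c) * (1 + 4 / C) * (1 + b * δ ^ 2)⁻¹) ^ 2 := by ring
      _ ≤ _ := by
          unfold tailConst
          gcongr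
          have := sq_nonneg Kσ
          linarith

theorem PolyTail.lintegral_abs_le {Ω : Type*} [MeasurableSpace Ω] {ρ : Measure Ω}
    [IsProbabilityMeasure ρ] {W : Ω → ℝ} {b K : ℝ} (hW : PolyTail ρ W b K) (hb : 0 < b)
    (hm : AEMeasurable W ρ) :
    ∫⁻ ω, ENNReal.ofReal |W ω| ∂ρ ≤ ENNReal.ofReal (K ^ 2 * Real.pi * (1 / √b)) := by
  rw [lintegral_eq_lintegral_meas_le ρ (ae_of_all _ fun _ => abs_nonneg _) (by fun_prop)]
  have hsb : √b ^ 2 = b := Real.sq_sqrt hb.le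
  calc ∫⁻ t in Ioi 0, ρ {ω | t ≤ |W ω|}
      ≤ ∫⁻ t in Ioi 0, ENNReal.ofReal (K ^ 2) *
          ENNReal.ofReal ((1 + (√b * (t - 0)) ^ 2)⁻¹) := by
        refine setLIntegral_mono' measurableSet_Ioi fun t ht => ?_
        rw [← ofReal_measureReal, ← ENNReal.ofReal_mul (by positivity)]
        apply ENNReal.ofReal_le_ofReal
        refine (hW t (le_of_lt ht)).trans ?_
        rw [mul_pow, sub_zero, mul_pow √b, hsb]
        have h0 : 0 < 1 + b * t ^ 2 := by positivity
        have h1 : (1 + b * t ^ 2)⁻¹ ≤ 1 := inv_le_one_of_one_le₀ (by nlinarith [sq_nonneg t])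
        have h2 : 0 < (1 + b * t ^ 2)⁻¹ := by positivity
        gcongr
        nlinarith
    _ ≤ ∫⁻ t, ENNReal.ofReal (K ^ 2) * ENNReal.ofReal ((1 + (√b * (t - 0)) ^ 2)⁻¹) :=
        setLIntegral_le_lintegral _ _
    _ = _ := by
        rw [lintegral_const_mul _ (by fun_prop), lintegral_cauchy_kernel (Real.sqrt_pos.2 hb),
          ← ENNReal.ofReal_mul (by positivity)]
        congr 1; ring

theorem integral_sq_mean_indicator_le {Ω ι : Type*} [MeasurableSpace Ω] {ρ : Measure Ω}
    [IsProbabilityMeasure ρ] {A : ι → Set Ω} (hA : ∀ i, MeasurableSet (A i)) {h : ι → ℝ}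
    {J : Finset ι} (h0 : ∀ i ∈ J, 0 ≤ h i) (hρ : ∀ i ∈ J, ρ.real (A i) ≤ h i ^ 2) :
    ∫⁻ ω, ENNReal.ofReal (((∑ i ∈ J, (A i).indicator (fun _ => (1 : ℝ)) ω) / J.card) ^ 2) ∂ρ
      ≤ ENNReal.ofReal (((∑ i ∈ J, h i) / J.card) ^ 2) := by
  have hi : ∀ i j, Integrable ((A i ∩ A j).indicator fun _ => (1 : ℝ)) ρ := fun i j =>
    (integrable_const _).indicator ((hA i).inter (hA j))
  have h1 : ∀ ω, ((∑ i ∈ J, (A i).indicator (fun _ => (1 : ℝ)) ω) / J.card) ^ 2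
      = ((J.card : ℝ) ^ 2)⁻¹ * ∑ i ∈ J, ∑ j ∈ J, (A i ∩ A j).indicator (fun _ => (1 : ℝ)) ω := by
    intro ω
    rw [div_pow, sq (∑ i ∈ J, _), Finset.sum_mul_sum, div_eq_inv_mul]
    congr 1
    refine Finset.sum_congr rfl fun i _ => Finset.sum_congr rfl fun j _ => ?_
    by_cases hωi : ω ∈ A i <;> by_cases hωj : ω ∈ A j <;> simp [hωi, hωj]
  rw [← ofReal_integral_eq_lintegral_ofReal]
  · apply ENNReal.ofReal_le_ofReal
    simp_rw [h1]
    rw [integral_const_mul, integral_finsetSum _ fun i _ => integrable_finsetSum _ fun j _ => hi i j,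
      div_pow, div_eq_inv_mul, sq (∑ i ∈ J, h i), Finset.sum_mul_sum]
    gcongr with i hiJ
    rw [integral_finsetSum _ fun j _ => hi i j]
    gcongr with j hjJ
    rw [integral_indicator ((hA i).inter (hA j))]
    simp only [integral_const, MeasurableSet.univ, measureReal_restrict_apply, univ_inter,
      smul_eq_mul, mul_one]
    have ha : ρ.real (A i ∩ A j) ≤ h i ^ 2 :=
      (measureReal_mono inter_subset_left).trans (hρ i hiJ)
    have hb : ρ.real (A i ∩ A j) ≤ h j ^ 2 :=
      (measureReal_mono inter_subset_right).trans (hρ j hjJ)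
    rcases le_total (h i) (h j) with hij | hij
    · nlinarith [h0 i hiJ, h0 j hjJ]
    · nlinarith [h0 i hiJ, h0 j hjJ]
  · simp_rw [h1]
    exact (integrable_finsetSum _ fun i _ => integrable_finsetSum _ fun j _ => hi i j).const_mul _
  · exact ae_of_all _ fun ω => by positivity

theorem ecdf_le_one {ι : Type*} (J : Finset ι) (v : ι → ℝ) (t : ℝ) : ecdf J v t ≤ 1 := by
  unfold ecdf
  exact div_le_one_of_le₀ (by exact_mod_cast Finset.card_filter_le _ _) (by positivity)

theorem ecdf_eq_sum {ι : Type*} (J : Finset ι) (v : ι → ℝ) (t : ℝ) :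
    ecdf J v t = (∑ i ∈ J, if v i ≤ t then (1 : ℝ) else 0) / J.card := by
  unfold ecdf
  rw [Finset.card_filter]
  push_cast
  rfl

theorem measurable_ecdf {ι α : Type*} [MeasurableSpace α] (J : Finset ι) {v : α → ι → ℝ}
    {t : α → ℝ} (hv : ∀ i, Measurable fun a => v a i) (ht : Measurable t) :
    Measurable fun a => ecdf J (v a) (t a) := by
  simp_rw [ecdf_eq_sum]
  refine Measurable.div_const (Finset.measurable_sum _ fun i _ => ?_) _
  exact Measurable.ite (measurableSet_le (hv i) ht) measurable_const measurable_const

theorem ae_pi_of_ae {E ι : Type*} [MeasurableSpace E] [Fintype ι] {μ : Measure E}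
    [IsProbabilityMeasure μ] {p : ι → E → Prop} (h : ∀ i, ∀ᵐ x ∂μ, p i x) :
    ∀ᵐ X ∂(Measure.pi fun _ : ι => μ), ∀ i, p i (X i) :=
  ae_all_iff.2 fun i =>
    (measurePreserving_eval (fun _ : ι => μ) i).quasiMeasurePreserving.ae (h i)

/-- The constant in the second moment bound of empirical distribution functions. -/
def ecdfConst (K L : ℝ) : ℝ := 4 + 288 * K ^ 2 + 144 * K ^ 2 * L ^ 2 * Real.pi ^ 2

theorem lintegral_sq_ecdf_sub_le {Ω E ι : Type*} [MeasurableSpace Ω] [MeasurableSpace E]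
    [Fintype ι] {ρ : Measure Ω} [IsProbabilityMeasure ρ] {μ : Measure E} [IsProbabilityMeasure μ]
    {J : Finset ι} {sc : Ω → E → ι → ℝ} (hsc : ∀ i, Measurable fun q : Ω × E => sc q.1 q.2 i)
    {u : E → ℝ} (hu : Measurable u) {v : Ω → ℝ} (hv : Measurable v) (u₀ : ℝ) {b K L : ℝ}
    (hb : 0 < b) (hK : 0 ≤ K) (hL : 0 ≤ L)
    (htail : ∀ i, ∀ᵐ x ∂μ, PolyTail ρ (fun ω => sc ω x i - u x) b K)
    (htail₀ : PolyTail ρ (fun ω => v ω - u₀) b K)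
    (hdens : μ.map u ≤ ENNReal.ofReal L • volume) :
    ∫⁻ q, ENNReal.ofReal ((ecdf J (fun i => sc q.1 (q.2 i) i) (v q.1)
        - μ.real {x | u x ≤ u₀}) ^ 2) ∂(ρ.prod (Measure.pi fun _ : ι => μ))
      ≤ ENNReal.ofReal (ecdfConst K L * (1 / ((J.card : ℝ) + 1) + 1 / b)) := by
  have hK1 : 4 ≤ ecdfConst K L := by
    have : 0 ≤ 288 * K ^ 2 + 144 * K ^ 2 * L ^ 2 * Real.pi ^ 2 := by positivity
    unfold ecdfConst; linarith
  have hF0 : 0 ≤ μ.real {x | u x ≤ u₀} := measureReal_nonneg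
  have hF1 : μ.real {x | u x ≤ u₀} ≤ 1 := measureReal_le_one
  rcases J.eq_empty_or_nonempty with rfl | hJ
  · calc _ ≤ ∫⁻ q, 1 ∂(ρ.prod (Measure.pi fun _ : ι => μ)) := by
          refine lintegral_mono fun q => ?_
          rw [← ENNReal.ofReal_one]
          apply ENNReal.ofReal_le_ofReal
          simp only [ecdf, Finset.filter_empty, Finset.card_empty]
          norm_num
          exact abs_le.2 ⟨by linarith, hF1⟩
      _ = 1 := by simp
      _ ≤ _ := by
          rw [← ENNReal.ofReal_one]
          apply ENNReal.ofReal_le_ofReal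
          have : 0 < 1 / b := by positivity
          simp only [Finset.card_empty]
          norm_num
          have h2 : (0:ℝ) < b⁻¹ := by positivity
          nlinarith
  have hm : (0 : ℝ) < J.card := by exact_mod_cast hJ.card_pos
  have hm1 : (1 : ℝ) ≤ J.card := by exact_mod_cast hJ.card_pos
  set F := μ.real {x | u x ≤ u₀} with hF
  let A : ι → E → Set Ω := fun i x => {ω | |u x - u₀| ≤ |sc ω x i - u x| + |v ω - u₀|}
  let h : E → ℝ := fun x => 6 * K * (1 + b * (u x - u₀) ^ 2)⁻¹
  let I : E → ℝ := fun x => if u x ≤ u₀ then 1 else 0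
  have hhm : Measurable h := by fun_prop
  have hIm : Measurable I := Measurable.ite (measurableSet_le hu measurable_const)
    measurable_const measurable_const
  have hh0 : ∀ x, 0 ≤ h x := fun x => by positivity
  have hhle : ∀ x, h x ≤ 6 * K := fun x =>
    mul_le_of_le_one_right (by positivity) (inv_le_one_of_one_le₀ (by nlinarith [sq_nonneg (u x - u₀)]))
  have hIint : ∫ x, I x ∂μ = F := by
    have : I = {x | u x ≤ u₀}.indicator fun _ => (1 : ℝ) := by
      ext x; simp [I, indicator]
    rw [this, integral_indicator (measurableSet_le hu measurable_const)]
    simp [hF]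
  have hAm : ∀ i x, MeasurableSet (A i x) := fun i x => by
    have h1 : Measurable fun ω => sc ω x i := (hsc i).comp (measurable_id.prodMk measurable_const)
    exact measurableSet_le (by fun_prop) (by fun_prop)
  have hAh : ∀ i, ∀ᵐ x ∂μ, ρ.real (A i x) ≤ h x ^ 2 := by
    intro i
    filter_upwards [htail i] with x hx
    set δ := |u x - u₀| / 2 with hδ
    have hsub : A i x ⊆ {ω | δ ≤ |sc ω x i - u x|} ∪ {ω | δ ≤ |v ω - u₀|} := by
      intro ω hω
      simp only [A, mem_ofPred_eq, mem_union] at hω ⊢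
      by_contra hcon
      push Not at hcon
      linarith [hcon.1, hcon.2]
    have hδ0 : 0 ≤ δ := by positivity
    have hsq : δ ^ 2 = (u x - u₀) ^ 2 / 4 := by rw [hδ, div_pow, sq_abs]; norm_num
    have h1 : (1 + b * δ ^ 2)⁻¹ ≤ 4 * (1 + b * (u x - u₀) ^ 2)⁻¹ := by
      rw [hsq, ← div_eq_mul_inv, le_div_iff₀ (by positivity), inv_mul_le_iff₀ (by positivity)]
      linarith
    calc ρ.real (A i x) ≤ _ := measureReal_mono hsub
      _ ≤ _ := measureReal_union_le _ _
      _ ≤ (K * (1 + b * δ ^ 2)⁻¹) ^ 2 + (K * (1 + b * δ ^ 2)⁻¹) ^ 2 :=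
          add_le_add (hx δ hδ0) (htail₀ δ hδ0)
      _ ≤ (K * (4 * (1 + b * (u x - u₀) ^ 2)⁻¹)) ^ 2
          + (K * (4 * (1 + b * (u x - u₀) ^ 2)⁻¹)) ^ 2 := by gcongr
      _ ≤ h x ^ 2 := by
          simp only [h]
          nlinarith [sq_nonneg (K * (1 + b * (u x - u₀) ^ 2)⁻¹)]
  have hhint : ∫ x, h x ∂μ ≤ 6 * K * L * Real.pi / √b := by
    rw [integral_eq_lintegral_of_nonneg_ae (ae_of_all _ hh0) hhm.aestronglyMeasurable]
    refine ENNReal.toReal_le_of_le_ofReal (by positivity) ?_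
    have hsb : √b ^ 2 = b := Real.sq_sqrt hb.le
    calc ∫⁻ x, ENNReal.ofReal (h x) ∂μ
        = ∫⁻ x, ENNReal.ofReal (6 * K) *
            ENNReal.ofReal ((1 + (√b * (u x - u₀)) ^ 2)⁻¹) ∂μ := by
          refine lintegral_congr fun x => ?_
          rw [← ENNReal.ofReal_mul (by positivity), mul_pow √b, hsb]
      _ = ∫⁻ y, ENNReal.ofReal (6 * K) *
            ENNReal.ofReal ((1 + (√b * (y - u₀)) ^ 2)⁻¹) ∂(μ.map u) := by
          rw [lintegral_map (by fun_prop) hu]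
      _ ≤ ∫⁻ y, ENNReal.ofReal (6 * K) *
            ENNReal.ofReal ((1 + (√b * (y - u₀)) ^ 2)⁻¹) ∂(ENNReal.ofReal L • volume) :=
          lintegral_mono' hdens le_rfl
      _ = _ := by
          rw [lintegral_smul_measure, lintegral_const_mul _ (by fun_prop),
            lintegral_cauchy_kernel (Real.sqrt_pos.2 hb), smul_eq_mul,
            ← ENNReal.ofReal_mul (by positivity), ← ENNReal.ofReal_mul (by positivity)]
          congr 1; ring
  have hhint0 : 0 ≤ ∫ x, h x ∂μ := integral_nonneg hh0
  have hpt : ∀ q : Ω × (ι → E), (ecdf J (fun i => sc q.1 (q.2 i) i) (v q.1) - F) ^ 2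
      ≤ 2 * ((∑ i ∈ J, (A i (q.2 i)).indicator (fun _ => (1 : ℝ)) q.1) / J.card) ^ 2
        + 2 * ((∑ i ∈ J, I (q.2 i)) / J.card - F) ^ 2 := by
    rintro ⟨ω, X⟩
    have h1 : |ecdf J (fun i => sc ω (X i) i) (v ω) - (∑ i ∈ J, I (X i)) / J.card|
        ≤ (∑ i ∈ J, (A i (X i)).indicator (fun _ => (1 : ℝ)) ω) / J.card := by
      rw [ecdf_eq_sum, ← sub_div, abs_div, abs_of_pos hm, ← Finset.sum_sub_distrib]
      gcongr
      refine (Finset.abs_sum_le_sum_abs _ _).trans (Finset.sum_le_sum fun i _ => ?_)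
      by_cases hA : ω ∈ A i (X i)
      · rw [indicator_of_mem hA]
        simp only [I]
        split_ifs <;> norm_num
      · rw [indicator_of_notMem hA]
        simp only [A, mem_ofPred_eq, not_le] at hA
        have e1 := abs_sub_lt_iff.1 (lt_of_le_of_lt (le_add_of_nonneg_right (abs_nonneg _)) hA)
        have hiff : sc ω (X i) i ≤ v ω ↔ u (X i) ≤ u₀ := by
          have a1 := le_abs_self (sc ω (X i) i - u (X i))
          have a2 := neg_abs_le (sc ω (X i) i - u (X i))
          have a3 := le_abs_self (v ω - u₀)
          have a4 := neg_abs_le (v ω - u₀)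
          rcases abs_cases (u (X i) - u₀) with ⟨e, e'⟩ | ⟨e, e'⟩
          · constructor <;> intro <;> linarith
          · constructor <;> intro <;> linarith
        simp [I, hiff]
    have h2 := sq_le_sq' (by linarith [neg_abs_le (ecdf J (fun i => sc ω (X i) i) (v ω)
      - (∑ i ∈ J, I (X i)) / J.card)]) ((le_abs_self _).trans h1)
    simp only
    nlinarith [sq_nonneg ((ecdf J (fun i => sc ω (X i) i) (v ω) - (∑ i ∈ J, I (X i)) / J.card)
      - ((∑ i ∈ J, I (X i)) / J.card - F))]
  have hmeasA : Measurable fun q : Ω × (ι → E) =>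
      ENNReal.ofReal (((∑ i ∈ J, (A i (q.2 i)).indicator (fun _ => (1 : ℝ)) q.1) / J.card) ^ 2) := by
    have : ∀ i, Measurable fun q : Ω × (ι → E) =>
        (A i (q.2 i)).indicator (fun _ => (1 : ℝ)) q.1 := by
      intro i
      have h1 : Measurable fun q : Ω × (ι → E) => sc q.1 (q.2 i) i :=
        (hsc i).comp (measurable_fst.prodMk ((measurable_pi_apply i).comp measurable_snd))
      have h2 : Measurable fun q : Ω × (ι → E) => u (q.2 i) := by fun_prop
      have hset : MeasurableSet {q : Ω × (ι → E) |
          |u (q.2 i) - u₀| ≤ |sc q.1 (q.2 i) i - u (q.2 i)| + |v q.1 - u₀|} :=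
        measurableSet_le (by fun_prop) (by fun_prop)
      exact (measurable_const (a := (1 : ℝ))).indicator hset
    fun_prop
  have hpart1 : ∫⁻ q, ENNReal.ofReal (((∑ i ∈ J, (A i (q.2 i)).indicator (fun _ => (1 : ℝ)) q.1)
      / J.card) ^ 2) ∂(ρ.prod (Measure.pi fun _ : ι => μ))
      ≤ ∫⁻ X, ENNReal.ofReal (((∑ i ∈ J, h (X i)) / J.card) ^ 2)
          ∂(Measure.pi fun _ : ι => μ) := by
    rw [lintegral_prod_symm _ hmeasA.aemeasurable]
    refine lintegral_mono_ae ?_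
    filter_upwards [ae_pi_of_ae hAh] with X hX
    exact integral_sq_mean_indicator_le (fun i => hAm i (X i)) (fun i _ => hh0 _)
      (fun i _ => hX i)
  have hbound : ∀ (φ : E → ℝ) (B : ℝ), Measurable φ → 0 ≤ B → (∀ x, |φ x| ≤ B) →
      ∫⁻ X, ENNReal.ofReal (((∑ i ∈ J, φ (X i)) / J.card - ∫ x, φ x ∂μ) ^ 2)
        ∂(Measure.pi fun _ : ι => μ) ≤ ENNReal.ofReal (B ^ 2 / J.card) := by
    intro φ B hφ hB0 hB
    have hmeas : Measurable fun X : ι → E =>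
        ((∑ i ∈ J, φ (X i)) / J.card - ∫ x, φ x ∂μ) ^ 2 := by fun_prop
    rw [← ofReal_integral_eq_lintegral_ofReal]
    · refine ENNReal.ofReal_le_ofReal ((integral_sq_mean_sub_le μ hφ hB hJ).trans ?_)
      gcongr
      calc ∫ x, φ x ^ 2 ∂μ ≤ ∫ x, B ^ 2 ∂μ :=
            integral_mono_of_nonneg (ae_of_all _ fun x => by positivity) (integrable_const _)
              (ae_of_all _ fun x => sq_le_sq.2 (by rw [abs_of_nonneg hB0]; exact hB x))
        _ = B ^ 2 := by simp
    · refine Integrable.of_bound hmeas.aestronglyMeasurable ((B + B) ^ 2) (ae_of_all _ fun X => ?_)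
      rw [Real.norm_eq_abs, abs_pow]
      refine pow_le_pow_left₀ (abs_nonneg _) ?_ 2
      refine (abs_sub _ _).trans (add_le_add ?_ ?_)
      · rw [abs_div, abs_of_pos hm, div_le_iff₀ hm]
        refine (Finset.abs_sum_le_sum_abs _ _).trans ?_
        refine (Finset.sum_le_sum fun i _ => hB (X i)).trans ?_
        simp [mul_comm]
      · have := norm_integral_le_of_norm_le_const (μ := μ) (f := φ) (C := B) (ae_of_all μ hB)
        simpa using this
    · exact ae_of_all _ fun X => by positivity
  have hpart2 : ∫⁻ X, ENNReal.ofReal (((∑ i ∈ J, h (X i)) / J.card) ^ 2)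
      ∂(Measure.pi fun _ : ι => μ)
      ≤ ENNReal.ofReal (2 * ((6 * K) ^ 2 / J.card) + 2 * (6 * K * L * Real.pi / √b) ^ 2) := by
    calc _ ≤ ∫⁻ X, (ENNReal.ofReal 2 *
            ENNReal.ofReal (((∑ i ∈ J, h (X i)) / J.card - ∫ x, h x ∂μ) ^ 2)
            + ENNReal.ofReal (2 * (6 * K * L * Real.pi / √b) ^ 2))
            ∂(Measure.pi fun _ : ι => μ) := by
          refine lintegral_mono fun X => ?_
          rw [← ENNReal.ofReal_mul (by norm_num), ← ENNReal.ofReal_add (by positivity) (by positivity)]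
          apply ENNReal.ofReal_le_ofReal
          have h2 : (∫ x, h x ∂μ) ^ 2 ≤ (6 * K * L * Real.pi / √b) ^ 2 :=
            pow_le_pow_left₀ hhint0 hhint 2
          nlinarith [sq_nonneg ((∑ i ∈ J, h (X i)) / J.card - ∫ x, h x ∂μ - ∫ x, h x ∂μ)]
      _ ≤ _ := by
          rw [lintegral_add_right _ (by fun_prop), lintegral_const_mul _ (by fun_prop),
            lintegral_const, measure_univ, mul_one, ENNReal.ofReal_add (by positivity) (by positivity),
            ENNReal.ofReal_mul (p := 2) (q := (6 * K) ^ 2 / J.card) (by norm_num)]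
          gcongr
          exact hbound h (6 * K) hhm (by positivity)
            (fun x => by rw [abs_of_nonneg (hh0 x)]; exact hhle x)
  have hpart3 : ∫⁻ q, ENNReal.ofReal (((∑ i ∈ J, I (q.2 i)) / J.card - F) ^ 2)
      ∂(ρ.prod (Measure.pi fun _ : ι => μ)) ≤ ENNReal.ofReal (1 / J.card) := by
    rw [lintegral_prod_symm _ (by fun_prop)]
    simp only [lintegral_const, measure_univ, mul_one]
    have := hbound I 1 hIm zero_le_one (fun x => by simp only [I]; split_ifs <;> norm_num)
    rw [hIint] at this
    simpa using this
  have hsb : √b ^ 2 = b := Real.sq_sqrt hb.le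
  calc _ ≤ ∫⁻ q, (ENNReal.ofReal 2 *
          ENNReal.ofReal (((∑ i ∈ J, (A i (q.2 i)).indicator (fun _ => (1 : ℝ)) q.1) / J.card) ^ 2)
        + ENNReal.ofReal 2 * ENNReal.ofReal (((∑ i ∈ J, I (q.2 i)) / J.card - F) ^ 2))
        ∂(ρ.prod (Measure.pi fun _ : ι => μ)) := by
        refine lintegral_mono fun q => ?_
        rw [← ENNReal.ofReal_mul (by norm_num), ← ENNReal.ofReal_mul (by norm_num),
          ← ENNReal.ofReal_add (by positivity) (by positivity)]
        exact ENNReal.ofReal_le_ofReal (hpt q)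
    _ ≤ ENNReal.ofReal 2 *
          ENNReal.ofReal (2 * ((6 * K) ^ 2 / J.card) + 2 * (6 * K * L * Real.pi / √b) ^ 2)
        + ENNReal.ofReal 2 * ENNReal.ofReal (1 / J.card) := by
        rw [lintegral_add_left (by fun_prop), lintegral_const_mul _ hmeasA,
          lintegral_const_mul _ (by fun_prop)]
        gcongr
        exact hpart1.trans hpart2
    _ ≤ _ := by
        rw [← ENNReal.ofReal_mul (by norm_num), ← ENNReal.ofReal_mul (by norm_num),
          ← ENNReal.ofReal_add (by positivity) (by positivity)]
        apply ENNReal.ofReal_le_ofReal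
        have e1 : 1 / (J.card : ℝ) ≤ 2 * (1 / ((J.card : ℝ) + 1)) := by
          rw [mul_one_div, div_le_div_iff₀ hm (by positivity)]; linarith
        have e2 : (6 * K * L * Real.pi / √b) ^ 2 = 36 * K ^ 2 * L ^ 2 * Real.pi ^ 2 * (1 / b) := by
          rw [div_pow, hsb]; ring
        have e3 : (6 * K) ^ 2 / (J.card : ℝ) = 36 * K ^ 2 * (1 / J.card) := by ring
        rw [e2, e3]
        have p1 : 0 ≤ 1 / ((J.card : ℝ) + 1) := by positivity
        have p2 : 0 ≤ 1 / b := by positivity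
        set r := 1 / (J.card : ℝ)
        set r' := 1 / ((J.card : ℝ) + 1)
        set β := 1 / b
        have q1 : K ^ 2 * r ≤ K ^ 2 * (2 * r') := by gcongr
        have q2 : 0 ≤ K ^ 2 * L ^ 2 * Real.pi ^ 2 * r' := by positivity
        have q3 : 0 ≤ K ^ 2 * β := by positivity
        unfold ecdfConst
        nlinarith

/-! ### Quantile functions -/

/-- The set whose infimum is the quantile. -/
def quantileSet (F : ℝ → ℝ) (t : ℝ) : Set ℝ := {y | t ≤ F y ∧ 0 < F y}

theorem mem_quantileSet {F : ℝ → ℝ} {t y : ℝ} : y ∈ quantileSet F t ↔ t ≤ F y ∧ 0 < F y := Iff.rfl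

theorem mem_quantileSet_of_quantile_lt {F : ℝ → ℝ} (hF : Monotone F) {t y : ℝ}
    (hne : (quantileSet F t).Nonempty) (h : quantile F t < y) : y ∈ quantileSet F t := by
  obtain ⟨z, hz, hzy⟩ := exists_lt_of_csInf_lt hne h
  exact ⟨hz.1.trans (hF hzy.le), hz.2.trans_le (hF hzy.le)⟩

theorem notMem_quantileSet_of_lt_quantile {F : ℝ → ℝ} {t y : ℝ}
    (hbdd : BddBelow (quantileSet F t)) (h : y < quantile F t) : y ∉ quantileSet F t :=
  fun hy => absurd (csInf_le hbdd hy) (not_le.2 h)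

theorem measurable_quantile {α : Type*} [MeasurableSpace α] {F : α → ℝ → ℝ} {t : α → ℝ}
    (hF : ∀ a, Monotone (F a)) (hFm : ∀ y, Measurable fun a => F a y) (ht : Measurable t)
    (hne : ∀ a, (quantileSet (F a) (t a)).Nonempty)
    (hbdd : ∀ a, BddBelow (quantileSet (F a) (t a))) :
    Measurable fun a => quantile (F a) (t a) := by
  refine measurable_of_Iio fun y => ?_
  have : (fun a => quantile (F a) (t a)) ⁻¹' Iio y
      = ⋃ q : {q : ℚ // (q : ℝ) < y}, {a | t a ≤ F a q ∧ 0 < F a q} := by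
    ext a
    simp only [mem_preimage, mem_Iio, mem_iUnion, mem_ofPred_eq]
    constructor
    · intro h
      obtain ⟨q, hq1, hq2⟩ := exists_rat_btwn h
      exact ⟨⟨q, hq2⟩, mem_quantileSet_of_quantile_lt (hF a) (hne a) hq1⟩
    · rintro ⟨⟨q, hq⟩, h⟩
      exact lt_of_le_of_lt (csInf_le (hbdd a) h) hq
  rw [this]
  exact MeasurableSet.iUnion fun q =>
    (measurableSet_le ht (hFm _)).inter (measurableSet_lt measurable_const (hFm _))

theorem abs_sub_le_of_quantile_lt {F G : ℝ → ℝ} (hF : Monotone F) {s t y : ℝ} (ht : 0 ≤ t)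
    (hne : (quantileSet F s).Nonempty) (hbdd : BddBelow (quantileSet G t)) (hG : 0 ≤ G y)
    (h1 : quantile F s < y) (h2 : y < quantile G t) :
    |t - G y| ≤ |s - t| + |F y - G y| := by
  have m1 := mem_quantileSet_of_quantile_lt hF hne h1
  have m2 := notMem_quantileSet_of_lt_quantile hbdd h2
  rw [mem_quantileSet, not_and_or, not_le, not_lt] at m2
  have a1 := neg_abs_le (s - t)
  have a2 := le_abs_self (F y - G y)
  rcases m2 with m2 | m2
  · rw [abs_of_pos (by linarith)]; linarith [m1.1]
  · have h0 : G y = 0 := le_antisymm m2 hG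
    rw [h0] at a2 ⊢
    rw [sub_zero, abs_of_nonneg ht]; rw [sub_zero] at a2 ⊢; linarith [m1.1]

theorem abs_sub_le_of_lt_quantile {F G : ℝ → ℝ} (hG : Monotone G) {s t y : ℝ} (ht : 0 ≤ t)
    (hne : (quantileSet G t).Nonempty) (hbdd : BddBelow (quantileSet F s))
    (h1 : quantile G t < y) (h2 : y < quantile F s) :
    |t - G y| ≤ |s - t| + |F y - G y| := by
  have m1 := mem_quantileSet_of_quantile_lt hG hne h1
  have m2 := notMem_quantileSet_of_lt_quantile hbdd h2
  rw [mem_quantileSet, not_and_or, not_le, not_lt] at m2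
  have a1 := le_abs_self (s - t)
  have a2 := neg_abs_le (F y - G y)
  have a3 := abs_nonneg (s - t)
  rw [abs_of_nonpos (by linarith [m1.1])]
  rcases m2 with m2 | m2
  · linarith
  · linarith

/-! ### Quantiles of empirical distribution functions -/

theorem monotone_ecdf {ι : Type*} (J : Finset ι) (v : ι → ℝ) : Monotone (ecdf J v) := by
  intro y z hyz
  unfold ecdf
  gcongr

theorem nonempty_quantileSet_ecdf {ι : Type*} {J : Finset ι} (hJ : J.Nonempty) (v : ι → ℝ)
    {t : ℝ} (ht : t ≤ 1) : (quantileSet (ecdf J v) t).Nonempty := by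
  have h : ecdf J v (J.sup' hJ v) = 1 := by
    unfold ecdf
    rw [Finset.filter_true_of_mem fun i hi => Finset.le_sup' v hi]
    exact div_self (by exact_mod_cast hJ.card_pos.ne')
  exact ⟨_, by rw [h]; exact ht, by rw [h]; exact one_pos⟩

theorem bddBelow_quantileSet_ecdf {ι : Type*} {J : Finset ι} (hJ : J.Nonempty) (v : ι → ℝ)
    (t : ℝ) : BddBelow (quantileSet (ecdf J v) t) := by
  refine ⟨J.inf' hJ v, fun y hy => ?_⟩
  by_contra hlt
  have h : ecdf J v y = 0 := by
    unfold ecdf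
    rw [Finset.filter_false_of_mem fun i hi hi' => hlt ((Finset.inf'_le v hi).trans hi')]
    simp
  exact absurd hy.2 (by rw [h]; exact lt_irrefl _)

theorem quantile_ecdf_empty {ι : Type*} (v : ι → ℝ) (t : ℝ) : quantile (ecdf ∅ v) t = 0 := by
  unfold quantile ecdf
  simp

theorem measurable_quantile_ecdf {ι α : Type*} [MeasurableSpace α] (J : Finset ι) {v : α → ι → ℝ}
    {t : α → ℝ} (hv : ∀ i, Measurable fun a => v a i) (ht : Measurable t) (ht1 : ∀ a, t a ≤ 1) :
    Measurable fun a => quantile (ecdf J (v a)) (t a) := by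
  rcases J.eq_empty_or_nonempty with rfl | hJ
  · simp_rw [quantile_ecdf_empty]; exact measurable_const
  · exact measurable_quantile (fun a => monotone_ecdf J (v a))
      (fun y => measurable_ecdf J hv measurable_const) ht
      (fun a => nonempty_quantileSet_ecdf hJ _ (ht1 a))
      (fun a => bddBelow_quantileSet_ecdf hJ _ _)

theorem quantile_ecdf_eq_imp {ι : Type*} {J : Finset ι} (hJ : J.Nonempty) (v : ι → ℝ) {t z : ℝ}
    (ht1 : t ≤ 1) (h : quantile (ecdf J v) t = z) :
    (t ≤ ecdf J v z ∧ 0 < ecdf J v z) ∧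
      ¬ (t ≤ ((J.filter fun i => v i < z).card : ℝ) / J.card ∧
        0 < (J.filter fun i => v i < z).card) := by
  constructor
  · obtain ⟨y, hzy, hy⟩ : ∃ y, z < y ∧ ∀ i ∈ J, v i ≤ y → v i ≤ z := by
      rcases (J.filter fun i => z < v i).eq_empty_or_nonempty with he | hne
      · refine ⟨z + 1, by linarith, fun i hi _ => ?_⟩
        by_contra hlt
        have hmem : i ∈ J.filter fun i => z < v i := Finset.mem_filter.2 ⟨hi, not_le.1 hlt⟩
        rw [he] at hmem
        exact absurd hmem (Finset.notMem_empty i)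
      · have hlt : z < (J.filter fun i => z < v i).inf' hne v := by
          rw [Finset.lt_inf'_iff]
          exact fun i hi => (Finset.mem_filter.1 hi).2
        obtain ⟨y, hy1, hy2⟩ := exists_between hlt
        refine ⟨y, hy1, fun i hi hiy => ?_⟩
        by_contra hcon
        have hmem : i ∈ J.filter fun i => z < v i := Finset.mem_filter.2 ⟨hi, not_le.1 hcon⟩
        have := Finset.inf'_le v hmem
        linarith
    have heq : ecdf J v y = ecdf J v z := by
      unfold ecdf
      congr 3
      refine Finset.filter_congr fun i hi => ⟨hy i hi, fun h => h.trans hzy.le⟩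
    rw [← heq]
    exact mem_quantileSet_of_quantile_lt (monotone_ecdf J v) (nonempty_quantileSet_ecdf hJ v ht1)
      (by rw [h]; exact hzy)
  · rintro ⟨h1, h2⟩
    have hne := Finset.card_pos.1 h2
    set y := (J.filter fun i => v i < z).sup' hne v with hy
    have hyz : y < z := by
      rw [hy, Finset.sup'_lt_iff]
      exact fun i hi => (Finset.mem_filter.1 hi).2
    have heq : ecdf J v y = ((J.filter fun i => v i < z).card : ℝ) / J.card := by
      unfold ecdf
      congr 3
      refine Finset.filter_congr fun i hi => ⟨fun h => h.trans_lt hyz, fun h => ?_⟩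
      exact Finset.le_sup' v (Finset.mem_filter.2 ⟨hi, h⟩)
    have hJ0 : (0 : ℝ) < J.card := by exact_mod_cast hJ.card_pos
    refine notMem_quantileSet_of_lt_quantile (bddBelow_quantileSet_ecdf hJ v t)
      (by rw [h]; exact hyz) ⟨by rw [heq]; exact h1, ?_⟩
    rw [heq]
    have : (0 : ℝ) < (J.filter fun i => v i < z).card := by exact_mod_cast h2
    positivity

theorem sum_quantile_ecdf_le {ι : Type*} {J : Finset ι} (hJ : J.Nonempty) (v : ι → ℝ)
    {e : ℝ → ℝ} (he : ∀ z, 0 ≤ e z) (m : ℕ) :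
    ∑ k ∈ Finset.range (m + 1), e (quantile (ecdf J v) ((k : ℝ) / m))
      ≤ ((m : ℝ) / J.card + 2) * ∑ j ∈ J, e (v j) := by
  classical
  have hJ0 : (0 : ℝ) < J.card := by exact_mod_cast hJ.card_pos
  have hk1 : ∀ k ∈ Finset.range (m + 1), (k : ℝ) / m ≤ 1 := fun k hk => by
    have : k ≤ m := Nat.lt_succ_iff.1 (Finset.mem_range.1 hk)
    exact div_le_one_of_le₀ (by exact_mod_cast this) (by positivity)
  rw [Finset.sum_comp e v, Finset.sum_comp e fun k : ℕ => quantile (ecdf J v) ((k : ℝ) / m),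
    Finset.mul_sum]
  have hcard : ∀ z, ((J.filter fun i => v i ≤ z).card : ℝ)
      = (J.filter fun i => v i < z).card + (J.filter fun i => v i = z).card := by
    intro z
    rw [← Nat.cast_add, ← Finset.card_union_of_disjoint]
    · congr 2
      ext i
      simp only [Finset.mem_filter, Finset.mem_union, le_iff_lt_or_eq]
      tauto
    · rw [Finset.disjoint_filter]
      exact fun i _ h1 h2 => absurd h2 h1.ne
  have hpos : ∀ k ∈ Finset.range (m + 1),
      0 < (J.filter fun i => v i = quantile (ecdf J v) ((k : ℝ) / m)).card := by
    intro k hk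
    by_contra hcon
    have h0 := Nat.eq_zero_of_not_pos hcon
    obtain ⟨⟨h1, h2⟩, h3⟩ := quantile_ecdf_eq_imp hJ v (hk1 k hk) rfl
    have hc := hcard (quantile (ecdf J v) ((k : ℝ) / m))
    rw [h0, Nat.cast_zero, add_zero] at hc
    unfold ecdf at h1 h2
    unfold ecdf at hc h3
    rw [hc] at h1 h2
    refine h3 ⟨h1, ?_⟩
    by_contra h4
    rw [Nat.eq_zero_of_not_pos h4] at h2
    simp at h2
  have hsub : (Finset.range (m + 1)).image (fun k : ℕ => quantile (ecdf J v) ((k : ℝ) / m))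
      ⊆ J.image v := by
    intro z hz
    obtain ⟨k, hk, rfl⟩ := Finset.mem_image.1 hz
    obtain ⟨i, hi⟩ := Finset.card_pos.1 (hpos k hk)
    rw [Finset.mem_filter] at hi
    exact Finset.mem_image.2 ⟨i, hi.1, hi.2⟩
  refine (Finset.sum_le_sum fun z hz => ?_).trans
    (Finset.sum_le_sum_of_subset_of_nonneg hsub fun z _ _ => ?_)
  swap
  · have := he z
    positivity
  obtain ⟨k₀, hk₀, hz₀⟩ := Finset.mem_image.1 hz
  have hr := hpos k₀ hk₀
  rw [hz₀] at hr
  rw [nsmul_eq_mul, nsmul_eq_mul, ← mul_assoc]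
  refine mul_le_mul_of_nonneg_right ?_ (he z)
  set c₁ := (J.filter fun i => v i < z).card with hc₁
  set r := (J.filter fun i => v i = z).card with hrdef
  have hJn : 0 < J.card := hJ.card_pos
  have hfib : (Finset.range (m + 1)).filter (fun k : ℕ => quantile (ecdf J v) ((k : ℝ) / m) = z)
      ⊆ insert 0 (Finset.Ioc (c₁ * m / J.card) ((c₁ + r) * m / J.card)) := by
    intro k hk
    rw [Finset.mem_filter] at hk
    rw [Finset.mem_insert, Finset.mem_Ioc]
    rcases Nat.eq_zero_or_pos k with h0 | h0
    · exact Or.inl h0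
    right
    have hkm : k ≤ m := Nat.lt_succ_iff.1 (Finset.mem_range.1 hk.1)
    have hm0 : (0 : ℝ) < m := by exact_mod_cast h0.trans_le hkm
    obtain ⟨⟨h1, h2⟩, h3⟩ := quantile_ecdf_eq_imp hJ v (hk1 k hk.1) hk.2
    have hc := hcard z
    unfold ecdf at h1 h2
    rw [hc, div_le_div_iff₀ hm0 hJ0] at h1
    constructor
    · rw [Nat.div_lt_iff_lt_mul hJn]
      by_contra hcon
      have h5 : (k : ℝ) * J.card ≤ c₁ * m := by exact_mod_cast not_lt.1 hcon
      refine h3 ⟨by rw [div_le_div_iff₀ hm0 hJ0]; exact h5, ?_⟩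
      have : (0 : ℝ) < c₁ * m := lt_of_lt_of_le (by positivity) h5
      exact_mod_cast pos_of_mul_pos_left this hm0.le
    · rw [Nat.le_div_iff_mul_le hJn]
      exact_mod_cast h1
  have hle := (Finset.card_le_card hfib).trans (Finset.card_insert_le _ _)
  rw [Nat.card_Ioc] at hle
  have hA : (((c₁ + r) * m / J.card : ℕ) : ℝ) ≤ ((c₁ : ℝ) + r) * m / J.card := by
    refine Nat.cast_div_le.trans ?_
    push_cast; exact le_rfl
  have hB : (c₁ : ℝ) * m / J.card ≤ ((c₁ * m / J.card : ℕ) : ℝ) + 1 := by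
    have := Nat.lt_div_mul_add (a := c₁ * m) hJn
    rw [div_le_iff₀ hJ0]
    have h' : ((c₁ * m : ℕ) : ℝ) < ((c₁ * m / J.card * J.card + J.card : ℕ) : ℝ) := by
      exact_mod_cast this
    push_cast at h'
    linarith
  have hdiv : c₁ * m / J.card ≤ (c₁ + r) * m / J.card :=
    Nat.div_le_div_right (Nat.mul_le_mul_right _ (Nat.le_add_right _ _))
  have hle' : (((Finset.range (m + 1)).filter
      (fun k : ℕ => quantile (ecdf J v) ((k : ℝ) / m) = z)).card : ℝ)
      ≤ ((c₁ + r) * m / J.card : ℕ) - (c₁ * m / J.card : ℕ) + 1 := by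
    rw [← Nat.cast_sub hdiv]
    exact_mod_cast hle
  have hr1 : (1 : ℝ) ≤ r := by exact_mod_cast hr
  have e1 : ((c₁ : ℝ) + r) * m / J.card = c₁ * m / J.card + r * (m / J.card) := by ring
  have e2 : 0 ≤ (m : ℝ) / J.card := by positivity
  rw [e1] at hA
  nlinarith

/-! ### Ranks -/

theorem sum_rank {κ : Type*} (J : Finset κ) {V : κ → ℝ} (hV : InjOn V J) (φ : ℕ → ℝ) :
    ∑ a ∈ J, φ ((J.filter fun b => V b < V a).card) = ∑ k ∈ Finset.range J.card, φ k := by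
  classical
  have hlt : ∀ a ∈ J, ∀ b ∈ J, V a < V b →
      (J.filter fun c => V c < V a).card < (J.filter fun c => V c < V b).card := by
    intro a ha b _ hab
    refine Finset.card_lt_card ⟨fun c hc => ?_, fun h => ?_⟩
    · rw [Finset.mem_filter] at hc ⊢
      exact ⟨hc.1, hc.2.trans hab⟩
    · have := h (Finset.mem_filter.2 ⟨ha, hab⟩)
      exact lt_irrefl _ (Finset.mem_filter.1 this).2
  have hinj : InjOn (fun a => (J.filter fun b => V b < V a).card) J := by
    intro a ha b hb hab
    rcases lt_trichotomy (V a) (V b) with h | h | h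
    · exact absurd hab (hlt a ha b hb h).ne
    · exact hV ha hb h
    · exact absurd hab (hlt b hb a ha h).ne'
  have himg : J.image (fun a => (J.filter fun b => V b < V a).card) = Finset.range J.card := by
    refine Finset.eq_of_subset_of_card_le (fun k hk => ?_) ?_
    · obtain ⟨a, ha, rfl⟩ := Finset.mem_image.1 hk
      rw [Finset.mem_range]
      refine Finset.card_lt_card ⟨Finset.filter_subset _ _, fun h => ?_⟩
      exact lt_irrefl _ (Finset.mem_filter.1 (h ha)).2
    · rw [Finset.card_image_of_injOn hinj, Finset.card_range]
  rw [← himg, Finset.sum_image fun a ha b hb h => hinj ha hb h]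

theorem sum_ecdf_swap {ι : Type*} [DecidableEq ι] {J : Finset ι} {v : ι → ℝ} {w : ℝ}
    (hv : InjOn v J) (hw : ∀ i ∈ J, v i ≠ w) (ψ : ℝ → ℝ) :
    ψ (ecdf J v w) + ∑ i ∈ J, ψ (ecdf J (Function.update v i w) (v i))
      = ∑ k ∈ Finset.range (J.card + 1), ψ ((k : ℝ) / J.card) := by
  let V : Option ι → ℝ := fun a => a.elim w v
  have hV : InjOn V (Finset.insertNone J) := by
    rintro (_ | a) ha (_ | b) hb hab
    · rfl
    · exact absurd hab.symm (hw b (Finset.some_mem_insertNone.1 hb))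
    · exact absurd hab (hw a (Finset.some_mem_insertNone.1 ha))
    · exact congrArg some (hv (Finset.some_mem_insertNone.1 ha) (Finset.some_mem_insertNone.1 hb) hab)
  have key := sum_rank (Finset.insertNone J) hV fun k => ψ ((k : ℝ) / J.card)
  rw [Finset.card_insertNone, Finset.sum_insertNone] at key
  have hnone : ((Finset.insertNone J).filter fun b => V b < V none).card
      = (J.filter fun i => v i ≤ w).card := by
    rw [Finset.card_filter, Finset.sum_insertNone, Finset.card_filter]
    simp only [V, Option.elim, lt_irrefl, if_false, zero_add]
    refine Finset.sum_congr rfl fun i hi => ?_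
    exact if_congr (hw i hi).le_iff_lt.symm rfl rfl
  have hsome : ∀ i ∈ J, ((Finset.insertNone J).filter fun b => V b < V (some i)).card
      = (J.filter fun j => Function.update v i w j ≤ v i).card := by
    intro i hi
    rw [Finset.card_filter, Finset.sum_insertNone, Finset.card_filter,
      ← Finset.add_sum_erase J _ hi, ← Finset.add_sum_erase J _ hi]
    simp only [V, Option.elim, lt_irrefl, if_false, zero_add, Function.update_self]
    congr 1
    · exact if_congr (hw i hi).symm.le_iff_lt.symm rfl rfl
    · refine Finset.sum_congr rfl fun j hj => ?_
      rw [Finset.mem_erase] at hj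
      rw [Function.update_of_ne hj.1]
      have : v j ≠ v i := fun h => hj.1 (hv hj.2 hi h)
      exact if_congr this.le_iff_lt.symm rfl rfl
  rw [hnone, Finset.sum_congr rfl fun i hi => by rw [hsome i hi]] at key
  exact key

/-! ### Clipping -/

/-- The part of `|z|` that exceeds `M`. -/
def excess (M z : ℝ) : ℝ := max (|z| - M) 0

/-- Clipping to `[-M, M]`. -/
def clip (M z : ℝ) : ℝ := max (-M) (min M z)

theorem excess_nonneg (M z : ℝ) : 0 ≤ excess M z := le_max_right _ _

theorem abs_sub_le_clip_add_excess {M : ℝ} (hM : 0 ≤ M) (z q : ℝ) :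
    |z - q| ≤ |clip M z - q| + excess M z := by
  have h : |z - clip M z| ≤ excess M z := by
    unfold clip excess
    rcases le_total M z with h1 | h1
    · rw [min_eq_left h1, max_eq_right (by linarith), abs_of_nonneg (by linarith),
        abs_of_nonneg (by linarith)]
      exact le_max_left _ _
    · rw [min_eq_right h1]
      rcases le_total (-M) z with h2 | h2
      · rw [max_eq_right h2]; simp
      · rw [max_eq_left h2, abs_of_nonpos (by linarith : z ≤ 0), abs_of_nonpos (by linarith)]
        exact le_trans (by linarith) (le_max_left _ _)
  calc |z - q| = |(clip M z - q) + (z - clip M z)| := by ring_nf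
    _ ≤ _ := (abs_add_le _ _).trans (by linarith)

theorem ofReal_abs_clip_sub_le {M : ℝ} {z q : ℝ} (hq : q ∈ Icc (-M) M) :
    ENNReal.ofReal |clip M z - q|
      ≤ volume {y : ℝ | y ∈ Icc (-M) M ∧ ((z < y ∧ y < q) ∨ (q < y ∧ y < z))} := by
  rcases le_total (clip M z) q with h | h
  · rw [abs_of_nonpos (by linarith), neg_sub, ← Real.volume_Ioo]
    refine measure_mono fun y hy => ?_
    have h1 := hy.1
    unfold clip at h1
    rw [max_lt_iff, min_lt_iff] at h1
    have h2 : y < M := hy.2.trans_le hq.2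
    exact ⟨⟨h1.1.le, h2.le⟩, Or.inl ⟨h1.2.resolve_left (not_lt.2 h2.le), hy.2⟩⟩
  · rw [abs_of_nonneg (by linarith), ← Real.volume_Ioo]
    refine measure_mono fun y hy => ?_
    have h1 := hy.2
    unfold clip at h1
    rw [lt_max_iff, lt_min_iff] at h1
    have h2 : -M < y := hq.1.trans_lt hy.1
    have h3 := h1.resolve_left (not_lt.2 h2.le)
    exact ⟨⟨h2.le, h3.1.le⟩, Or.inr ⟨hy.1, h3.2⟩⟩

theorem measurable_excess (M : ℝ) : Measurable (excess M) := by
  unfold excess; fun_prop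

theorem measurable_clip (M : ℝ) : Measurable (clip M) := by
  unfold clip; fun_prop

/-! ### Resampling one coordinate of a product measure -/

/-- Overwriting (by `R`) the part of `a` that is read off by `g` with an independent draw from `μ`
does not change the law `A`. -/
structure IsRefresh {𝔸 E : Type*} [MeasurableSpace 𝔸] [MeasurableSpace E] (A : Measure 𝔸)
    (μ : Measure E) (R : 𝔸 → E → 𝔸) (g : 𝔸 → E) : Prop where
  measurable_set : Measurable fun q : 𝔸 × E => R q.1 q.2
  measurable_get : Measurable g
  set_set : ∀ a z w, R (R a z) w = R a w
  get_set : ∀ a z, g (R a z) = z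
  lintegral_eq : ∀ F : 𝔸 → ℝ≥0∞, Measurable F → ∫⁻ a, F a ∂A = ∫⁻ a, ∫⁻ z, F (R a z) ∂μ ∂A

theorem isRefresh_self {E : Type*} [MeasurableSpace E] (μ : Measure E) [IsProbabilityMeasure μ] :
    IsRefresh μ μ (fun _ z => z) id where
  measurable_set := measurable_snd
  measurable_get := measurable_id
  set_set _ _ _ := rfl
  get_set _ _ := rfl
  lintegral_eq F _ := by simp

theorem isRefresh_pi {ι : Type*} [Fintype ι] [DecidableEq ι] {α : ι → Type*}
    [∀ i, MeasurableSpace (α i)] (μ : ∀ i, Measure (α i)) [∀ i, IsProbabilityMeasure (μ i)]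
    (i : ι) : IsRefresh (Measure.pi μ) (μ i) (fun X z => Function.update X i z) (fun X => X i) where
  measurable_set := measurable_update'
  measurable_get := measurable_pi_apply i
  set_set _ _ _ := by simp
  get_set _ _ := by simp
  lintegral_eq F hF := by
    have hm : Measurable fun q : (∀ i, α i) × α i => Function.update q.1 i q.2 := measurable_update'
    have hmap : ((Measure.pi μ).prod (μ i)).map (fun q => Function.update q.1 i q.2)
        = Measure.pi μ := by
      refine (Measure.pi_eq fun t ht => ?_).symm
      rw [Measure.map_apply hm (MeasurableSet.univ_pi ht)]
      have : (fun q : (∀ i, α i) × α i => Function.update q.1 i q.2) ⁻¹' (univ.pi t)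
          = (univ.pi (Function.update t i univ)) ×ˢ (t i) := by
        ext ⟨X, z⟩
        simp only [mem_preimage, mem_pi, mem_univ, true_imp_iff, mem_prod]
        constructor
        · intro h
          refine ⟨fun j => ?_, by simpa using h i⟩
          by_cases hj : j = i
          · subst hj; simp
          · simpa [Function.update_of_ne hj] using h j
        · rintro ⟨h1, h2⟩ j
          by_cases hj : j = i
          · subst hj; simpa using h2
          · simpa [Function.update_of_ne hj] using h1 j
      rw [this, Measure.prod_prod, Measure.pi_pi, ← Finset.mul_prod_erase _ _ (Finset.mem_univ i),
        ← Finset.mul_prod_erase _ (fun j => μ j (t j)) (Finset.mem_univ i)]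
      simp only [Function.update_self, measure_univ, one_mul]
      rw [mul_comm]
      congr 1
      refine Finset.prod_congr rfl fun j hj => ?_
      rw [Function.update_of_ne (Finset.ne_of_mem_erase hj)]
    conv_lhs => rw [← hmap]
    rw [lintegral_map hF hm]
    exact lintegral_prod (fun q : (∀ i, α i) × α i => F (Function.update q.1 i q.2))
      (hF.comp hm).aemeasurable

theorem IsRefresh.comp {𝔸 𝔹 E : Type*} [MeasurableSpace 𝔸] [MeasurableSpace 𝔹]
    [MeasurableSpace E] {A : Measure 𝔸} {B : Measure 𝔹} {μ : Measure E} [SFinite μ] [SFinite B]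
    {R : 𝔸 → 𝔹 → 𝔸} {g : 𝔸 → 𝔹} {R' : 𝔹 → E → 𝔹} {g' : 𝔹 → E}
    (h : IsRefresh A B R g) (h' : IsRefresh B μ R' g') :
    IsRefresh A μ (fun a z => R a (R' (g a) z)) (fun a => g' (g a)) where
  measurable_set := by
    have h1 := h.measurable_set
    have h2 := h.measurable_get
    have h3 := h'.measurable_set
    exact h1.comp (measurable_fst.prodMk (h3.comp ((h2.comp measurable_fst).prodMk measurable_snd)))
  measurable_get := h'.measurable_get.comp h.measurable_get
  set_set a z w := by rw [h.set_set, h.get_set, h'.set_set]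
  get_set a z := by rw [h.get_set, h'.get_set]
  lintegral_eq F hF := by
    have h1 : Measurable fun q : 𝔸 × E => F (R q.1 (R' (g q.1) q.2)) :=
      hF.comp (h.measurable_set.comp (measurable_fst.prodMk (h'.measurable_set.comp
        ((h.measurable_get.comp measurable_fst).prodMk measurable_snd))))
    rw [h.lintegral_eq (fun a => ∫⁻ z, F (R a (R' (g a) z)) ∂μ) h1.lintegral_prod_right',
      h.lintegral_eq F hF]
    refine lintegral_congr fun a => ?_
    simp_rw [h.set_set, h.get_set]
    exact h'.lintegral_eq (fun y => F (R a y))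
      (hF.comp (h.measurable_set.comp (measurable_const.prodMk measurable_id)))

theorem IsRefresh.lintegral_swap {𝔸 𝔹 E : Type*} [MeasurableSpace 𝔸] [MeasurableSpace 𝔹]
    [MeasurableSpace E] {A : Measure 𝔸} {B : Measure 𝔹} {μ : Measure E} [SFinite μ] [SFinite A]
    [SFinite B] {R : 𝔸 → E → 𝔸} {g : 𝔸 → E} {R' : 𝔹 → E → 𝔹} {g' : 𝔹 → E}
    (h : IsRefresh A μ R g) (h' : IsRefresh B μ R' g') {F : 𝔸 × 𝔹 → ℝ≥0∞} (hF : Measurable F) :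
    ∫⁻ a, ∫⁻ b, F (R a (g' b), R' b (g a)) ∂B ∂A = ∫⁻ a, ∫⁻ b, F (a, b) ∂B ∂A := by
  have m1 := h.measurable_set
  have m2 := h'.measurable_set
  have m3 := h.measurable_get
  have m4 := h'.measurable_get
  have expand : ∀ G : 𝔸 × 𝔹 → ℝ≥0∞, Measurable G → ∫⁻ a, ∫⁻ b, G (a, b) ∂B ∂A
      = ∫⁻ a, ∫⁻ b, ∫⁻ z, ∫⁻ w, G (R a z, R' b w) ∂μ ∂μ ∂B ∂A := by
    intro G hG
    rw [h.lintegral_eq _ hG.lintegral_prod_right']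
    refine lintegral_congr fun a => ?_
    have e1 : ∀ z, ∫⁻ b, G (R a z, b) ∂B = ∫⁻ b, ∫⁻ w, G (R a z, R' b w) ∂μ ∂B := fun z =>
      h'.lintegral_eq (fun b => G (R a z, b)) (hG.comp (measurable_const.prodMk measurable_id))
    simp_rw [e1]
    refine lintegral_lintegral_swap ?_
    have : Measurable fun q : (E × 𝔹) × E => G (R a q.1.1, R' q.1.2 q.2) :=
      hG.comp ((m1.comp (measurable_const.prodMk (measurable_fst.comp measurable_fst))).prodMk
        (m2.comp ((measurable_snd.comp measurable_fst).prodMk measurable_snd)))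
    exact this.lintegral_prod_right'.aemeasurable
  have hF' : Measurable fun q : 𝔸 × 𝔹 => F (R q.1 (g' q.2), R' q.2 (g q.1)) :=
    hF.comp ((m1.comp (measurable_fst.prodMk (m4.comp measurable_snd))).prodMk
      (m2.comp (measurable_snd.prodMk (m3.comp measurable_fst))))
  rw [expand _ hF', expand _ hF]
  refine lintegral_congr fun a => lintegral_congr fun b => ?_
  simp only [h.set_set, h'.set_set, h.get_set, h'.get_set]
  refine lintegral_lintegral_swap ?_
  have : Measurable fun q : E × E => F (R a q.2, R' b q.1) :=
    hF.comp ((m1.comp (measurable_const.prodMk measurable_snd)).prodMk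
      (m2.comp (measurable_const.prodMk measurable_fst)))
  exact this.aemeasurable

theorem IsRefresh.measure_eq_zero {𝔸 E : Type*} [MeasurableSpace 𝔸] [MeasurableSpace E]
    {A : Measure 𝔸} {μ : Measure E} {R : 𝔸 → E → 𝔸} {g : 𝔸 → E} (h : IsRefresh A μ R g)
    {T : Set 𝔸} (hT : MeasurableSet T) (h0 : ∀ a, μ {z | R a z ∈ T} = 0) : A T = 0 := by
  rw [← lintegral_indicator_one hT, h.lintegral_eq _ (measurable_one.indicator hT)]
  refine (lintegral_congr fun a => ?_).trans lintegral_zero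
  have hm : MeasurableSet {z | R a z ∈ T} :=
    (h.measurable_set.comp (measurable_const.prodMk measurable_id)) hT
  rw [← h0 a, ← lintegral_indicator_one hm]
  rfl

/-! ### Jittered scores -/

instance : IsProbabilityMeasure unifLaw := by
  unfold unifLaw
  refine cond_isProbabilityMeasure_of_finite ?_ ?_ <;> simp

theorem unifLaw_absolutelyContinuous : unifLaw ≪ volume := by
  unfold unifLaw
  exact cond_absolutelyContinuous

theorem ae_mem_unifLaw : ∀ᵐ z ∂unifLaw, z ∈ Icc (-1 : ℝ) 1 :=
  ae_cond_mem measurableSet_Icc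

/-- The jittered predictions `g(X_i^s, s) + σ e_{is}`. -/
def score {E S ι : Type*} (g : E → S → ℝ) (σ : ℝ) (X : S → ι → E) (e : S → ι → ℝ) (s : S)
    (i : ι) : ℝ :=
  g (X s i) s + σ * e s i

theorem ecdf_congr {ι : Type*} {J : Finset ι} {v w : ι → ℝ} (h : ∀ i ∈ J, v i = w i) :
    ecdf J v = ecdf J w := by
  ext t
  unfold ecdf
  rw [Finset.filter_congr fun i hi => by rw [h i hi]]

theorem measurable_score {α E S ι : Type*} [MeasurableSpace E] [MeasurableSpace α] {g : α → E → S → ℝ}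
    (hg : ∀ s, Measurable fun q : α × E => g q.1 q.2 s) {X : α → S → ι → E} (hX : Measurable X)
    {e : α → S → ι → ℝ} (he : Measurable e) (σ : ℝ) (s : S) (i : ι) :
    Measurable fun a => score (g a) σ (X a) (e a) s i := by
  unfold score
  have h1 : Measurable fun a => g a (X a s i) s :=
    (hg s).comp (measurable_id.prodMk (by fun_prop : Measurable fun a => X a s i))
  have h2 : Measurable fun a => e a s i := by fun_prop
  fun_prop

section Excess

variable {E S ι : Type*} [MeasurableSpace E] [Fintype S] [DecidableEq S] [Fintype ι]
  [DecidableEq ι] (μ : S → Measure E) [∀ s, IsProbabilityMeasure (μ s)]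

theorem ae_score_ne {σ : ℝ} (hσ : σ ≠ 0) (s : S) {i : ι} {a : ℝ} {h : (S → ι → ℝ) → ℝ}
    (hm : Measurable h)
    (hh : ∀ e z, h (Function.update e s (Function.update (e s) i z)) = h e) :
    ∀ᵐ e ∂(Measure.pi fun _ : S => Measure.pi fun _ : ι => unifLaw), a + σ * e s i ≠ h e := by
  have hr := (isRefresh_pi (fun _ : S => Measure.pi fun _ : ι => unifLaw) s).comp
    (isRefresh_pi (fun _ : ι => unifLaw) i)
  have hms : MeasurableSet {e : S → ι → ℝ | a + σ * e s i = h e} :=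
    measurableSet_eq_fun (by fun_prop) hm
  rw [ae_iff]
  simp only [not_not]
  refine hr.measure_eq_zero hms fun e => ?_
  refine measure_mono_null (t := {(h e - a) / σ}) ?_ (unifLaw_absolutelyContinuous (by simp))
  intro z hz
  simp only [mem_ofPred_eq, Function.update_self, hh] at hz
  rw [mem_singleton_iff, ← hz]
  field_simp
  ring

/-- Replacing the entry `(s, i)` of `X` by `z`. -/
def overwrite {α : Type*} (s : S) (i : ι) (X : S → ι → α) (z : α) : S → ι → α :=
  Function.update X s (Function.update (X s) i z)

theorem isRefresh_overwrite {α : Type*} [MeasurableSpace α] (ν : S → Measure α)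
    [∀ s, IsProbabilityMeasure (ν s)] (s : S) (i : ι) :
    IsRefresh (Measure.pi fun s : S => Measure.pi fun _ : ι => ν s) (ν s) (overwrite s i)
      (fun X => X s i) :=
  (isRefresh_pi (fun s : S => Measure.pi fun _ : ι => ν s) s).comp
    (isRefresh_pi (fun _ : ι => ν s) i)

/-- The law of the features, the test point, and the jitters. -/
def swapLaw (s : S) : Measure (((S → ι → E) × E) × ((S → ι → ℝ) × (S → ℝ))) :=
  ((Measure.pi fun s : S => Measure.pi fun _ : ι => μ s).prod (μ s)).prod
    ((Measure.pi fun _ : S => Measure.pi fun _ : ι => unifLaw).prod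
      (Measure.pi fun _ : S => unifLaw))

instance (s : S) : IsProbabilityMeasure (swapLaw (ι := ι) μ s) := by
  unfold swapLaw; infer_instance

theorem ae_swapLaw_feature (s s' : S) (j : ι) {p : E → Prop} (hp : ∀ᵐ x ∂(μ s'), p x) :
    ∀ᵐ q ∂(swapLaw μ s), p (q.1.1 s' j) := by
  have h1 := (measurePreserving_eval (fun _ : ι => μ s') j).quasiMeasurePreserving.ae hp
  have h2 := (measurePreserving_eval (fun s : S => Measure.pi fun _ : ι => μ s)
    s').quasiMeasurePreserving.ae h1
  have h3 := (Measure.quasiMeasurePreserving_fst (ν := μ s)).ae h2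
  exact (Measure.quasiMeasurePreserving_fst
    (ν := (Measure.pi fun _ : S => Measure.pi fun _ : ι => unifLaw).prod
      (Measure.pi fun _ : S => unifLaw))).ae h3

theorem ae_swapLaw_jitter (s s' : S) (j : ι) :
    ∀ᵐ q ∂(swapLaw μ s), q.2.1 s' j ∈ Icc (-1 : ℝ) 1 := by
  have h1 := (measurePreserving_eval (fun _ : ι => unifLaw) j).quasiMeasurePreserving.ae
    ae_mem_unifLaw
  have h2 := (measurePreserving_eval (fun _ : S => Measure.pi fun _ : ι => unifLaw)
    s').quasiMeasurePreserving.ae h1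
  have h3 := (Measure.quasiMeasurePreserving_fst (ν := Measure.pi fun _ : S => unifLaw)).ae h2
  exact (Measure.quasiMeasurePreserving_snd
    (μ := (Measure.pi fun s : S => Measure.pi fun _ : ι => μ s).prod (μ s))).ae h3

/-- Exchanging the test point, and its jitter, with the point `i` of group `s`. -/
def swapTest (s : S) (i : ι) (q : ((S → ι → E) × E) × ((S → ι → ℝ) × (S → ℝ))) :
    ((S → ι → E) × E) × ((S → ι → ℝ) × (S → ℝ)) :=
  ((overwrite s i q.1.1 q.1.2, q.1.1 s i),
    (overwrite s i q.2.1 (q.2.2 s), Function.update q.2.2 s (q.2.1 s i)))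

theorem measurable_overwrite {α : Type*} [MeasurableSpace α] (s : S) (i : ι) :
    Measurable fun q : (S → ι → α) × α => overwrite s i q.1 q.2 := by
  unfold overwrite
  refine measurable_pi_iff.2 fun s' => measurable_pi_iff.2 fun j => ?_
  by_cases hs : s' = s
  · subst hs
    by_cases hj : j = i
    · subst hj; simpa using measurable_snd
    · simp only [Function.update_self, Function.update_of_ne hj]; fun_prop
  · simp only [Function.update_of_ne hs]; fun_prop

theorem measurable_swapTest (s : S) (i : ι) : Measurable (swapTest (E := E) s i) := by
  refine Measurable.prodMk (Measurable.prodMk ?_ (by fun_prop)) (Measurable.prodMk ?_ ?_)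
  · exact (measurable_overwrite s i).comp measurable_fst
  · exact (measurable_overwrite s i).comp
      (f := fun q : ((S → ι → E) × E) × ((S → ι → ℝ) × (S → ℝ)) => (q.2.1, q.2.2 s)) (by fun_prop)
  · exact (measurable_update' (a := s)).comp
      (f := fun q : ((S → ι → E) × E) × ((S → ι → ℝ) × (S → ℝ)) => (q.2.2, q.2.1 s i))
      (by fun_prop)

theorem lintegral_swapLaw (s : S) {G : ((S → ι → E) × E) × ((S → ι → ℝ) × (S → ℝ)) → ℝ≥0∞}
    (hG : Measurable G) :
    ∫⁻ q, G q ∂(swapLaw μ s) = ∫⁻ X, ∫⁻ x, ∫⁻ e, ∫⁻ e₀, G ((X, x), (e, e₀))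
      ∂(Measure.pi fun _ : S => unifLaw)
      ∂(Measure.pi fun _ : S => Measure.pi fun _ : ι => unifLaw)
      ∂(μ s) ∂(Measure.pi fun s : S => Measure.pi fun _ : ι => μ s) := by
  unfold swapLaw
  rw [lintegral_prod _ hG.aemeasurable, lintegral_prod _ hG.lintegral_prod_right'.aemeasurable]
  refine lintegral_congr fun X => lintegral_congr fun x => ?_
  exact lintegral_prod _ (hG.comp (measurable_const.prodMk measurable_id)).aemeasurable

theorem lintegral_swapTest (s : S) (i : ι)
    {G : ((S → ι → E) × E) × ((S → ι → ℝ) × (S → ℝ)) → ℝ≥0∞} (hG : Measurable G) :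
    ∫⁻ q, G (swapTest s i q) ∂(swapLaw μ s) = ∫⁻ q, G q ∂(swapLaw μ s) := by
  rw [lintegral_swapLaw μ s (G := fun q => G (swapTest s i q))
    (hG.comp (measurable_swapTest s i)), lintegral_swapLaw μ s hG]
  have h1 : ∀ (X : S → ι → E) (x : E), ∫⁻ e, ∫⁻ e₀, G ((X, x), (overwrite s i e (e₀ s),
        Function.update e₀ s (e s i))) ∂(Measure.pi fun _ : S => unifLaw)
        ∂(Measure.pi fun _ : S => Measure.pi fun _ : ι => unifLaw)
      = ∫⁻ e, ∫⁻ e₀, G ((X, x), (e, e₀)) ∂(Measure.pi fun _ : S => unifLaw)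
        ∂(Measure.pi fun _ : S => Measure.pi fun _ : ι => unifLaw) := fun X x =>
    (isRefresh_overwrite (fun _ : S => unifLaw) s i).lintegral_swap
      (isRefresh_pi (fun _ : S => unifLaw) s) (F := fun q => G ((X, x), q))
      (hG.comp (measurable_const.prodMk measurable_id))
  have hm : Measurable fun q : (S → ι → E) × E => ∫⁻ e, ∫⁻ e₀, G (q, (e, e₀))
      ∂(Measure.pi fun _ : S => unifLaw)
      ∂(Measure.pi fun _ : S => Measure.pi fun _ : ι => unifLaw) := by
    have h2 := hG.lintegral_prod_right' (ν := (Measure.pi fun _ : S => Measure.pi fun _ : ι =>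
      unifLaw).prod (Measure.pi fun _ : S => unifLaw))
    convert h2 using 2 with q
    exact (lintegral_prod _ (hG.comp (measurable_const.prodMk measurable_id)).aemeasurable).symm
  refine Eq.trans (lintegral_congr fun X => lintegral_congr fun x => ?_)
    ((isRefresh_overwrite μ s i).lintegral_swap (isRefresh_self (μ s)) hm)
  exact h1 (overwrite s i X x) (X s i)

theorem card_add_one_mul_lintegral (s : S) (J : Finset ι)
    {G : ((S → ι → E) × E) × ((S → ι → ℝ) × (S → ℝ)) → ℝ≥0∞} (hG : Measurable G) :
    ((J.card : ℝ≥0∞) + 1) * ∫⁻ q, G q ∂(swapLaw μ s)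
      = ∫⁻ q, (G q + ∑ i ∈ J, G (swapTest s i q)) ∂(swapLaw μ s) := by
  rw [lintegral_add_left hG, lintegral_finsetSum J (f := fun i q => G (swapTest s i q))
      fun i _ => hG.comp (measurable_swapTest s i),
    Finset.sum_congr rfl fun i _ => lintegral_swapTest μ s i hG, Finset.sum_const, nsmul_eq_mul]
  ring

theorem score_swapTest {g : E → S → ℝ} {σ : ℝ} (s : S) (i : ι)
    (q : ((S → ι → E) × E) × ((S → ι → ℝ) × (S → ℝ))) :
    score g σ (swapTest s i q).1.1 (swapTest s i q).2.1 s
      = Function.update (score g σ q.1.1 q.2.1 s) i (g q.1.2 s + σ * q.2.2 s) := by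
  ext j
  by_cases hj : j = i
  · subst hj; simp [score, swapTest, overwrite]
  · simp [score, swapTest, overwrite, Function.update_of_ne hj]

theorem score_swapTest_of_ne {g : E → S → ℝ} {σ : ℝ} {s s' : S} (hs : s' ≠ s) (i : ι)
    (q : ((S → ι → E) × E) × ((S → ι → ℝ) × (S → ℝ))) :
    score g σ (swapTest s i q).1.1 (swapTest s i q).2.1 s' = score g σ q.1.1 q.2.1 s' := by
  ext j
  simp [score, swapTest, overwrite, Function.update_of_ne hs]

theorem ae_swapLaw (s : S) {p : ((S → ι → E) × E) × ((S → ι → ℝ) × (S → ℝ)) → Prop}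
    (hp : MeasurableSet {q | p q})
    (h : ∀ X x e₀, ∀ᵐ e ∂(Measure.pi fun _ : S => Measure.pi fun _ : ι => unifLaw),
      p ((X, x), (e, e₀))) : ∀ᵐ q ∂(swapLaw μ s), p q := by
  unfold swapLaw
  rw [Measure.ae_prod_iff_ae_ae hp]
  refine ae_of_all _ fun y => ?_
  have hp' : MeasurableSet {r : (S → ι → ℝ) × (S → ℝ) | p (y, r)} := measurable_prodMk_left hp
  rw [Measure.ae_prod_iff_ae_ae hp', Measure.ae_ae_comm hp']
  exact ae_of_all _ fun e₀ => h y.1 y.2 e₀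

theorem ae_score_no_ties {g : E → S → ℝ} (hg : ∀ s, Measurable fun x => g x s) {σ : ℝ}
    (hσ : σ ≠ 0) (s : S) (J : Finset ι) :
    ∀ᵐ q ∂(swapLaw μ s), InjOn (score g σ q.1.1 q.2.1 s) J ∧
      ∀ i ∈ J, score g σ q.1.1 q.2.1 s i ≠ g q.1.2 s + σ * q.2.2 s := by
  have hs : ∀ s i, Measurable fun q : ((S → ι → E) × E) × ((S → ι → ℝ) × (S → ℝ)) =>
      score g σ q.1.1 q.2.1 s i := fun s i =>
    measurable_score (g := fun _ => g) (fun s => (hg s).comp measurable_snd)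
      (by fun_prop) (by fun_prop) σ s i
  have hx : Measurable fun q : ((S → ι → E) × E) × ((S → ι → ℝ) × (S → ℝ)) => g q.1.2 s :=
    (hg s).comp (by fun_prop)
  have h1 : ∀ᵐ q ∂(swapLaw (ι := ι) μ s), ∀ i, score g σ q.1.1 q.2.1 s i ≠ g q.1.2 s + σ * q.2.2 s := by
    rw [ae_all_iff]
    intro i
    refine ae_swapLaw μ s
      (measurableSet_eq_fun (hs s i) (by fun_prop)).compl fun X x e₀ => ?_
    exact ae_score_ne (a := g (X s i) s) (i := i) hσ s (h := fun _ => g x s + σ * e₀ s)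
      measurable_const fun _ _ => rfl
  have h2 : ∀ᵐ q ∂(swapLaw (ι := ι) μ s), ∀ i j, i ≠ j →
      score g σ q.1.1 q.2.1 s i ≠ score g σ q.1.1 q.2.1 s j := by
    rw [ae_all_iff]
    intro i
    rw [ae_all_iff]
    intro j
    by_cases hij : i = j
    · exact ae_of_all _ fun e h => absurd hij h
    have : ∀ᵐ q ∂(swapLaw μ s), score g σ q.1.1 q.2.1 s i ≠ score g σ q.1.1 q.2.1 s j := by
      refine ae_swapLaw μ s (measurableSet_eq_fun (hs s i) (hs s j)).compl fun X x e₀ => ?_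
      exact ae_score_ne (a := g (X s i) s) (i := i) hσ s
        (h := fun e => score g σ X e s j) (by unfold score; fun_prop)
        (fun e z => by simp [score, Function.update_of_ne (Ne.symm hij)])
    filter_upwards [this] with q hq _ using hq
  filter_upwards [h1, h2] with q hq1 hq2
  refine ⟨fun i _ j _ hij => ?_, fun i _ => hq1 i⟩
  by_contra hne
  exact hq2 i j hne hij

theorem lintegral_quantile_ecdf_le {g : E → S → ℝ} (hg : ∀ s, Measurable fun x => g x s) {σ : ℝ}
    (hσ : σ ≠ 0) (s s' : S) {J J' : Finset ι} (hJ' : J'.Nonempty)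
    (hdisj : s = s' → Disjoint J J') {φ : ℝ → ℝ} (hφ : Measurable φ) (hφ0 : ∀ z, 0 ≤ φ z) :
    ∫⁻ q, ENNReal.ofReal (φ (quantile (ecdf J' (score g σ q.1.1 q.2.1 s'))
          (ecdf J (score g σ q.1.1 q.2.1 s) (g q.1.2 s + σ * q.2.2 s)))) ∂(swapLaw μ s)
      ≤ ENNReal.ofReal ((((J.card : ℝ) / J'.card + 2)) / (J.card + 1)) *
        ∫⁻ q, ENNReal.ofReal (∑ j ∈ J', φ (score g σ q.1.1 q.2.1 s' j)) ∂(swapLaw μ s) := by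
  have hs : ∀ s i, Measurable fun q : ((S → ι → E) × E) × ((S → ι → ℝ) × (S → ℝ)) =>
      score g σ q.1.1 q.2.1 s i := fun s i =>
    measurable_score (g := fun _ => g) (fun s => (hg s).comp measurable_snd)
      (by fun_prop) (by fun_prop) σ s i
  have hx : Measurable fun q : ((S → ι → E) × E) × ((S → ι → ℝ) × (S → ℝ)) => g q.1.2 s :=
    (hg s).comp (by fun_prop)
  have hG : Measurable fun q : ((S → ι → E) × E) × ((S → ι → ℝ) × (S → ℝ)) =>
      ENNReal.ofReal (φ (quantile (ecdf J' (score g σ q.1.1 q.2.1 s'))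
          (ecdf J (score g σ q.1.1 q.2.1 s) (g q.1.2 s + σ * q.2.2 s)))) :=
    ENNReal.measurable_ofReal.comp (hφ.comp (measurable_quantile_ecdf J' (hs s')
      (measurable_ecdf J (hs s) (by fun_prop)) fun a => ecdf_le_one _ _ _))
  have hval : ∀ i ∈ J, ∀ q : ((S → ι → E) × E) × ((S → ι → ℝ) × (S → ℝ)),
      ENNReal.ofReal (φ (quantile
        (ecdf J' (score g σ (swapTest s i q).1.1 (swapTest s i q).2.1 s'))
        (ecdf J (score g σ (swapTest s i q).1.1 (swapTest s i q).2.1 s)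
          (g (swapTest s i q).1.2 s + σ * (swapTest s i q).2.2 s))))
      = ENNReal.ofReal (φ (quantile (ecdf J' (score g σ q.1.1 q.2.1 s'))
        (ecdf J (Function.update (score g σ q.1.1 q.2.1 s) i (g q.1.2 s + σ * q.2.2 s))
          (score g σ q.1.1 q.2.1 s i)))) := by
    intro i hi q
    have e2 : ecdf J' (score g σ (swapTest s i q).1.1 (swapTest s i q).2.1 s')
        = ecdf J' (score g σ q.1.1 q.2.1 s') := by
      refine ecdf_congr fun j hj => ?_
      by_cases hss : s' = s
      · subst hss
        rw [score_swapTest, Function.update_of_ne]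
        rintro rfl
        exact Finset.disjoint_left.1 (hdisj rfl) hi hj
      · rw [score_swapTest_of_ne hss]
    have e3 : g (swapTest s i q).1.2 s + σ * (swapTest s i q).2.2 s
        = score g σ q.1.1 q.2.1 s i := by
      simp [swapTest, score]
    rw [e2, e3, score_swapTest]
  have hJ0 : (0 : ℝ) < J.card + 1 := by positivity
  have hRm : Measurable fun q : ((S → ι → E) × E) × ((S → ι → ℝ) × (S → ℝ)) =>
      ENNReal.ofReal (∑ j ∈ J', φ (score g σ q.1.1 q.2.1 s' j)) :=
    ENNReal.measurable_ofReal.comp (Finset.measurable_sum _ fun j _ => hφ.comp (hs s' j))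
  have hJt : (J.card : ℝ≥0∞) + 1 = ENNReal.ofReal ((J.card : ℝ) + 1) := by
    rw [ENNReal.ofReal_add (by positivity) (by norm_num)]; simp
  have hfin := card_add_one_mul_lintegral μ s J hG
  have hle : ∫⁻ q, (ENNReal.ofReal (φ (quantile (ecdf J' (score g σ q.1.1 q.2.1 s'))
          (ecdf J (score g σ q.1.1 q.2.1 s) (g q.1.2 s + σ * q.2.2 s)))) + ∑ i ∈ J,
        ENNReal.ofReal (φ (quantile
          (ecdf J' (score g σ (swapTest s i q).1.1 (swapTest s i q).2.1 s'))
          (ecdf J (score g σ (swapTest s i q).1.1 (swapTest s i q).2.1 s)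
            (g (swapTest s i q).1.2 s + σ * (swapTest s i q).2.2 s))))) ∂(swapLaw μ s)
      ≤ ENNReal.ofReal ((J.card : ℝ) / J'.card + 2) *
        ∫⁻ q, ENNReal.ofReal (∑ j ∈ J', φ (score g σ q.1.1 q.2.1 s' j)) ∂(swapLaw μ s) := by
    rw [← lintegral_const_mul _ hRm]
    refine lintegral_mono_ae ?_
    filter_upwards [ae_score_no_ties μ hg hσ s J] with q hq
    rw [Finset.sum_congr rfl fun i hi => hval i hi q,
      ← ENNReal.ofReal_sum_of_nonneg fun i _ => hφ0 _,
      ← ENNReal.ofReal_add (hφ0 _) (Finset.sum_nonneg fun i _ => hφ0 _),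
      ← ENNReal.ofReal_mul (by positivity)]
    apply ENNReal.ofReal_le_ofReal
    rw [sum_ecdf_swap hq.1 hq.2 fun t => φ (quantile (ecdf J' (score g σ q.1.1 q.2.1 s')) t)]
    exact sum_quantile_ecdf_le hJ' _ hφ0 _
  have hfin' := hfin.trans_le hle
  rw [hJt, mul_comm, ← ENNReal.le_div_iff_mul_le (by left; simpa using hJ0) (by left; simp),
    ENNReal.div_eq_inv_mul] at hfin'
  rw [ENNReal.ofReal_div_of_pos hJ0, ENNReal.div_eq_inv_mul, mul_assoc]
  exact hfin'

end Excess

/-! ### Plug-in ranks and quantiles -/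

/-- The properties of an estimator `fh` of `f`, built from data of law `ρ`, on which the rate of the
plug-in quantiles depends. -/
structure PluginSetting {𝒟 E S : Type*} [MeasurableSpace 𝒟] [MeasurableSpace E] (ρ : Measure 𝒟)
    (μ : S → Measure E) (f : E → S → ℝ) (fh : 𝒟 → E → S → ℝ) (σ b K L M : ℝ) : Prop where
  measurable_f : ∀ s, Measurable fun x => f x s
  measurable_fh : ∀ s, Measurable fun q : 𝒟 × E => fh q.1 q.2 s
  sigma_pos : 0 < σ
  b_pos : 0 < b
  one_le_K : 1 ≤ K
  L_nonneg : 0 ≤ L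
  M_nonneg : 0 ≤ M
  tail : ∀ s, ∀ᵐ x ∂(μ s), ∀ z ∈ Icc (-1 : ℝ) 1,
    PolyTail ρ (fun D => fh D x s + σ * z - f x s) b K
  density : ∀ s, (μ s).map (fun x => f x s) ≤ ENNReal.ofReal L • volume
  bounded : ∀ s, ∀ᵐ x ∂(μ s), |f x s| ≤ M

section Plugin

variable {𝒟 E S ι : Type*} [MeasurableSpace 𝒟] [MeasurableSpace E] [Fintype S] [DecidableEq S]
  [Fintype ι] [DecidableEq ι] {ρ : Measure 𝒟} [IsProbabilityMeasure ρ] {μ : S → Measure E}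
  [∀ s, IsProbabilityMeasure (μ s)] {f : E → S → ℝ} {fh : 𝒟 → E → S → ℝ} {σ b K L M : ℝ}

/-- The law of `f(X, s)` under `μ s`. -/
def pushLaw (μ : S → Measure E) (f : E → S → ℝ) (s : S) : Measure ℝ := (μ s).map fun x => f x s

/-- The rank of `f(x, s)` in its law. -/
def trueRank (μ : S → Measure E) (f : E → S → ℝ) (s : S) (x : E) : ℝ :=
  cdf (pushLaw μ f s) (f x s)

/-- The joint law of the training data and the unlabeled features. -/
def dataLaw (ι : Type*) [Fintype ι] (ρ : Measure 𝒟) (μ : S → Measure E) :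
    Measure (𝒟 × (S → ι → E)) :=
  ρ.prod (Measure.pi fun s : S => Measure.pi fun _ : ι => μ s)

instance : IsProbabilityMeasure (dataLaw ι ρ μ) := by unfold dataLaw; infer_instance

namespace PluginSetting

variable (h : PluginSetting ρ μ f fh σ b K L M)

include h

theorem isProbabilityMeasure_pushLaw (s : S) : IsProbabilityMeasure (pushLaw μ f s) :=
  Measure.isProbabilityMeasure_map (h.measurable_f s).aemeasurable

theorem nullSingletonClass_pushLaw (s : S) : NullSingletonClass (pushLaw μ f s) := by
  refine ⟨fun y => le_antisymm ?_ (zero_le)⟩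
  refine (h.density s {y}).trans ?_
  simp

theorem map_trueRank (s : S) : (μ s).map (trueRank μ f s) = volume.restrict (Icc 0 1) := by
  have h1 := h.isProbabilityMeasure_pushLaw s
  have h2 := h.nullSingletonClass_pushLaw s
  rw [← map_cdf_eq (pushLaw μ f s), pushLaw, Measure.map_map (monotone_cdf _).measurable
    (h.measurable_f s)]
  rfl

theorem measurable_trueRank (s : S) : Measurable (trueRank μ f s) :=
  (monotone_cdf _).measurable.comp (h.measurable_f s)

theorem cdf_pushLaw (s : S) (y : ℝ) : cdf (pushLaw μ f s) y = (μ s).real {x | f x s ≤ y} := by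
  have h1 := h.isProbabilityMeasure_pushLaw s
  rw [cdf_eq_real, measureReal_def, pushLaw, Measure.map_apply (h.measurable_f s) measurableSet_Iic]
  rfl

theorem cdf_pushLaw_eq_one (s : S) : cdf (pushLaw μ f s) M = 1 := by
  rw [h.cdf_pushLaw]
  have : (μ s) {x | f x s ≤ M} = 1 := by
    rw [measure_congr (t := univ), measure_univ]
    refine Filter.eventuallyEq_univ.2 ?_
    filter_upwards [h.bounded s] with x hx
    exact (le_abs_self _).trans hx
  rw [measureReal_def, this, ENNReal.toReal_one]

theorem cdf_pushLaw_eq_zero (s : S) {y : ℝ} (hy : y < -M) : cdf (pushLaw μ f s) y = 0 := by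
  rw [h.cdf_pushLaw]
  have : (μ s) {x | f x s ≤ y} = 0 := by
    rw [measure_eq_zero_iff_ae_notMem]
    filter_upwards [h.bounded s] with x hx hxy
    have h1 : f x s ≤ y := hxy
    linarith [neg_abs_le (f x s)]
  rw [measureReal_def, this, ENNReal.toReal_zero]

theorem neg_le_of_mem_quantileSet (s : S) {t y : ℝ}
    (hy : y ∈ quantileSet (cdf (pushLaw μ f s)) t) : -M ≤ y := by
  by_contra hlt
  exact absurd hy.2 (by rw [h.cdf_pushLaw_eq_zero s (not_le.1 hlt)]; exact lt_irrefl _)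

theorem bddBelow_quantileSet (s : S) (t : ℝ) :
    BddBelow (quantileSet (cdf (pushLaw μ f s)) t) :=
  ⟨-M, fun _ hy => h.neg_le_of_mem_quantileSet s hy⟩

theorem mem_quantileSet_bound (s : S) {t : ℝ} (ht : t ≤ 1) :
    M ∈ quantileSet (cdf (pushLaw μ f s)) t := by
  rw [mem_quantileSet, h.cdf_pushLaw_eq_one]
  exact ⟨ht, one_pos⟩

theorem quantile_mem_Icc (s : S) {t : ℝ} (ht : t ≤ 1) :
    quantile (cdf (pushLaw μ f s)) t ∈ Icc (-M) M :=
  ⟨le_csInf ⟨M, h.mem_quantileSet_bound s ht⟩ fun _ hy => h.neg_le_of_mem_quantileSet s hy,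
    csInf_le (h.bddBelow_quantileSet s t) (h.mem_quantileSet_bound s ht)⟩

theorem measurable_quantile_cdf {α : Type*} [MeasurableSpace α] (s : S) {t : α → ℝ}
    (ht : Measurable t) (ht1 : ∀ a, t a ≤ 1) :
    Measurable fun a => quantile (cdf (pushLaw μ f s)) (t a) :=
  measurable_quantile (fun _ => monotone_cdf _) (fun _ => measurable_const) ht
    (fun a => ⟨M, h.mem_quantileSet_bound s (ht1 a)⟩) (fun a => h.bddBelow_quantileSet s (t a))

theorem lintegral_sq_ecdf_score_le (s : S) {e : S → ι → ℝ} (he : ∀ i, e s i ∈ Icc (-1 : ℝ) 1)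
    (J : Finset ι) {v : 𝒟 → ℝ} (hv : Measurable v) {u₀ : ℝ}
    (htail₀ : PolyTail ρ (fun D => v D - u₀) b K) :
    ∫⁻ ω, ENNReal.ofReal ((ecdf J (score (fh ω.1) σ ω.2 e s) (v ω.1)
        - cdf (pushLaw μ f s) u₀) ^ 2) ∂(dataLaw ι ρ μ)
      ≤ ENNReal.ofReal (ecdfConst K L * (1 / ((J.card : ℝ) + 1) + 1 / b)) := by
  have hmp : MeasurePreserving (Prod.map id (Function.eval s))
      (dataLaw ι ρ μ) (ρ.prod (Measure.pi fun _ : ι => μ s)) :=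
    (MeasurePreserving.id ρ).prod
      (measurePreserving_eval (fun s : S => Measure.pi fun _ : ι => μ s) s)
  have hsc : ∀ i, Measurable fun q : 𝒟 × E => fh q.1 q.2 s + σ * e s i := fun i =>
    (h.measurable_fh s).add_const _
  have key := lintegral_sq_ecdf_sub_le (ρ := ρ) (μ := μ s) (J := J)
    (sc := fun D x i => fh D x s + σ * e s i) hsc (h.measurable_f s) hv u₀ h.b_pos
    (zero_le_one.trans h.one_le_K) h.L_nonneg (fun i => by filter_upwards [h.tail s] with x hx using hx _ (he i)) htail₀
    (h.density s)
  rw [h.cdf_pushLaw]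
  refine le_trans (le_of_eq ?_) key
  rw [← hmp.lintegral_comp]
  · rfl
  · refine ENNReal.measurable_ofReal.comp (((measurable_ecdf J (fun i => ?_)
      (hv.comp measurable_fst)).sub_const _).pow_const 2)
    exact (hsc i).comp (measurable_fst.prodMk ((measurable_pi_apply i).comp measurable_snd))

theorem ecdfConst_pos : 0 < ecdfConst K L := by
  unfold ecdfConst; positivity

theorem measurable_ecdf_score {e : S → ι → ℝ} (s : S) (J : Finset ι) {v : 𝒟 → ℝ}
    (hv : Measurable v) :
    Measurable fun ω : 𝒟 × (S → ι → E) => ecdf J (score (fh ω.1) σ ω.2 e s) (v ω.1) :=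
  measurable_ecdf J (fun i => measurable_score (g := fun ω : 𝒟 × (S → ι → E) => fh ω.1)
    (fun s => (h.measurable_fh s).comp
      (by fun_prop : Measurable fun q : (𝒟 × (S → ι → E)) × E => (q.1.1, q.2))) measurable_snd measurable_const σ s i)
    (hv.comp measurable_fst)

theorem measurable_testScore (s : S) (x : E) (z : ℝ) :
    Measurable fun D => fh D x s + σ * z :=
  ((h.measurable_fh s).comp (measurable_id.prodMk measurable_const)).add_const _

/-- The estimated and the true rank rarely lie on different sides of a given level. -/
theorem lintegral_rank_crossing_le (s : S) {e : S → ι → ℝ} (he : ∀ i, e s i ∈ Icc (-1 : ℝ) 1)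
    {z : ℝ} (hz : z ∈ Icc (-1 : ℝ) 1) (J : Finset ι) (p : ℝ) :
    ∫⁻ x, dataLaw ι ρ μ {ω | |trueRank μ f s x - p|
        ≤ |ecdf J (score (fh ω.1) σ ω.2 e s) (fh ω.1 x s + σ * z) - trueRank μ f s x|} ∂(μ s)
      ≤ ENNReal.ofReal (2 * Real.pi *
        (√(ecdfConst K L) * (1 / √((J.card : ℝ) + 1) + 1 / √b))) := by
  have hE := h.ecdfConst_pos
  have hb := h.b_pos
  have hsb : 0 < √b := Real.sqrt_pos.2 hb
  refine measure_abs_sub_le_of_sq_moment (h.measurable_trueRank s)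
    ((h.map_trueRank s).trans_le Measure.restrict_le_self) (by positivity)
    (ae_of_all _ fun x => ?_) ?_ p
  · exact ((h.measurable_ecdf_score s J (h.measurable_testScore s x z)).sub_const _).aemeasurable
  · filter_upwards [h.tail s] with x hx
    refine (h.lintegral_sq_ecdf_score_le s he J (h.measurable_testScore s x z) (hx z hz)).trans ?_
    apply ENNReal.ofReal_le_ofReal
    rw [mul_pow, Real.sq_sqrt hE.le]
    refine mul_le_mul_of_nonneg_left ?_ hE.le
    have e1 : (1 / √((J.card : ℝ) + 1)) ^ 2 = 1 / ((J.card : ℝ) + 1) := by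
      rw [div_pow, Real.sq_sqrt (by positivity), one_pow]
    have e2 : (1 / √b) ^ 2 = 1 / b := by rw [div_pow, Real.sq_sqrt hb.le, one_pow]
    have e3 : 0 ≤ 1 / √((J.card : ℝ) + 1) * (1 / √b) := by positivity
    nlinarith

theorem lintegral_rank_mismatch_le (s s' : S) {e : S → ι → ℝ}
    (he : ∀ s i, e s i ∈ Icc (-1 : ℝ) 1) {z : ℝ} (hz : z ∈ Icc (-1 : ℝ) 1) (J J' : Finset ι)
    (y : ℝ) :
    ∫⁻ x, dataLaw ι ρ μ {ω | |trueRank μ f s x - cdf (pushLaw μ f s') y|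
        ≤ |(|ecdf J (score (fh ω.1) σ ω.2 e s) (fh ω.1 x s + σ * z) - trueRank μ f s x|
          + |ecdf J' (score (fh ω.1) σ ω.2 e s') y - cdf (pushLaw μ f s') y|)|} ∂(μ s)
      ≤ ENNReal.ofReal (2 * Real.pi * (2 * √(ecdfConst K L) *
        (1 / √((J.card : ℝ) + 1) + 1 / √((J'.card : ℝ) + 1) + 1 / √b))) := by
  have hE := h.ecdfConst_pos
  have hb := h.b_pos
  have hsb : 0 < √b := Real.sqrt_pos.2 hb
  have hm2 : Measurable fun ω : 𝒟 × (S → ι → E) =>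
      ecdf J' (score (fh ω.1) σ ω.2 e s') y - cdf (pushLaw μ f s') y :=
    (h.measurable_ecdf_score s' J' (v := fun _ => y) measurable_const).sub_const _
  refine measure_abs_sub_le_of_sq_moment (h.measurable_trueRank s)
    ((h.map_trueRank s).trans_le Measure.restrict_le_self)
    (Z := fun x (ω : 𝒟 × (S → ι → E)) =>
      |ecdf J (score (fh ω.1) σ ω.2 e s) (fh ω.1 x s + σ * z) - trueRank μ f s x|
        + |ecdf J' (score (fh ω.1) σ ω.2 e s') y - cdf (pushLaw μ f s') y|)
    (by positivity) (ae_of_all _ fun x => ?_) ?_ _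
  · have := (h.measurable_ecdf_score (e := e) s J (h.measurable_testScore s x z)).sub_const
      (trueRank μ f s x)
    fun_prop
  · filter_upwards [h.tail s] with x hx
    have m1 : Measurable fun ω : 𝒟 × (S → ι → E) =>
        ecdf J (score (fh ω.1) σ ω.2 e s) (fh ω.1 x s + σ * z) - trueRank μ f s x :=
      (h.measurable_ecdf_score s J (h.measurable_testScore s x z)).sub_const _
    have b1 := h.lintegral_sq_ecdf_score_le s (he s) J (h.measurable_testScore s x z) (hx z hz)
    have b2 := h.lintegral_sq_ecdf_score_le s' (he s') J' (v := fun _ => y) (u₀ := y)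
      measurable_const (fun δ hδ => by
        rcases eq_or_lt_of_le hδ with h0 | h0
        · rw [← h0]
          have := h.one_le_K
          exact measureReal_le_one.trans (one_le_pow₀ (by simpa using this))
        · have : {ω : 𝒟 | δ ≤ |y - y|} = ∅ := by
            ext ω; simpa using h0
          rw [this]; simp; positivity)
    calc ∫⁻ ω, ENNReal.ofReal ((|ecdf J (score (fh ω.1) σ ω.2 e s) (fh ω.1 x s + σ * z)
            - trueRank μ f s x|
          + |ecdf J' (score (fh ω.1) σ ω.2 e s') y - cdf (pushLaw μ f s') y|) ^ 2)
          ∂(dataLaw ι ρ μ)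
        ≤ ∫⁻ ω, (ENNReal.ofReal 2 * ENNReal.ofReal
            ((ecdf J (score (fh ω.1) σ ω.2 e s) (fh ω.1 x s + σ * z) - trueRank μ f s x) ^ 2)
          + ENNReal.ofReal 2 * ENNReal.ofReal
            ((ecdf J' (score (fh ω.1) σ ω.2 e s') y - cdf (pushLaw μ f s') y) ^ 2))
          ∂(dataLaw ι ρ μ) := by
          refine lintegral_mono fun ω => ?_
          rw [← ENNReal.ofReal_mul (by norm_num), ← ENNReal.ofReal_mul (by norm_num),
            ← ENNReal.ofReal_add (by positivity) (by positivity)]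
          apply ENNReal.ofReal_le_ofReal
          rw [← sq_abs (ecdf J _ _ - _), ← sq_abs (ecdf J' _ _ - _)]
          set A := |ecdf J (score (fh ω.1) σ ω.2 e s) (fh ω.1 x s + σ * z) - trueRank μ f s x|
          set B := |ecdf J' (score (fh ω.1) σ ω.2 e s') y - cdf (pushLaw μ f s') y|
          nlinarith [sq_nonneg (A - B)]
      _ ≤ ENNReal.ofReal 2 * ENNReal.ofReal (ecdfConst K L * (1 / ((J.card : ℝ) + 1) + 1 / b))
          + ENNReal.ofReal 2 *
            ENNReal.ofReal (ecdfConst K L * (1 / ((J'.card : ℝ) + 1) + 1 / b)) := by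
          rw [lintegral_add_left (by fun_prop), lintegral_const_mul _ (by fun_prop),
            lintegral_const_mul _ (by fun_prop)]
          gcongr
          exact b1
      _ ≤ _ := by
          rw [← ENNReal.ofReal_mul (by norm_num), ← ENNReal.ofReal_mul (by norm_num),
            ← ENNReal.ofReal_add (by positivity) (by positivity)]
          apply ENNReal.ofReal_le_ofReal
          have e1 : (1 / √((J.card : ℝ) + 1)) ^ 2 = 1 / ((J.card : ℝ) + 1) := by
            rw [div_pow, Real.sq_sqrt (by positivity), one_pow]
          have e1' : (1 / √((J'.card : ℝ) + 1)) ^ 2 = 1 / ((J'.card : ℝ) + 1) := by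
            rw [div_pow, Real.sq_sqrt (by positivity), one_pow]
          have e2 : (1 / √b) ^ 2 = 1 / b := by rw [div_pow, Real.sq_sqrt hb.le, one_pow]
          rw [mul_pow, mul_pow, Real.sq_sqrt hE.le, ← e1, ← e1', ← e2]
          have p1 : 0 ≤ 1 / √((J.card : ℝ) + 1) := by positivity
          have p2 : 0 ≤ 1 / √((J'.card : ℝ) + 1) := by positivity
          have p3 : 0 ≤ 1 / √b := by positivity
          set α := 1 / √((J.card : ℝ) + 1)
          set β := 1 / √((J'.card : ℝ) + 1)
          set γ := 1 / √b
          set k := ecdfConst K L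
          have : α ^ 2 + γ ^ 2 + (β ^ 2 + γ ^ 2) ≤ 2 * (α + β + γ) ^ 2 := by
            nlinarith [mul_nonneg p1 p2, mul_nonneg p1 p3, mul_nonneg p2 p3]
          nlinarith [mul_le_mul_of_nonneg_left this hE.le]

theorem lintegral_clip_quantile_sub_le (s s' : S) {e : S → ι → ℝ}
    (he : ∀ s i, e s i ∈ Icc (-1 : ℝ) 1) {z : ℝ} (hz : z ∈ Icc (-1 : ℝ) 1) (J J' : Finset ι) :
    ∫⁻ x, ∫⁻ ω, ENNReal.ofReal |clip M (quantile (ecdf J' (score (fh ω.1) σ ω.2 e s'))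
          (ecdf J (score (fh ω.1) σ ω.2 e s) (fh ω.1 x s + σ * z)))
        - quantile (cdf (pushLaw μ f s')) (trueRank μ f s x)| ∂(dataLaw ι ρ μ) ∂(μ s)
      ≤ ENNReal.ofReal (M * (1 + 8 * Real.pi * √(ecdfConst K L)) *
        (1 / √((J.card : ℝ) + 1) + 1 / √((J'.card : ℝ) + 1) + 1 / √b)) := by
  have hE := h.ecdfConst_pos
  have hM := h.M_nonneg
  have hsb : 0 < √b := Real.sqrt_pos.2 h.b_pos
  have ht1 : ∀ x, trueRank μ f s x ≤ 1 := fun x => cdf_le_one _ _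
  have ht0 : ∀ x, 0 ≤ trueRank μ f s x := fun x => cdf_nonneg _ _
  rcases J'.eq_empty_or_nonempty with rfl | hJ'
  · simp_rw [quantile_ecdf_empty]
    calc _ ≤ ∫⁻ _x, ∫⁻ _ω, ENNReal.ofReal M ∂(dataLaw ι ρ μ) ∂(μ s) := by
          refine lintegral_mono fun x => lintegral_mono fun ω => ENNReal.ofReal_le_ofReal ?_
          have hq := h.quantile_mem_Icc s' (ht1 x)
          have h0 : clip M 0 = 0 := by
            unfold clip; rw [min_eq_right hM, max_eq_right (by linarith)]
          rw [h0, zero_sub, abs_neg, abs_le]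
          exact hq
      _ = ENNReal.ofReal M := by simp
      _ ≤ _ := by
          apply ENNReal.ofReal_le_ofReal
          rw [mul_assoc]
          refine le_mul_of_one_le_right hM ?_
          have a1 : (1 : ℝ) ≤ 1 + 8 * Real.pi * √(ecdfConst K L) := by
            have : 0 ≤ 8 * Real.pi * √(ecdfConst K L) := by positivity
            linarith
          have a2 : (1 : ℝ) ≤ 1 / √((J.card : ℝ) + 1) + 1 / √(((∅ : Finset ι).card : ℝ) + 1)
              + 1 / √b := by
            have p1 : 0 ≤ 1 / √((J.card : ℝ) + 1) := by positivity
            have p3 : 0 ≤ 1 / √b := by positivity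
            simp only [Finset.card_empty, Nat.cast_zero, zero_add, Real.sqrt_one, div_one]
            linarith
          exact one_le_mul_of_one_le_of_one_le a1 a2
  set W := dataLaw ι ρ μ
  set R : E → 𝒟 × (S → ι → E) → ℝ := fun x ω =>
    ecdf J (score (fh ω.1) σ ω.2 e s) (fh ω.1 x s + σ * z) with hR
  set T : Set ((E × (𝒟 × (S → ι → E))) × ℝ) := {r |
    |trueRank μ f s r.1.1 - cdf (pushLaw μ f s') r.2|
      ≤ |(|R r.1.1 r.1.2 - trueRank μ f s r.1.1|
        + |ecdf J' (score (fh r.1.2.1) σ r.1.2.2 e s') r.2 - cdf (pushLaw μ f s') r.2|)|} with hT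
  have hsc : ∀ s i, Measurable fun r : (E × (𝒟 × (S → ι → E))) × ℝ =>
      score (fh r.1.2.1) σ r.1.2.2 e s i := fun s i =>
    measurable_score (g := fun r : (E × (𝒟 × (S → ι → E))) × ℝ => fh r.1.2.1)
      (fun s => (h.measurable_fh s).comp
        (by fun_prop : Measurable fun q : ((E × (𝒟 × (S → ι → E))) × ℝ) × E => (q.1.1.2.1, q.2)))
      (by fun_prop) measurable_const σ s i
  have htest : Measurable fun r : (E × (𝒟 × (S → ι → E))) × ℝ => fh r.1.2.1 r.1.1 s + σ * z :=
    ((h.measurable_fh s).comp (by fun_prop : Measurable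
      fun r : (E × (𝒟 × (S → ι → E))) × ℝ => (r.1.2.1, r.1.1))).add_const _
  have hRm : Measurable fun r : (E × (𝒟 × (S → ι → E))) × ℝ => R r.1.1 r.1.2 :=
    measurable_ecdf J (hsc s) htest
  have hFm : Measurable fun r : (E × (𝒟 × (S → ι → E))) × ℝ =>
      ecdf J' (score (fh r.1.2.1) σ r.1.2.2 e s') r.2 :=
    measurable_ecdf J' (hsc s') measurable_snd
  have hcm : Measurable (cdf (pushLaw μ f s')) := (monotone_cdf _).measurable
  have htm := h.measurable_trueRank s
  have habs : Measurable fun y : ℝ => |y| := by fun_prop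
  have htr : Measurable fun r : (E × (𝒟 × (S → ι → E))) × ℝ => trueRank μ f s r.1.1 :=
    htm.comp (by fun_prop)
  have hcr : Measurable fun r : (E × (𝒟 × (S → ι → E))) × ℝ => cdf (pushLaw μ f s') r.2 :=
    hcm.comp measurable_snd
  have hTm : MeasurableSet T := measurableSet_le (habs.comp (htr.sub hcr))
    (habs.comp ((habs.comp (hRm.sub htr)).add (habs.comp (hFm.sub hcr))))
  have hpt : ∀ x ω, ENNReal.ofReal |clip M (quantile (ecdf J' (score (fh ω.1) σ ω.2 e s')) (R x ω))
        - quantile (cdf (pushLaw μ f s')) (trueRank μ f s x)|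
      ≤ volume.restrict (Icc (-M) M) (Prod.mk (x, ω) ⁻¹' T) := by
    intro x ω
    refine (ofReal_abs_clip_sub_le (h.quantile_mem_Icc s' (ht1 x))).trans ?_
    rw [Measure.restrict_apply (measurable_prodMk_left hTm)]
    refine measure_mono fun y hy => ⟨?_, hy.1⟩
    rw [hT, mem_preimage, mem_ofPred_eq]
    refine le_trans ?_ (le_abs_self _)
    rcases hy.2 with ⟨h1, h2⟩ | ⟨h1, h2⟩
    · exact abs_sub_le_of_quantile_lt (monotone_ecdf _ _) (ht0 x)
        (nonempty_quantileSet_ecdf hJ' _ (ecdf_le_one _ _ _)) (h.bddBelow_quantileSet s' _)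
        (cdf_nonneg _ _) h1 h2
    · exact abs_sub_le_of_lt_quantile (monotone_cdf _) (ht0 x)
        ⟨M, h.mem_quantileSet_bound s' (ht1 x)⟩ (bddBelow_quantileSet_ecdf hJ' _ _) h1 h2
  calc _ ≤ ∫⁻ x, ∫⁻ ω, volume.restrict (Icc (-M) M) (Prod.mk (x, ω) ⁻¹' T) ∂W ∂(μ s) :=
        lintegral_mono fun x => lintegral_mono fun ω => hpt x ω
    _ = ∫⁻ r, volume.restrict (Icc (-M) M) (Prod.mk r ⁻¹' T) ∂((μ s).prod W) :=
        (lintegral_prod _ (measurable_measure_prodMk_left hTm).aemeasurable).symm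
    _ = ∫⁻ y in Icc (-M) M, ((μ s).prod W) ((fun r => (r, y)) ⁻¹' T) := by
        rw [← Measure.prod_apply hTm, Measure.prod_apply_symm hTm]
    _ ≤ ∫⁻ _y in Icc (-M) M, ENNReal.ofReal (2 * Real.pi * (2 * √(ecdfConst K L) *
        (1 / √((J.card : ℝ) + 1) + 1 / √((J'.card : ℝ) + 1) + 1 / √b))) := by
        refine lintegral_mono fun y => ?_
        rw [Measure.prod_apply (measurable_prodMk_right hTm)]
        exact h.lintegral_rank_mismatch_le s s' he hz J J' y
    _ ≤ _ := by
        rw [lintegral_const, Measure.restrict_apply_univ, Real.volume_Icc,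
          ← ENNReal.ofReal_mul (by positivity)]
        apply ENNReal.ofReal_le_ofReal
        have p1 : 0 ≤ 1 / √((J.card : ℝ) + 1) + 1 / √((J'.card : ℝ) + 1) + 1 / √b := by positivity
        nlinarith [mul_nonneg hM p1]

theorem measurable_excess_score (s' : S) (j : ι) :
    Measurable fun r : 𝒟 × (((S → ι → E) × E) × ((S → ι → ℝ) × (S → ℝ))) =>
      ENNReal.ofReal (excess M (score (fh r.1) σ r.2.1.1 r.2.2.1 s' j)) := by
  have hm : Measurable fun r : 𝒟 × (((S → ι → E) × E) × ((S → ι → ℝ) × (S → ℝ))) =>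
      score (fh r.1) σ r.2.1.1 r.2.2.1 s' j :=
    measurable_score (g := fun r : 𝒟 × (((S → ι → E) × E) × ((S → ι → ℝ) × (S → ℝ))) => fh r.1)
      (fun s => (h.measurable_fh s).comp (by fun_prop : Measurable fun q :
        (𝒟 × (((S → ι → E) × E) × ((S → ι → ℝ) × (S → ℝ)))) × E => (q.1.1, q.2)))
      (by fun_prop) (by fun_prop) σ s' j
  exact ((measurable_excess M).comp hm).ennreal_ofReal

theorem lintegral_excess_score_le (s s' : S) (j : ι) :
    ∫⁻ D, ∫⁻ q, ENNReal.ofReal (excess M (score (fh D) σ q.1.1 q.2.1 s' j)) ∂(swapLaw μ s) ∂ρ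
      ≤ ENNReal.ofReal (K ^ 2 * Real.pi * (1 / √b)) := by
  have hm : AEMeasurable (Function.uncurry fun (D : 𝒟)
      (q : ((S → ι → E) × E) × ((S → ι → ℝ) × (S → ℝ))) =>
      ENNReal.ofReal (excess M (score (fh D) σ q.1.1 q.2.1 s' j))) (ρ.prod (swapLaw μ s)) :=
    (h.measurable_excess_score s' j).aemeasurable
  rw [lintegral_lintegral_swap hm]
  have hX := ae_swapLaw_feature (ι := ι) μ s s' j ((h.bounded s').and (h.tail s'))
  have he := ae_swapLaw_jitter (ι := ι) μ s s' j
  have hle : ∀ᵐ q ∂(swapLaw (ι := ι) μ s),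
      ∫⁻ D, ENNReal.ofReal (excess M (score (fh D) σ q.1.1 q.2.1 s' j)) ∂ρ
        ≤ ENNReal.ofReal (K ^ 2 * Real.pi * (1 / √b)) := by
    filter_upwards [hX, he] with q hq hqe
    have hW := (hq.2 (q.2.1 s' j) hqe).lintegral_abs_le h.b_pos
      ((h.measurable_testScore s' (q.1.1 s' j) (q.2.1 s' j)).sub_const
        (f (q.1.1 s' j) s')).aemeasurable
    refine le_trans (lintegral_mono fun D => ?_) hW
    apply ENNReal.ofReal_le_ofReal
    unfold excess score
    refine max_le ?_ (abs_nonneg _)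
    have := abs_sub_abs_le_abs_sub (fh D (q.1.1 s' j) s' + σ * q.2.1 s' j) (f (q.1.1 s' j) s')
    linarith [hq.1]
  calc _ ≤ ∫⁻ _q, ENNReal.ofReal (K ^ 2 * Real.pi * (1 / √b)) ∂(swapLaw (ι := ι) μ s) :=
        lintegral_mono_ae hle
    _ = _ := by simp

theorem lintegral_excess_quantile_le (s s' : S) (J J' : Finset ι)
    (hdisj : s = s' → Disjoint J J') :
    ∫⁻ D, ∫⁻ q, ENNReal.ofReal (excess M (quantile (ecdf J' (score (fh D) σ q.1.1 q.2.1 s'))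
          (ecdf J (score (fh D) σ q.1.1 q.2.1 s) (fh D q.1.2 s + σ * q.2.2 s))))
        ∂(swapLaw μ s) ∂ρ
      ≤ ENNReal.ofReal ((1 + 2 * (J'.card / ((J.card : ℝ) + 1))) *
        (K ^ 2 * Real.pi * (1 / √b))) := by
  have hsb : 0 < √b := Real.sqrt_pos.2 h.b_pos
  rcases J'.eq_empty_or_nonempty with rfl | hJ'
  · have h0 : excess M 0 = 0 := by
      unfold excess; rw [abs_zero, zero_sub, max_eq_right (by linarith [h.M_nonneg])]
    simp [quantile_ecdf_empty, h0]
  have hJ0 : (0 : ℝ) < J'.card := by exact_mod_cast hJ'.card_pos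
  have hsum : ∫⁻ D, ∫⁻ q, ENNReal.ofReal (∑ j ∈ J', excess M (score (fh D) σ q.1.1 q.2.1 s' j))
        ∂(swapLaw μ s) ∂ρ
      = ∑ j ∈ J', ∫⁻ D, ∫⁻ q, ENNReal.ofReal (excess M (score (fh D) σ q.1.1 q.2.1 s' j))
          ∂(swapLaw μ s) ∂ρ := by
    have hin : ∀ D, ∫⁻ q, ENNReal.ofReal (∑ j ∈ J', excess M (score (fh D) σ q.1.1 q.2.1 s' j))
          ∂(swapLaw μ s)
        = ∑ j ∈ J', ∫⁻ q, ENNReal.ofReal (excess M (score (fh D) σ q.1.1 q.2.1 s' j))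
          ∂(swapLaw μ s) := by
      intro D
      simp_rw [ENNReal.ofReal_sum_of_nonneg fun j _ => excess_nonneg M _]
      refine lintegral_finsetSum J' fun j _ => ?_
      exact Measurable.of_uncurry_left (f := fun (D : 𝒟)
        (q : ((S → ι → E) × E) × ((S → ι → ℝ) × (S → ℝ))) =>
        ENNReal.ofReal (excess M (score (fh D) σ q.1.1 q.2.1 s' j)))
        (h.measurable_excess_score s' j)
    simp_rw [hin]
    refine lintegral_finsetSum J' fun j _ => ?_
    exact (h.measurable_excess_score s' j).lintegral_prod_right'
  have hD : ∀ D, ∫⁻ q, ENNReal.ofReal (excess M (quantile (ecdf J' (score (fh D) σ q.1.1 q.2.1 s'))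
          (ecdf J (score (fh D) σ q.1.1 q.2.1 s) (fh D q.1.2 s + σ * q.2.2 s)))) ∂(swapLaw μ s)
      ≤ ENNReal.ofReal ((((J.card : ℝ) / J'.card + 2)) / (J.card + 1)) *
        ∫⁻ q, ENNReal.ofReal (∑ j ∈ J', excess M (score (fh D) σ q.1.1 q.2.1 s' j))
          ∂(swapLaw μ s) := fun D =>
    lintegral_quantile_ecdf_le μ (g := fh D) (φ := excess M)
      (fun s => (h.measurable_fh s).comp (measurable_prodMk_left (x := D)))
      h.sigma_pos.ne' s s' hJ' hdisj (measurable_excess M) (excess_nonneg M)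
  refine (lintegral_mono hD).trans ?_
  rw [lintegral_const_mul' _ _ ENNReal.ofReal_ne_top, hsum]
  calc ENNReal.ofReal ((((J.card : ℝ) / J'.card + 2)) / (J.card + 1)) * ∑ j ∈ J',
        ∫⁻ D, ∫⁻ q, ENNReal.ofReal (excess M (score (fh D) σ q.1.1 q.2.1 s' j))
          ∂(swapLaw μ s) ∂ρ
      ≤ ENNReal.ofReal ((((J.card : ℝ) / J'.card + 2)) / (J.card + 1)) *
        ∑ j ∈ J', ENNReal.ofReal (K ^ 2 * Real.pi * (1 / √b)) := by
        gcongr with j _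
        exact h.lintegral_excess_score_le s s' j
    _ ≤ _ := by
        rw [Finset.sum_const, nsmul_eq_mul, ← ENNReal.ofReal_natCast,
          ← ENNReal.ofReal_mul (by positivity), ← ENNReal.ofReal_mul (by positivity)]
        apply ENNReal.ofReal_le_ofReal
        rw [← mul_assoc]
        refine mul_le_mul_of_nonneg_right ?_ (by positivity)
        have e1 : ((J.card : ℝ) / J'.card + 2) / (J.card + 1) * J'.card
            = (J.card : ℝ) / (J.card + 1) + 2 * (J'.card / ((J.card : ℝ) + 1)) := by
          field_simp
        rw [e1]
        have : (J.card : ℝ) / (J.card + 1) ≤ 1 :=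
          div_le_one_of_le₀ (by linarith) (by positivity)
        linarith

end PluginSetting

end Plugin

/-! ### The error for given group sizes -/

theorem abs_tailQuantile_sub_le {S : Type*} [Fintype S] {α ξ p A M : ℝ} {w π : S → ℝ}
    {Qhat Q : S → ℝ → ℝ} {s : S} {t tHat : ℝ} (hξ : 0 ≤ ξ) (hα : |α| ≤ A)
    (hw : ∀ s, 0 ≤ w s) (hπ : ∀ s, 0 ≤ π s) (hπ1 : ∑ s, π s = 1) (hQ : ∀ s, |Q s t| ≤ M) :
    |tailQuantile α α p π Q s t - tailQuantile α (α + ξ) p w Qhat s tHat|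
      ≤ |Qhat s tHat - Q s t| + ∑ s', w s' * |Qhat s' tHat - Q s' t| + M * ∑ s', |w s' - π s'| + ξ
        + (if tHat ≤ p ↔ t ≤ p then 0 else 2 * (A + M)) := by
  have hM : 0 ≤ M := (abs_nonneg _).trans (hQ s)
  have hlow : |min α (Q s t) - min α (Qhat s tHat)| ≤ |Qhat s tHat - Q s t| := by
    have := abs_min_sub_min_le_max α (Q s t) α (Qhat s tHat)
    rwa [sub_self, abs_zero, max_eq_right (abs_nonneg _), abs_sub_comm (Q s t)] at this
  have hsum : |∑ s', π s' * Q s' t - ∑ s', w s' * Qhat s' tHat|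
      ≤ ∑ s', w s' * |Qhat s' tHat - Q s' t| + M * ∑ s', |w s' - π s'| := by
    rw [← Finset.sum_sub_distrib, Finset.mul_sum, ← Finset.sum_add_distrib]
    refine (Finset.abs_sum_le_sum_abs _ _).trans (Finset.sum_le_sum fun s' _ => ?_)
    have e : π s' * Q s' t - w s' * Qhat s' tHat
        = -(w s' * (Qhat s' tHat - Q s' t)) + -((w s' - π s') * Q s' t) := by ring
    rw [e]
    refine (abs_add_le _ _).trans ?_
    rw [abs_neg, abs_neg, abs_mul, abs_mul, abs_of_nonneg (hw s'), mul_comm M]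
    gcongr
    exact hQ s'
  have hhigh : |max α (∑ s', π s' * Q s' t) - max (α + ξ) (∑ s', w s' * Qhat s' tHat)|
      ≤ ∑ s', w s' * |Qhat s' tHat - Q s' t| + M * ∑ s', |w s' - π s'| + ξ := by
    have := abs_max_sub_max_le_max α (∑ s', π s' * Q s' t) (α + ξ) (∑ s', w s' * Qhat s' tHat)
    refine this.trans (max_le ?_ ?_)
    · rw [show α - (α + ξ) = -ξ by ring, abs_neg, abs_of_nonneg hξ]
      have : 0 ≤ ∑ s', w s' * |Qhat s' tHat - Q s' t| :=
        Finset.sum_nonneg fun s' _ => mul_nonneg (hw s') (abs_nonneg _)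
      have : 0 ≤ M * ∑ s', |w s' - π s'| :=
        mul_nonneg hM (Finset.sum_nonneg fun s' _ => abs_nonneg _)
      linarith
    · linarith
  have hlowb : |min α (Q s t)| ≤ A + M := by
    have h1 := abs_le.1 hα
    have h2 := abs_le.1 (hQ s)
    rw [abs_le]
    constructor
    · exact le_min (by linarith) (by linarith)
    · exact (min_le_left _ _).trans (by linarith)
  have hhighb : |max α (∑ s', π s' * Q s' t)| ≤ A + M := by
    have h1 := abs_le.1 hα
    have h2 : |∑ s', π s' * Q s' t| ≤ M := by
      refine (Finset.abs_sum_le_sum_abs _ _).trans ?_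
      calc ∑ s', |π s' * Q s' t| ≤ ∑ s', π s' * M := Finset.sum_le_sum fun s' _ => by
            rw [abs_mul, abs_of_nonneg (hπ s')]
            exact mul_le_mul_of_nonneg_left (hQ s') (hπ s')
        _ = M := by rw [← Finset.sum_mul, hπ1, one_mul]
    have h3 := abs_le.1 h2
    rw [abs_le]
    constructor
    · exact le_trans (by linarith) (le_max_left _ _)
    · exact max_le (by linarith) (by linarith)
  have p1 : 0 ≤ ∑ s', w s' * |Qhat s' tHat - Q s' t| :=
    Finset.sum_nonneg fun s' _ => mul_nonneg (hw s') (abs_nonneg _)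
  have p2 : 0 ≤ M * ∑ s', |w s' - π s'| :=
    mul_nonneg hM (Finset.sum_nonneg fun s' _ => abs_nonneg _)
  have p3 := abs_nonneg (Qhat s tHat - Q s t)
  unfold tailQuantile
  by_cases h1 : tHat ≤ p <;> by_cases h2 : t ≤ p <;> simp only [h1, h2, if_true, if_false]
  · linarith
  · simp only [iff_false, not_true_eq_false, if_false]
    calc _ = |(max α (∑ s', π s' * Q s' t) - min α (Q s t))
          + (min α (Q s t) - min α (Qhat s tHat))| := by ring_nf
      _ ≤ _ := abs_add_le _ _
      _ ≤ (A + M + (A + M)) + |Qhat s tHat - Q s t| :=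
        add_le_add ((abs_sub _ _).trans (add_le_add hhighb hlowb)) hlow
      _ ≤ _ := by linarith
  · simp only [iff_true, if_false]
    calc _ = |(min α (Q s t) - max α (∑ s', π s' * Q s' t))
          + (max α (∑ s', π s' * Q s' t) - max (α + ξ) (∑ s', w s' * Qhat s' tHat))| := by ring_nf
      _ ≤ _ := abs_add_le _ _
      _ ≤ (A + M + (A + M)) + _ :=
        add_le_add ((abs_sub _ _).trans (add_le_add hlowb hhighb)) hhigh
      _ ≤ _ := by linarith
  · linarith

/-- The bound of the expected distance between estimated and true quantiles. -/
def quantileBound (b K L M m m' : ℝ) : ℝ :=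
  M * (1 + 8 * Real.pi * √(ecdfConst K L)) * (1 / √(m + 1) + 1 / √(m' + 1) + 1 / √b)
    + (1 + 2 * (m' / (m + 1))) * (K ^ 2 * Real.pi * (1 / √b))

section PluginError

variable {𝒟 E S ι : Type*} [MeasurableSpace 𝒟] [MeasurableSpace E] [Fintype S] [DecidableEq S]
  [Fintype ι] [DecidableEq ι] {ρ : Measure 𝒟} [IsProbabilityMeasure ρ] {μ : S → Measure E}
  [∀ s, IsProbabilityMeasure (μ s)] {f : E → S → ℝ} {fh : 𝒟 → E → S → ℝ} {σ b K L M : ℝ}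

/-- All the randomness except the group labels. -/
abbrev PlugSpace (𝒟 E S ι : Type*) : Type _ :=
  𝒟 × (((S → ι → E) × E) × ((S → ι → ℝ) × (S → ℝ)))

/-- The estimated rank of the test point. -/
def plugRank (fh : 𝒟 → E → S → ℝ) (σ : ℝ) (J : Finset ι) (s : S) (r : PlugSpace 𝒟 E S ι) : ℝ :=
  ecdf J (score (fh r.1) σ r.2.1.1 r.2.2.1 s) (fh r.1 r.2.1.2 s + σ * r.2.2.2 s)

/-- The estimated quantile of group `s'` at the estimated rank in group `s`. -/
def plugQuantile (fh : 𝒟 → E → S → ℝ) (σ : ℝ) (J J' : Finset ι) (s s' : S)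
    (r : PlugSpace 𝒟 E S ι) : ℝ :=
  quantile (ecdf J' (score (fh r.1) σ r.2.1.1 r.2.2.1 s')) (plugRank fh σ J s r)

/-- The distance between the plug-in estimator and the oracle. -/
def plugError (μ : S → Measure E) (f : E → S → ℝ) (fh : 𝒟 → E → S → ℝ) (σ : ℝ)
    (J J' : S → Finset ι) (α ξ p : ℝ) (w π : S → ℝ) (s : S) (r : PlugSpace 𝒟 E S ι) : ℝ :=
  |tailQuantile α α p π (fun s' => quantile (cdf (pushLaw μ f s'))) s (trueRank μ f s r.2.1.2)
    - tailQuantile α (α + ξ) p w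
      (fun s' => quantile (ecdf (J' s') (score (fh r.1) σ r.2.1.1 r.2.2.1 s'))) s
      (plugRank fh σ (J s) s r)|

theorem lintegral_plugSpace (s : S) {G : PlugSpace 𝒟 E S ι → ℝ≥0∞} (hG : Measurable G) :
    ∫⁻ r, G r ∂(ρ.prod (swapLaw μ s))
      = ∫⁻ e, ∫⁻ x, ∫⁻ ω, G (ω.1, ((ω.2, x), e)) ∂(dataLaw ι ρ μ) ∂(μ s)
        ∂((Measure.pi fun _ : S => Measure.pi fun _ : ι => unifLaw).prod
          (Measure.pi fun _ : S => unifLaw)) := by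
  set 𝒳 := Measure.pi fun s : S => Measure.pi fun _ : ι => μ s
  set 𝒥 := (Measure.pi fun _ : S => Measure.pi fun _ : ι => unifLaw).prod
          (Measure.pi fun _ : S => unifLaw)
  have h1 : ∀ D, ∫⁻ q, G (D, q) ∂(swapLaw μ s) = ∫⁻ e, ∫⁻ y, G (D, (y, e)) ∂(𝒳.prod (μ s)) ∂𝒥 :=
    fun D => lintegral_prod_symm (fun q => G (D, q))
      (hG.comp (measurable_prodMk_left (x := D))).aemeasurable
  rw [lintegral_prod _ hG.aemeasurable]
  simp_rw [h1]
  have hm : Measurable fun q : (𝒟 × ((S → ι → ℝ) × (S → ℝ))) × ((S → ι → E) × E) =>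
      G (q.1.1, (q.2, q.1.2)) := hG.comp (by fun_prop)
  rw [lintegral_lintegral_swap (f := fun D e => ∫⁻ y, G (D, (y, e)) ∂(𝒳.prod (μ s)))
    hm.lintegral_prod_right'.aemeasurable]
  refine lintegral_congr fun e => ?_
  have h2 : ∀ D, ∫⁻ y, G (D, (y, e)) ∂(𝒳.prod (μ s)) = ∫⁻ x, ∫⁻ X, G (D, ((X, x), e)) ∂𝒳 ∂(μ s) :=
    fun D => lintegral_prod_symm (fun y => G (D, (y, e)))
      (hG.comp (by fun_prop : Measurable fun y : (S → ι → E) × E => (D, (y, e)))).aemeasurable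
  simp_rw [h2]
  have hm2 : Measurable fun q : (𝒟 × E) × (S → ι → E) => G (q.1.1, ((q.2, q.1.2), e)) :=
    hG.comp (by fun_prop)
  rw [lintegral_lintegral_swap (f := fun D x => ∫⁻ X, G (D, ((X, x), e)) ∂𝒳)
    hm2.lintegral_prod_right'.aemeasurable]
  refine lintegral_congr fun x => ?_
  exact (lintegral_prod (fun ω : 𝒟 × (S → ι → E) => G (ω.1, ((ω.2, x), e)))
    (hG.comp (by fun_prop : Measurable fun ω : 𝒟 × (S → ι → E) =>
      (ω.1, ((ω.2, x), e)))).aemeasurable).symm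

theorem ae_jitters :
    ∀ᵐ e ∂((Measure.pi fun _ : S => Measure.pi fun _ : ι => unifLaw).prod
      (Measure.pi fun _ : S => unifLaw)),
      (∀ s i, e.1 s i ∈ Icc (-1 : ℝ) 1) ∧ ∀ s, e.2 s ∈ Icc (-1 : ℝ) 1 := by
  have h1 : ∀ᵐ e ∂(Measure.pi fun _ : S => Measure.pi fun _ : ι => unifLaw),
      ∀ s i, e s i ∈ Icc (-1 : ℝ) 1 :=
    ae_pi_of_ae (p := fun _ (y : ι → ℝ) => ∀ i, y i ∈ Icc (-1 : ℝ) 1) fun _ =>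
      ae_pi_of_ae (p := fun _ y => y ∈ Icc (-1 : ℝ) 1) fun _ => ae_mem_unifLaw
  have h2 : ∀ᵐ e ∂(Measure.pi fun _ : S => unifLaw), ∀ s, e s ∈ Icc (-1 : ℝ) 1 :=
    ae_pi_of_ae (p := fun _ y => y ∈ Icc (-1 : ℝ) 1) fun _ => ae_mem_unifLaw
  exact (Measure.quasiMeasurePreserving_fst.ae h1).and (Measure.quasiMeasurePreserving_snd.ae h2)

namespace PluginSetting

variable (h : PluginSetting ρ μ f fh σ b K L M)

include h

theorem measurable_plugScore (s : S) (i : ι) :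
    Measurable fun r : PlugSpace 𝒟 E S ι => score (fh r.1) σ r.2.1.1 r.2.2.1 s i :=
  measurable_score (g := fun r : PlugSpace 𝒟 E S ι => fh r.1)
    (fun s => (h.measurable_fh s).comp (by fun_prop : Measurable fun q :
      (PlugSpace 𝒟 E S ι) × E => (q.1.1, q.2)))
    (by fun_prop) (by fun_prop) σ s i

theorem measurable_plugRank (J : Finset ι) (s : S) :
    Measurable (plugRank (E := E) (ι := ι) fh σ J s) := by
  have h1 : Measurable fun r : PlugSpace 𝒟 E S ι => fh r.1 r.2.1.2 s :=
    (h.measurable_fh s).comp (by fun_prop : Measurable fun r : PlugSpace 𝒟 E S ι =>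
      (r.1, r.2.1.2))
  have h2 : Measurable fun r : PlugSpace 𝒟 E S ι => r.2.2.2 s := by fun_prop
  exact measurable_ecdf J (h.measurable_plugScore s) (h1.add (h2.const_mul σ))

theorem measurable_plugQuantile (J J' : Finset ι) (s s' : S) :
    Measurable (plugQuantile (E := E) (ι := ι) fh σ J J' s s') :=
  measurable_quantile_ecdf J' (h.measurable_plugScore s') (h.measurable_plugRank J s)
    fun _ => ecdf_le_one _ _ _

theorem measurable_testRank (s : S) :
    Measurable fun r : PlugSpace 𝒟 E S ι => trueRank μ f s r.2.1.2 :=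
  (h.measurable_trueRank s).comp (by fun_prop)

theorem measurable_testQuantile (s s' : S) :
    Measurable fun r : PlugSpace 𝒟 E S ι =>
      quantile (cdf (pushLaw μ f s')) (trueRank μ f s r.2.1.2) :=
  h.measurable_quantile_cdf s' (h.measurable_testRank s) fun _ => cdf_le_one _ _

theorem measurable_plugError (J J' : S → Finset ι) (α ξ p : ℝ) (w π : S → ℝ) (s : S) :
    Measurable (plugError (E := E) μ f fh σ J J' α ξ p w π s) := by
  have m1 := h.measurable_testRank (ι := ι) s
  have m2 := h.measurable_testQuantile (ι := ι) s
  have m3 := h.measurable_plugRank (ι := ι) (J s) s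
  have m4 := fun s' => h.measurable_plugQuantile (ι := ι) (J s) (J' s') s s'
  have habs : Measurable fun y : ℝ => |y| := by fun_prop
  refine habs.comp (Measurable.sub ?_ ?_)
  · exact Measurable.ite (measurableSet_le m1 measurable_const) (measurable_const.min (m2 s))
      (measurable_const.max (Finset.measurable_sum _ fun s' _ => (m2 s').const_mul _))
  · exact Measurable.ite (measurableSet_le m3 measurable_const) (measurable_const.min (m4 s))
      (measurable_const.max (Finset.measurable_sum _ fun s' _ => (m4 s').const_mul _))

theorem measure_crossing_le (J : Finset ι) (s : S) (p : ℝ) :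
    (ρ.prod (swapLaw μ s)) {r | ¬ (plugRank fh σ J s r ≤ p ↔ trueRank μ f s r.2.1.2 ≤ p)}
      ≤ ENNReal.ofReal (2 * Real.pi *
        (√(ecdfConst K L) * (1 / √((J.card : ℝ) + 1) + 1 / √b))) := by
  set T : Set (PlugSpace 𝒟 E S ι) := {r | |trueRank μ f s r.2.1.2 - p|
    ≤ |plugRank fh σ J s r - trueRank μ f s r.2.1.2|} with hT
  have habs : Measurable fun y : ℝ => |y| := by fun_prop
  have hTm : MeasurableSet T :=
    measurableSet_le (habs.comp ((h.measurable_testRank s).sub measurable_const))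
      (habs.comp ((h.measurable_plugRank J s).sub (h.measurable_testRank s)))
  have hsub : {r : PlugSpace 𝒟 E S ι |
      ¬ (plugRank fh σ J s r ≤ p ↔ trueRank μ f s r.2.1.2 ≤ p)} ⊆ T := by
    intro r hr
    rw [mem_ofPred_eq] at hr
    rw [hT, mem_ofPred_eq]
    rcases le_or_gt (plugRank fh σ J s r) p with h1 | h1 <;>
      rcases le_or_gt (trueRank μ f s r.2.1.2) p with h2 | h2
    · exact absurd (iff_of_true h1 h2) hr
    · rw [abs_of_pos (by linarith), abs_of_neg (by linarith)]; linarith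
    · rw [abs_of_nonpos (by linarith), abs_of_pos (by linarith)]; linarith
    · exact absurd (iff_of_false (not_le.2 h1) (not_le.2 h2)) hr
  refine (measure_mono hsub).trans ?_
  rw [← lintegral_indicator_one hTm, lintegral_plugSpace s (measurable_one.indicator hTm)]
  refine (lintegral_mono_ae (g := fun _ => ENNReal.ofReal (2 * Real.pi *
    (√(ecdfConst K L) * (1 / √((J.card : ℝ) + 1) + 1 / √b)))) ?_).trans (by simp)
  filter_upwards [ae_jitters] with e he
  refine le_trans (le_of_eq ?_) (h.lintegral_rank_crossing_le s (he.1 s) (he.2 s) J p)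
  refine lintegral_congr fun x => ?_
  have hm : Measurable fun ω : 𝒟 × (S → ι → E) => ((ω.1, ((ω.2, x), e)) : PlugSpace 𝒟 E S ι) := by
    fun_prop
  exact lintegral_indicator_one (hm hTm)

theorem lintegral_plugQuantile_sub_le (J J' : Finset ι) (s s' : S)
    (hdisj : s = s' → Disjoint J J') :
    ∫⁻ r, ENNReal.ofReal |plugQuantile fh σ J J' s s' r
        - quantile (cdf (pushLaw μ f s')) (trueRank μ f s r.2.1.2)| ∂(ρ.prod (swapLaw μ s))
      ≤ ENNReal.ofReal (M * (1 + 8 * Real.pi * √(ecdfConst K L)) *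
          (1 / √((J.card : ℝ) + 1) + 1 / √((J'.card : ℝ) + 1) + 1 / √b)
        + (1 + 2 * (J'.card / ((J.card : ℝ) + 1))) * (K ^ 2 * Real.pi * (1 / √b))) := by
  have hM := h.M_nonneg
  have hsb : 0 < √b := Real.sqrt_pos.2 h.b_pos
  have habs : Measurable fun y : ℝ => |y| := by fun_prop
  have m1 : Measurable fun r : PlugSpace 𝒟 E S ι =>
      ENNReal.ofReal |clip M (plugQuantile fh σ J J' s s' r)
        - quantile (cdf (pushLaw μ f s')) (trueRank μ f s r.2.1.2)| :=
    (habs.comp (((measurable_clip M).comp (h.measurable_plugQuantile J J' s s')).sub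
      (h.measurable_testQuantile s s'))).ennreal_ofReal
  have m2 : Measurable fun r : PlugSpace 𝒟 E S ι =>
      ENNReal.ofReal (excess M (plugQuantile fh σ J J' s s' r)) :=
    ((measurable_excess M).comp (h.measurable_plugQuantile J J' s s')).ennreal_ofReal
  rw [ENNReal.ofReal_add (by positivity) (by positivity)]
  calc _ ≤ ∫⁻ r, (ENNReal.ofReal |clip M (plugQuantile fh σ J J' s s' r)
            - quantile (cdf (pushLaw μ f s')) (trueRank μ f s r.2.1.2)|
          + ENNReal.ofReal (excess M (plugQuantile fh σ J J' s s' r))) ∂(ρ.prod (swapLaw μ s)) := by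
        refine lintegral_mono fun r => ?_
        rw [← ENNReal.ofReal_add (abs_nonneg _) (excess_nonneg _ _)]
        exact ENNReal.ofReal_le_ofReal (abs_sub_le_clip_add_excess hM _ _)
    _ ≤ _ := by
        rw [lintegral_add_left m1]
        refine add_le_add ?_ ?_
        · rw [lintegral_plugSpace s m1]
          refine (lintegral_mono_ae (g := fun _ => ENNReal.ofReal
            (M * (1 + 8 * Real.pi * √(ecdfConst K L)) *
            (1 / √((J.card : ℝ) + 1) + 1 / √((J'.card : ℝ) + 1) + 1 / √b))) ?_).trans (by simp)
          filter_upwards [ae_jitters] with e he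
          exact h.lintegral_clip_quantile_sub_le s s' he.1 (he.2 s) J J'
        · rw [lintegral_prod _ m2.aemeasurable]
          exact h.lintegral_excess_quantile_le s s' J J' hdisj

theorem lintegral_plugError_le {J J' : S → Finset ι} (hdisj : ∀ s, Disjoint (J s) (J' s))
    {α ξ p A : ℝ} {w π : S → ℝ} (hξ : 0 ≤ ξ) (hα : |α| ≤ A)
    (hw : ∀ s, 0 ≤ w s) (hπ : ∀ s, 0 ≤ π s) (hπ1 : ∑ s, π s = 1) (s : S) :
    ∫⁻ r, ENNReal.ofReal (plugError μ f fh σ J J' α ξ p w π s r) ∂(ρ.prod (swapLaw μ s))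
      ≤ ENNReal.ofReal (quantileBound b K L M (J s).card (J' s).card
        + ∑ s', w s' * quantileBound b K L M (J s).card (J' s').card
        + M * ∑ s', |w s' - π s'| + ξ
        + 2 * (A + M) * (2 * Real.pi *
          (√(ecdfConst K L) * (1 / √(((J s).card : ℝ) + 1) + 1 / √b)))) := by
  have hM := h.M_nonneg
  have hA : 0 ≤ A := (abs_nonneg _).trans hα
  have hsb : 0 < √b := Real.sqrt_pos.2 h.b_pos
  have habs : Measurable fun y : ℝ => |y| := by fun_prop
  have hB : ∀ s', 0 ≤ quantileBound b K L M (J s).card (J' s').card := fun s' => by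
    unfold quantileBound; positivity
  have hcr := h.measure_crossing_le (J s) s p
  set T : Set (PlugSpace 𝒟 E S ι) :=
    {r | ¬ (plugRank fh σ (J s) s r ≤ p ↔ trueRank μ f s r.2.1.2 ≤ p)} with hT
  have hTm : MeasurableSet T := by
    have a1 : MeasurableSet {r : PlugSpace 𝒟 E S ι | plugRank fh σ (J s) s r ≤ p} :=
      measurableSet_le (h.measurable_plugRank (J s) s) measurable_const
    have a2 : MeasurableSet {r : PlugSpace 𝒟 E S ι | trueRank μ f s r.2.1.2 ≤ p} :=
      measurableSet_le (h.measurable_testRank s) measurable_const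
    exact (a1.iff a2).compl
  let g : S → PlugSpace 𝒟 E S ι → ℝ := fun s' r => |plugQuantile fh σ (J s) (J' s') s s' r
        - quantile (cdf (pushLaw μ f s')) (trueRank μ f s r.2.1.2)|
  have hgm : ∀ s', Measurable (g s') := fun s' =>
    habs.comp ((h.measurable_plugQuantile (J s) (J' s') s s').sub (h.measurable_testQuantile s s'))
  have hg : ∀ s', ∫⁻ r, ENNReal.ofReal (g s' r) ∂(ρ.prod (swapLaw μ s))
      ≤ ENNReal.ofReal (quantileBound b K L M (J s).card (J' s').card) := fun s' =>
    h.lintegral_plugQuantile_sub_le (J s) (J' s') s s' (by rintro rfl; exact hdisj s)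
  have hpt : ∀ r, ENNReal.ofReal (plugError μ f fh σ J J' α ξ p w π s r)
      ≤ ENNReal.ofReal (g s r) + ∑ s', ENNReal.ofReal (w s') * ENNReal.ofReal (g s' r)
        + ENNReal.ofReal (M * ∑ s', |w s' - π s'| + ξ)
        + T.indicator (fun _ => ENNReal.ofReal (2 * (A + M))) r := by
    intro r
    have hq : ∀ s', |quantile (cdf (pushLaw μ f s')) (trueRank μ f s r.2.1.2)| ≤ M := fun s' =>
      abs_le.2 (h.quantile_mem_Icc s' (cdf_le_one _ _))
    have key := abs_tailQuantile_sub_le (p := p) (s := s) (tHat := plugRank fh σ (J s) s r)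
      (Q := fun s' => quantile (cdf (pushLaw μ f s'))) (t := trueRank μ f s r.2.1.2)
      (Qhat := fun s' => quantile (ecdf (J' s') (score (fh r.1) σ r.2.1.1 r.2.2.1 s')))
      hξ hα hw hπ hπ1 hq
    have e1 : ∑ s', ENNReal.ofReal (w s') * ENNReal.ofReal (g s' r)
        = ENNReal.ofReal (∑ s', w s' * g s' r) := by
      rw [ENNReal.ofReal_sum_of_nonneg fun s' _ => mul_nonneg (hw s') (abs_nonneg _)]
      exact Finset.sum_congr rfl fun s' _ => (ENNReal.ofReal_mul (hw s')).symm
    have e2 : T.indicator (fun _ => ENNReal.ofReal (2 * (A + M))) r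
        = ENNReal.ofReal (if plugRank fh σ (J s) s r ≤ p ↔ trueRank μ f s r.2.1.2 ≤ p then 0
          else 2 * (A + M)) := by
      by_cases hr : plugRank fh σ (J s) s r ≤ p ↔ trueRank μ f s r.2.1.2 ≤ p
      · rw [if_pos hr, indicator_of_notMem (by rw [hT, mem_ofPred_eq, not_not]; exact hr)]; simp
      · rw [if_neg hr, indicator_of_mem (by rw [hT, mem_ofPred_eq]; exact hr)]
    have n1 : 0 ≤ ∑ s', w s' * g s' r :=
      Finset.sum_nonneg fun s' _ => mul_nonneg (hw s') (abs_nonneg _)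
    have n2 : 0 ≤ M * ∑ s', |w s' - π s'| + ξ :=
      add_nonneg (mul_nonneg hM (Finset.sum_nonneg fun s' _ => abs_nonneg _)) hξ
    have n3 : (0 : ℝ) ≤ if plugRank fh σ (J s) s r ≤ p ↔ trueRank μ f s r.2.1.2 ≤ p then 0
          else 2 * (A + M) := by
      split_ifs <;> positivity
    have n4 : 0 ≤ g s r := abs_nonneg _
    rw [e1, e2, ← ENNReal.ofReal_add n4 n1, ← ENNReal.ofReal_add (by positivity) n2,
      ← ENNReal.ofReal_add (by positivity) n3]
    refine ENNReal.ofReal_le_ofReal (key.trans (le_of_eq ?_))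
    rw [add_assoc (_ + _) (M * _) ξ]
    rfl
  refine (lintegral_mono hpt).trans ?_
  have hgm' := fun s' => (hgm s').ennreal_ofReal
  rw [lintegral_add_right _ (measurable_const.indicator hTm), lintegral_add_right _ measurable_const,
    lintegral_add_left (hgm' s),
    lintegral_finsetSum _ fun s' _ => (hgm' s').const_mul _, lintegral_indicator_const hTm,
    lintegral_const, measure_univ, mul_one]
  have n2 : 0 ≤ M * ∑ s', |w s' - π s'| + ξ :=
    add_nonneg (mul_nonneg hM (Finset.sum_nonneg fun s' _ => abs_nonneg _)) hξ
  have n1 : 0 ≤ ∑ s', w s' * quantileBound b K L M (J s).card (J' s').card :=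
    Finset.sum_nonneg fun s' _ => mul_nonneg (hw s') (hB s')
  have n5 := hB s
  rw [add_assoc (_ + _) (M * _) ξ]
  generalize M * ∑ s', |w s' - π s'| + ξ = γ at n2 ⊢
  rw [ENNReal.ofReal_add (by positivity) (by positivity),
    ENNReal.ofReal_add (by positivity) n2, ENNReal.ofReal_add n5 n1,
    ENNReal.ofReal_mul (p := 2 * (A + M)) (by positivity),
    ENNReal.ofReal_sum_of_nonneg fun s' _ => mul_nonneg (hw s') (hB s')]
  gcongr with s' _
  · exact hg s
  · rw [lintegral_const_mul _ (hgm' s'), ENNReal.ofReal_mul (hw s')]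
    gcongr
    exact hg s'

end PluginSetting

end PluginError

/-! ### Group sizes -/

/-- The number of labels that are equal to `s`. -/
def labelCount {S : Type*} [DecidableEq S] {N : ℕ} (g : Fin N → S) (s : S) : ℕ :=
  (Finset.univ.filter fun i => g i = s).card

theorem sum_labelCount {S : Type*} [Fintype S] [DecidableEq S] {N : ℕ} (g : Fin N → S) :
    ∑ s, labelCount g s = N := by
  have := Finset.card_eq_sum_card_fiberwise (f := g) (s := Finset.univ) (t := Finset.univ)
    (fun _ _ => Finset.mem_univ _)
  simpa [labelCount] using this.symm

theorem labelCount_le {S : Type*} [DecidableEq S] {N : ℕ} (g : Fin N → S) (s : S) :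
    labelCount g s ≤ N := by
  refine (Finset.card_filter_le _ _).trans ?_
  simp

section Labels

variable {S : Type*} [Fintype S] [DecidableEq S] [MeasurableSpace S] [MeasurableSingletonClass S]
  (G : Measure S) [IsProbabilityMeasure G] {N : ℕ}

theorem integral_sq_labelCount_sub_le (hN : 1 ≤ N) (s : S) :
    ∫ g, ((labelCount g s : ℝ) / N - G.real {s}) ^ 2 ∂(Measure.pi fun _ : Fin N => G)
      ≤ G.real {s} / N := by
  have : Nonempty (Fin N) := ⟨⟨0, hN⟩⟩
  have key := integral_sq_mean_sub_le (ι := Fin N) G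
    (φ := ({s} : Set S).indicator fun _ => (1 : ℝ))
    (measurable_const.indicator (measurableSet_singleton s)) (B := 1)
    (fun x => by by_cases hx : x ∈ ({s} : Set S) <;> simp [hx, indicator]) (J := Finset.univ)
    Finset.univ_nonempty
  have e1 : ∀ g : Fin N → S, ∑ i, ({s} : Set S).indicator (fun _ => (1 : ℝ)) (g i)
      = labelCount g s := by
    intro g
    unfold labelCount
    rw [Finset.card_filter]
    push_cast
    refine Finset.sum_congr rfl fun i _ => ?_
    simp [indicator]
  have e2 : ∫ x, ({s} : Set S).indicator (fun _ => (1 : ℝ)) x ∂G = G.real {s} := by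
    rw [integral_indicator (measurableSet_singleton s)]; simp [measureReal_def]
  have e3 : ∫ x, (({s} : Set S).indicator (fun _ => (1 : ℝ)) x) ^ 2 ∂G = G.real {s} := by
    rw [← e2]
    refine integral_congr_ae (ae_of_all _ fun x => ?_)
    by_cases hx : x ∈ ({s} : Set S) <;> simp [hx, indicator]
  simp only [e1, e2, e3, Finset.card_univ, Fintype.card_fin] at key
  exact key

theorem integral_abs_labelCount_sub_le (hN : 1 ≤ N) (s : S) :
    ∫ g, |(labelCount g s : ℝ) / N - G.real {s}| ∂(Measure.pi fun _ : Fin N => G)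
      ≤ √(1 / (N : ℝ)) := by
  have hN0 : (0 : ℝ) < N := by exact_mod_cast hN
  set ν := √(1 / (N : ℝ)) with hν
  have hν0 : 0 < ν := Real.sqrt_pos.2 (by positivity)
  have hν2 : ν ^ 2 = 1 / N := Real.sq_sqrt (by positivity)
  have h1 := integral_sq_labelCount_sub_le G hN s
  have h2 : G.real {s} ≤ 1 := measureReal_le_one
  calc _ ≤ ∫ g, ((2 * ν)⁻¹ * ((labelCount g s : ℝ) / N - G.real {s}) ^ 2 + ν / 2)
          ∂(Measure.pi fun _ : Fin N => G) := by
        refine integral_mono Integrable.of_finite Integrable.of_finite fun g => ?_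
        simp only
        set z := (labelCount g s : ℝ) / N - G.real {s}
        rw [← sq_abs z]
        have e : (2 * ν)⁻¹ * |z| ^ 2 + ν / 2 - |z| = (2 * ν)⁻¹ * (|z| - ν) ^ 2 := by
          field_simp; ring
        have : 0 ≤ (2 * ν)⁻¹ * (|z| - ν) ^ 2 := by positivity
        linarith
    _ = (2 * ν)⁻¹ * ∫ g, ((labelCount g s : ℝ) / N - G.real {s}) ^ 2
          ∂(Measure.pi fun _ : Fin N => G) + ν / 2 := by
        rw [integral_add Integrable.of_finite Integrable.of_finite, integral_const_mul]
        simp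
    _ ≤ (2 * ν)⁻¹ * ν ^ 2 + ν / 2 := by
        gcongr
        rw [hν2]
        refine h1.trans ?_
        gcongr
    _ = ν := by field_simp; norm_num

theorem integral_inv_labelCount_le (hN : 1 ≤ N) (s : S) (hs : 0 < G.real {s}) :
    ∫ g, G.real {s} * (1 / ((labelCount g s : ℝ) + 1)) ∂(Measure.pi fun _ : Fin N => G)
      ≤ 6 / N := by
  have hN0 : (0 : ℝ) < N := by exact_mod_cast hN
  set π := G.real {s} with hπ
  have h1 := integral_sq_labelCount_sub_le G hN s
  calc _ ≤ ∫ g, (2 / N + 4 / π * ((labelCount g s : ℝ) / N - π) ^ 2)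
          ∂(Measure.pi fun _ : Fin N => G) := by
        refine integral_mono Integrable.of_finite Integrable.of_finite fun g => ?_
        simp only
        have hk : (0 : ℝ) ≤ labelCount g s := by positivity
        set k : ℝ := (labelCount g s : ℝ)
        rw [mul_one_div]
        rcases le_or_gt (N * π) (2 * k) with hc | hc
        · have : π / (k + 1) ≤ 2 / N := by
            rw [div_le_div_iff₀ (by positivity) hN0]; linarith
          have : 0 ≤ 4 / π * (k / N - π) ^ 2 := by positivity
          linarith
        · have hd : π / 2 ≤ π - k / N := by
            have : k / N ≤ π / 2 := by
              rw [div_le_div_iff₀ hN0 (by norm_num)]; linarith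
            linarith
          have h3 : (π / 2) ^ 2 ≤ (k / N - π) ^ 2 := by
            rw [← neg_sq (k / N - π), neg_sub]
            exact pow_le_pow_left₀ (by positivity) hd 2
          have h4 : π ≤ 4 / π * (k / N - π) ^ 2 := by
            calc π = 4 / π * (π / 2) ^ 2 := by field_simp; norm_num
              _ ≤ _ := by gcongr
          have h5 : π / (k + 1) ≤ π := div_le_self hs.le (by linarith)
          have : 0 ≤ 2 / (N : ℝ) := by positivity
          linarith
    _ = 2 / N + 4 / π * ∫ g, ((labelCount g s : ℝ) / N - π) ^ 2
          ∂(Measure.pi fun _ : Fin N => G) := by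
        rw [integral_add Integrable.of_finite Integrable.of_finite, integral_const_mul]
        simp
    _ ≤ 2 / N + 4 / π * (π / N) := by gcongr
    _ = 6 / N := by field_simp; norm_num

end Labels

/-! ### The halves of a group -/

/-- The indices in a set of natural numbers. -/
def indexSet (N : ℕ) (A : Finset ℕ) : Finset (Fin N) := Finset.univ.filter fun i => (i : ℕ) ∈ A

theorem card_indexSet {N m : ℕ} {A : Finset ℕ} (hA : A ⊆ Finset.range m) (hm : m ≤ N) :
    (indexSet N A).card = A.card := by
  have : (indexSet N A).map Fin.valEmbedding = A := by
    ext k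
    simp only [indexSet, Finset.mem_map, Finset.mem_filter, Finset.mem_univ, true_and,
      Fin.valEmbedding_apply]
    constructor
    · rintro ⟨i, hi, rfl⟩; exact hi
    · intro hk
      exact ⟨⟨k, (Finset.mem_range.1 (hA hk)).trans_le hm⟩, hk, rfl⟩
  rw [← this, Finset.card_map, this]

variable {S : Type*}

theorem SplitRule.card_first_ge (I : SplitRule S) {N m : ℕ} (hm : m ≤ N) (s : S) :
    m ≤ 2 * (indexSet N (I.first s m)).card + 1 := by
  rw [card_indexSet (I.first_subset s m) hm]
  rcases I.card_first s m with h | h <;> omega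

theorem SplitRule.card_second (I : SplitRule S) {N m : ℕ} (hm : m ≤ N) (s : S) :
    m ≤ 2 * (indexSet N (I.second s m)).card + 1 ∧ (indexSet N (I.second s m)).card ≤ m := by
  have hsub : I.second s m ⊆ Finset.range m := Finset.sdiff_subset
  rw [card_indexSet hsub hm, SplitRule.second, Finset.card_sdiff_of_subset (I.first_subset s m),
    Finset.card_range]
  rcases I.card_first s m with h | h <;> omega

theorem SplitRule.disjoint (I : SplitRule S) (N m : ℕ) (s : S) :
    Disjoint (indexSet N (I.first s m)) (indexSet N (I.second s m)) := by
  unfold indexSet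
  rw [Finset.disjoint_filter]
  intro i _ h1 h2
  exact (Finset.mem_sdiff.1 h2).2 h1

/-! ### Disintegration along the groups -/

section Disintegration

variable {d : ℕ} [MeasurableSpace S] [MeasurableSingletonClass S] {P : Measure (Obs d S)}

theorem measurableSet_group (s : S) : MeasurableSet {z : Obs d S | z.2.1 = s} :=
  (measurable_fst.comp measurable_snd : Measurable fun z : Obs d S => z.2.1)
    (measurableSet_singleton s)

theorem isProbabilityMeasure_condX [IsProbabilityMeasure P] {s : S} (hs : 0 < groupProb P s) :
    IsProbabilityMeasure (condX P s) := by
  have h0 : P {z | z.2.1 = s} ≠ 0 := by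
    intro h
    rw [groupProb, measureReal_def, h] at hs
    simp at hs
  have := cond_isProbabilityMeasure h0
  exact Measure.isProbabilityMeasure_map measurable_fst.aemeasurable

theorem groupProb_nonneg (P : Measure (Obs d S)) (s : S) : 0 ≤ groupProb P s := measureReal_nonneg

theorem groupProb_eq_map [IsProbabilityMeasure P] (s : S) :
    (P.map fun z : Obs d S => z.2.1).real {s} = groupProb P s := by
  rw [measureReal_def, Measure.map_apply (by fun_prop) (measurableSet_singleton s)]
  rfl

theorem ofReal_groupProb [IsProbabilityMeasure P] (s : S) :
    ENNReal.ofReal (groupProb P s) = P {z | z.2.1 = s} := by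
  rw [groupProb, ofReal_measureReal]

variable [Fintype S]

theorem measure_eq_sum_group (P : Measure (Obs d S)) {T : Set (Obs d S)} (hT : MeasurableSet T) :
    P T = ∑ s, P ({z | z.2.1 = s} ∩ T) := by
  rw [← measure_biUnion_finset]
  · congr 1
    ext z; simp
  · intro s _ s' _ hss
    refine Set.disjoint_left.2 fun z hz hz' => hss ?_
    exact hz.1.symm.trans hz'.1
  · exact fun s _ => (measurableSet_group s).inter hT

theorem sum_groupProb [IsProbabilityMeasure P] : ∑ s, groupProb P s = 1 := by
  have h := measure_eq_sum_group P MeasurableSet.univ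
  simp only [measure_univ, inter_univ, ← ofReal_groupProb] at h
  rw [← ENNReal.ofReal_sum_of_nonneg fun s _ => groupProb_nonneg P s, eq_comm,
    ENNReal.ofReal_eq_one] at h
  exact h

theorem map_test_eq_sum [IsProbabilityMeasure P] (hP : ∀ s, 0 < groupProb P s) :
    P.map (fun z : Obs d S => (z.1, z.2.1))
      = ∑ s, ENNReal.ofReal (groupProb P s) • (condX P s).map (fun x => (x, s)) := by
  ext B hB
  have hm : Measurable fun z : Obs d S => (z.1, z.2.1) := by fun_prop
  rw [Measure.map_apply hm hB, measure_eq_sum_group P (hm hB), Measure.finsetSum_apply]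
  refine Finset.sum_congr rfl fun s _ => ?_
  have hms : Measurable fun x : Feature d => (x, s) := by fun_prop
  have h0 : P {z | z.2.1 = s} ≠ 0 := by
    intro h
    have := hP s
    rw [groupProb, measureReal_def, h] at this
    simp at this
  rw [Measure.smul_apply, Measure.map_apply hms hB, condX,
    Measure.map_apply measurable_fst (hms hB), cond_apply (measurableSet_group s),
    ofReal_groupProb, smul_eq_mul, ← mul_assoc, ENNReal.mul_inv_cancel h0 (measure_ne_top _ _),
    one_mul]
  congr 1
  ext z
  simp only [mem_inter_iff, mem_ofPred_eq, mem_preimage]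
  constructor
  · rintro ⟨rfl, h⟩; exact ⟨rfl, h⟩
  · rintro ⟨rfl, h⟩; exact ⟨rfl, h⟩

theorem ae_condX_of_ae [IsProbabilityMeasure P] (hP : ∀ s, 0 < groupProb P s)
    {p : Feature d × S → Prop} (h : ∀ᵐ w ∂(P.map fun z : Obs d S => (z.1, z.2.1)), p w) (s : S) :
    ∀ᵐ x ∂(condX P s), p (x, s) := by
  have hms : Measurable fun x : Feature d => (x, s) := by fun_prop
  refine ae_of_ae_map hms.aemeasurable ?_
  rw [map_test_eq_sum hP, ae_iff, Measure.finsetSum_apply, Finset.sum_eq_zero_iff] at h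
  have := h s (Finset.mem_univ s)
  rw [Measure.smul_apply, smul_eq_mul, mul_eq_zero] at this
  exact this.resolve_left (by simpa using hP s)

theorem lintegral_test [IsProbabilityMeasure P] (hP : ∀ s, 0 < groupProb P s)
    {H : Feature d × S → ℝ≥0∞} (hH : Measurable H) :
    ∫⁻ w, H w ∂(P.map fun z : Obs d S => (z.1, z.2.1))
      = ∑ s, ENNReal.ofReal (groupProb P s) * ∫⁻ x, H (x, s) ∂(condX P s) := by
  rw [map_test_eq_sum hP, lintegral_finsetSum_measure]
  refine Finset.sum_congr rfl fun s _ => ?_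
  rw [lintegral_smul_measure, lintegral_map hH (by fun_prop), smul_eq_mul]

variable [DecidableEq S]

theorem lintegral_sampleLaw [IsProbabilityMeasure P] (hP : ∀ s, 0 < groupProb P s)
    [∀ s, IsProbabilityMeasure (condX P s)] (n N : ℕ)
    {Φ : SampleTuple d S n N → ℝ≥0∞} (hΦ : Measurable Φ) :
    ∫⁻ w, Φ w ∂(sampleLaw P n N)
      = ∫⁻ g, ∑ s, ENNReal.ofReal (groupProb P s) *
          ∫⁻ r, Φ (r.1, g, r.2.1.1, r.2.2.1, r.2.2.2, (r.2.1.2, s))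
            ∂((Measure.pi fun _ : Fin n => P).prod (swapLaw (condX P) s))
          ∂(Measure.pi fun _ : Fin N => P.map fun z : Obs d S => z.2.1) := by
  have hprob1 : IsProbabilityMeasure (P.map fun z : Obs d S => z.2.1) :=
    Measure.isProbabilityMeasure_map (by fun_prop)
  have hprob2 : IsProbabilityMeasure (P.map fun z : Obs d S => (z.1, z.2.1)) :=
    Measure.isProbabilityMeasure_map (by fun_prop)
  unfold sampleLaw
  set ρ := Measure.pi fun _ : Fin n => P
  set γ := Measure.pi fun _ : Fin N => P.map fun z : Obs d S => z.2.1
  set 𝒳 := Measure.pi fun s : S => Measure.pi fun _ : Fin N => condX P s with h𝒳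
  set 𝒥 := Measure.pi fun _ : S => Measure.pi fun _ : Fin N => unifLaw with h𝒥
  set 𝒯 := Measure.pi fun _ : S => unifLaw with h𝒯
  set ζ := P.map fun z : Obs d S => (z.1, z.2.1) with hζ
  have hin : ∀ D g, ∫⁻ y, Φ (D, g, y) ∂(𝒳.prod (𝒥.prod (𝒯.prod ζ)))
      = ∑ s, ENNReal.ofReal (groupProb P s) *
        ∫⁻ q, Φ (D, g, q.1.1, q.2.1, q.2.2, (q.1.2, s)) ∂(swapLaw (condX P) s) := by
    intro D g
    have hm : Measurable fun y : (S → Fin N → Feature d) × ((S → Fin N → ℝ) ×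
        ((S → ℝ) × (Feature d × S))) => Φ (D, g, y) := hΦ.comp (by fun_prop)
    rw [lintegral_prod _ hm.aemeasurable]
    have e1 : ∀ X, ∫⁻ y, Φ (D, g, X, y) ∂(𝒥.prod (𝒯.prod ζ))
        = ∫⁻ z, ∫⁻ e, ∫⁻ e₀, Φ (D, g, X, e, e₀, z) ∂𝒯 ∂𝒥 ∂ζ := by
      intro X
      have hmX : Measurable fun y : (S → Fin N → ℝ) × ((S → ℝ) × (Feature d × S)) =>
        Φ (D, g, X, y) := hΦ.comp (by fun_prop)
      rw [lintegral_prod _ hmX.aemeasurable]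
      have e2 : ∀ e, ∫⁻ y, Φ (D, g, X, e, y) ∂(𝒯.prod ζ)
          = ∫⁻ z, ∫⁻ e₀, Φ (D, g, X, e, e₀, z) ∂𝒯 ∂ζ := fun e =>
        lintegral_prod_symm (fun y : (S → ℝ) × (Feature d × S) => Φ (D, g, X, e, y))
          (hΦ.comp (by fun_prop)).aemeasurable
      simp_rw [e2]
      refine lintegral_lintegral_swap (f := fun e z => ∫⁻ e₀, Φ (D, g, X, e, e₀, z) ∂𝒯) ?_
      have : Measurable fun q : ((S → Fin N → ℝ) × (Feature d × S)) × (S → ℝ) =>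
        Φ (D, g, X, q.1.1, q.2, q.1.2) := hΦ.comp (by fun_prop)
      exact this.lintegral_prod_right'.aemeasurable
    simp_rw [e1]
    have hm3 : Measurable fun q : ((S → Fin N → Feature d) × (Feature d × S)) ×
        ((S → Fin N → ℝ) × (S → ℝ)) => Φ (D, g, q.1.1, q.2.1, q.2.2, q.1.2) :=
      hΦ.comp (by fun_prop)
    have e3 : ∀ X z, ∫⁻ e, ∫⁻ e₀, Φ (D, g, X, e, e₀, z) ∂𝒯 ∂𝒥
        = ∫⁻ t, Φ (D, g, X, t.1, t.2, z) ∂(𝒥.prod 𝒯) := fun X z =>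
      (lintegral_prod (fun t : (S → Fin N → ℝ) × (S → ℝ) => Φ (D, g, X, t.1, t.2, z))
        (hΦ.comp (by fun_prop)).aemeasurable).symm
    simp_rw [e3]
    rw [lintegral_lintegral_swap (f := fun X z => ∫⁻ t, Φ (D, g, X, t.1, t.2, z) ∂(𝒥.prod 𝒯))
      hm3.lintegral_prod_right'.aemeasurable]
    have hm4 : Measurable fun q : (Feature d × S) × (S → Fin N → Feature d) =>
        ∫⁻ t, Φ (D, g, q.2, t.1, t.2, q.1) ∂(𝒥.prod 𝒯) :=
      hm3.lintegral_prod_right'.comp measurable_swap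
    rw [lintegral_test hP hm4.lintegral_prod_right']
    refine Finset.sum_congr rfl fun s _ => ?_
    congr 1
    have hm5 : Measurable fun q : ((S → Fin N → Feature d) × Feature d) ×
        ((S → Fin N → ℝ) × (S → ℝ)) => Φ (D, g, q.1.1, q.2.1, q.2.2, (q.1.2, s)) :=
      hΦ.comp (by fun_prop)
    unfold swapLaw
    rw [lintegral_prod _ hm5.aemeasurable,
      lintegral_prod_symm _ hm5.lintegral_prod_right'.aemeasurable]
  rw [lintegral_prod _ hΦ.aemeasurable]
  have hm6 : ∀ D, Measurable fun y : (Fin N → S) × ((S → Fin N → Feature d) ×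
      ((S → Fin N → ℝ) × ((S → ℝ) × (Feature d × S)))) => Φ (D, y) := fun D =>
    hΦ.comp (by fun_prop)
  have e5 : ∀ D, ∫⁻ y, Φ (D, y) ∂(γ.prod (𝒳.prod (𝒥.prod (𝒯.prod ζ))))
      = ∫⁻ g, ∑ s, ENNReal.ofReal (groupProb P s) *
        ∫⁻ q, Φ (D, g, q.1.1, q.2.1, q.2.2, (q.1.2, s)) ∂(swapLaw (condX P) s) ∂γ := by
    intro D
    rw [lintegral_prod _ (hm6 D).aemeasurable]
    exact lintegral_congr fun g => hin D g
  simp_rw [e5]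
  have hm7 : ∀ s, Measurable fun q : ((Fin n → Obs d S) × (Fin N → S)) ×
      (((S → Fin N → Feature d) × Feature d) × ((S → Fin N → ℝ) × (S → ℝ))) =>
      Φ (q.1.1, q.1.2, q.2.1.1, q.2.2.1, q.2.2.2, (q.2.1.2, s)) := fun s =>
    hΦ.comp (by fun_prop)
  rw [lintegral_lintegral_swap (f := fun D g => ∑ s, ENNReal.ofReal (groupProb P s) *
        ∫⁻ q, Φ (D, g, q.1.1, q.2.1, q.2.2, (q.1.2, s)) ∂(swapLaw (condX P) s))
    (Finset.measurable_sum _ fun s _ =>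
      ((hm7 s).lintegral_prod_right').const_mul _).aemeasurable]
  refine lintegral_congr fun g => ?_
  have hm8 : ∀ s, Measurable fun q : (Fin n → Obs d S) ×
      (((S → Fin N → Feature d) × Feature d) × ((S → Fin N → ℝ) × (S → ℝ))) =>
      Φ (q.1, g, q.2.1.1, q.2.2.1, q.2.2.2, (q.2.1.2, s)) := fun s =>
    hΦ.comp (by fun_prop)
  rw [lintegral_finsetSum _ fun s _ => ((hm8 s).lintegral_prod_right').const_mul _]
  refine Finset.sum_congr rfl fun s _ => ?_
  rw [lintegral_const_mul _ (hm8 s).lintegral_prod_right', lintegral_prod _ (hm8 s).aemeasurable]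

end Disintegration

/-! ### The plug-in setting of the regression model -/

theorem one_le_tailConst {c C : ℝ} (hc : 0 < c) (hC : 0 < C) (Kσ : ℝ) : 1 ≤ tailConst c C Kσ := by
  have : 0 ≤ 16 * Kσ ^ 2 + (1 + 2 * c) * (1 + 4 / C) := by positivity
  unfold tailConst; linarith

section Regression

variable {d : ℕ} {S : Type*} [Fintype S] [DecidableEq S] [MeasurableSpace S]
  [MeasurableSingletonClass S] {P : Measure (Obs d S)} [IsProbabilityMeasure P]
  {f : Feature d → S → ℝ} {fhat : BaseEstimator d S} {b : ℕ → ℝ}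

theorem measurable_uncurry_of_forall {E : Type*} [MeasurableSpace E] {f : E → S → ℝ}
    (hf : ∀ s, Measurable fun x => f x s) : Measurable fun w : E × S => f w.1 w.2 :=
  measurable_from_prod_countable_left hf

theorem pluginSetting_of_regression {lamLo lamHi : S → ℝ}
    (hlam : ∀ s, 0 ≤ lamHi s) {c C Kσ M σ : ℝ} (hc : 0 < c) (hC : 0 < C)
    (hP : ∀ s, 0 < groupProb P s)
    (hdens : ∀ s, HasBoundedDensity (condLaw P f s) (lamLo s) (lamHi s))
    (hreg : FeatureRegularity P f) (hM : ∀ᵐ z ∂P, |f z.1 z.2.1| ≤ M) {n : ℕ} (hb : 0 < b n)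
    (hdev : PointwiseDeviation P f fhat b c C) (hn : 1 ≤ n) (hσ : 0 < σ)
    (hσb : σ ≤ Kσ * (1 / √(b n))) :
    PluginSetting (Measure.pi fun _ : Fin n => P) (condX P) f (fhat.toFun n) σ (b n)
      (tailConst c C Kσ) (∑ s, lamHi s) M where
  measurable_f s := by
    obtain ⟨L, hL⟩ := hreg.lipschitz s
    exact hL.continuous.measurable
  measurable_fh := fhat.measurable_toFun n
  sigma_pos := hσ
  b_pos := hb
  one_le_K := one_le_tailConst hc hC Kσ
  L_nonneg := Finset.sum_nonneg fun s _ => hlam s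
  M_nonneg := by
    obtain ⟨z, hz⟩ := hM.exists
    exact (abs_nonneg _).trans hz
  tail s := by
    have h1 : ∀ᵐ x ∂(condX P s), ∀ q : ℚ, 0 < q →
        (Measure.pi fun _ : Fin n => P).real {D | (q : ℝ) ≤ |f x s - fhat.toFun n D x s|}
          ≤ c * Real.exp (-C * b n * (q : ℝ) ^ 2) := by
      rw [ae_all_iff]
      intro q
      by_cases hq : 0 < q
      · filter_upwards [ae_condX_of_ae hP (hdev n hn q (by exact_mod_cast hq)) s] with x hx _
        exact hx
      · exact ae_of_all _ fun _ h => absurd h hq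
    filter_upwards [h1] with x hx z hz
    have h2 : |σ * z| ≤ Kσ * (1 / √(b n)) := by
      rw [abs_mul, abs_of_pos hσ]
      have : |z| ≤ 1 := abs_le.2 hz
      exact (mul_le_of_le_one_right hσ.le this).trans hσb
    have h3 := polyTail_of_exp_tail hb hc hC h2 hx
    have e : (fun D => fhat.toFun n D x s + σ * z - f x s)
        = fun D => σ * z - (f x s - fhat.toFun n D x s) := by
      funext D; ring
    rw [e]
    exact h3
  density s := by
    obtain ⟨q, hq, -, hqd, hhi, -⟩ := hdens s
    change condLaw P f s ≤ _
    rw [hqd, ← withDensity_const]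
    refine withDensity_mono ?_
    filter_upwards [hhi] with t ht
    refine ENNReal.ofReal_le_ofReal (ht.trans ?_)
    exact Finset.single_le_sum (fun s _ => hlam s) (Finset.mem_univ s)
  bounded s := by
    refine ae_condX_of_ae hP (p := fun w => |f w.1 w.2| ≤ M) ?_ s
    have hf : Measurable fun w : Feature d × S => f w.1 w.2 := by
      refine measurable_uncurry_of_forall fun s => ?_
      obtain ⟨L, hL⟩ := hreg.lipschitz s
      exact hL.continuous.measurable
    have habs : Measurable fun y : ℝ => |y| := by fun_prop
    rw [ae_map_iff (by fun_prop) (p := fun w : Feature d × S => |f w.1 w.2| ≤ M)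
      (measurableSet_le (habs.comp hf) measurable_const)]
    exact hM

/-- The first halves of the groups. -/
def firstHalf (I : SplitRule S) {N : ℕ} (g : Fin N → S) (s : S) : Finset (Fin N) :=
  indexSet N (I.first s (labelCount g s))

/-- The second halves of the groups. -/
def secondHalf (I : SplitRule S) {N : ℕ} (g : Fin N → S) (s : S) : Finset (Fin N) :=
  indexSet N (I.second s (labelCount g s))

theorem absError_eq_plugError {n N : ℕ} (σ : (S → ℕ) → ℝ) (I : SplitRule S) (ξ α p : ℝ)
    (g : Fin N → S) (s : S) (r : PlugSpace (Fin n → Obs d S) (Feature d) S (Fin N)) :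
    absError P f fhat σ I ξ α p (r.1, g, r.2.1.1, r.2.2.1, r.2.2.2, (r.2.1.2, s))
      = plugError (condX P) f (fhat.toFun n) (σ (labelCount g)) (firstHalf I g) (secondHalf I g)
          α ξ p (fun s' => (labelCount g s' : ℝ) / N) (groupProb P) s r := rfl

theorem measurable_of_forall_group {n N : ℕ} {Φ : SampleTuple d S n N → ℝ}
    (h : ∀ (g : Fin N → S) s, Measurable fun r : PlugSpace (Fin n → Obs d S) (Feature d) S (Fin N)
      => Φ (r.1, g, r.2.1.1, r.2.2.1, r.2.2.2, (r.2.1.2, s))) :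
    Measurable Φ := by
  have h1 : Measurable fun q : PlugSpace (Fin n → Obs d S) (Feature d) S (Fin N) ×
      ((Fin N → S) × S) => Φ (q.1.1, q.2.1, q.1.2.1.1, q.1.2.2.1, q.1.2.2.2, (q.1.2.1.2, q.2.2)) :=
    measurable_from_prod_countable_left fun gs => h gs.1 gs.2
  have h2 : Measurable fun w : SampleTuple d S n N =>
      (((w.1, ((w.2.2.1, w.2.2.2.2.2.1), (w.2.2.2.1, w.2.2.2.2.1))), (w.2.1, w.2.2.2.2.2.2)) :
        PlugSpace (Fin n → Obs d S) (Feature d) S (Fin N) × ((Fin N → S) × S)) := by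
    fun_prop
  exact h1.comp h2

end Regression

/-! ### The bound for given group sizes -/

theorem one_div_sqrt_succ_le {N : ℝ} (hN : 0 < N) {k m : ℕ} (hk : k ≤ 2 * m + 1) :
    1 / √((m : ℝ) + 1) ≤ √N * (1 / ((k : ℝ) + 1)) + √(1 / N) / 2 := by
  have hk' : (k : ℝ) + 1 ≤ 2 * ((m : ℝ) + 1) := by
    have : (k : ℝ) ≤ 2 * m + 1 := by exact_mod_cast hk
    linarith
  have hk0 : (0 : ℝ) < k + 1 := by positivity
  have hm0 : (0 : ℝ) < m + 1 := by positivity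
  have h1 : 1 / ((m : ℝ) + 1) ≤ 2 * (1 / ((k : ℝ) + 1)) := by
    rw [mul_one_div, div_le_div_iff₀ hm0 hk0]; linarith
  set x := 1 / √((m : ℝ) + 1) with hx
  have hx2 : x ^ 2 = 1 / ((m : ℝ) + 1) := by rw [hx, div_pow, Real.sq_sqrt hm0.le, one_pow]
  have hs : 0 < √N := Real.sqrt_pos.2 hN
  have e : √(1 / N) = 1 / √N := by rw [Real.sqrt_div zero_le_one, Real.sqrt_one]
  rw [← hx2] at h1
  rw [e]
  have h2 : 0 ≤ (√N * x - 1) ^ 2 / (2 * √N) := by positivity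
  have h3 : (√N * x - 1) ^ 2 / (2 * √N) = √N * x ^ 2 / 2 - x + 1 / √N / 2 := by
    field_simp; ring
  have h4 : √N * x ^ 2 ≤ √N * (2 * (1 / ((k : ℝ) + 1))) := by gcongr
  linarith

theorem quantileBound_sum_le {S : Type*} [Fintype S] {b K L M : ℝ} (hM : 0 ≤ M)
    {N : ℕ} (hN : 1 ≤ N) {k m m' : S → ℕ} (hk : ∑ s, k s = N) (hm : ∀ s, k s ≤ 2 * m s + 1)
    (hm' : ∀ s, k s ≤ 2 * m' s + 1) (hmk : ∀ s, m' s ≤ k s) (s : S) :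
    quantileBound b K L M (m s) (m' s)
        + ∑ s', (k s' : ℝ) / N * quantileBound b K L M (m s) (m' s')
      ≤ M * (1 + 8 * Real.pi * √(ecdfConst K L)) * (3 * √N * (1 / ((k s : ℝ) + 1))
          + (3 + Fintype.card S) * √(1 / (N : ℝ)) + 2 * (1 / √b))
        + K ^ 2 * Real.pi * (1 / √b) * (6 + 4 * N * (1 / ((k s : ℝ) + 1))) := by
  have hN0 : (0 : ℝ) < N := by exact_mod_cast hN
  set Q := M * (1 + 8 * Real.pi * √(ecdfConst K L)) with hQ
  have hQ0 : 0 ≤ Q := by positivity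
  set R := K ^ 2 * Real.pi * (1 / √b) with hR
  have hR0 : 0 ≤ R := by positivity
  set c := 1 / √b with hc
  set ν := √(1 / (N : ℝ)) with hν
  have hν0 : 0 ≤ ν := Real.sqrt_nonneg _
  have hνN : √(N : ℝ) * (1 / N) = ν := by
    rw [hν, Real.sqrt_div zero_le_one, Real.sqrt_one, mul_one_div, Real.sqrt_div_self']
  set a := 1 / ((k s : ℝ) + 1) with ha
  have ha0 : 0 ≤ a := by positivity
  have hkN : ∑ s', (k s' : ℝ) = N := by exact_mod_cast hk
  have hw1 : ∑ s', (k s' : ℝ) / N = 1 := by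
    rw [← Finset.sum_div, hkN, div_self hN0.ne']
  have hu : 1 / √((m s : ℝ) + 1) ≤ √N * a + ν / 2 := one_div_sqrt_succ_le hN0 (hm s)
  have hu' : ∀ s', 1 / √((m' s' : ℝ) + 1) ≤ √N * (1 / ((k s' : ℝ) + 1)) + ν / 2 := fun s' =>
    one_div_sqrt_succ_le hN0 (hm' s')
  have hma : 1 / ((m s : ℝ) + 1) ≤ 2 * a := by
    have : (k s : ℝ) ≤ 2 * m s + 1 := by exact_mod_cast hm s
    rw [ha, mul_one_div, div_le_div_iff₀ (by positivity) (by positivity)]; linarith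
  have hown : quantileBound b K L M (m s) (m' s) ≤ Q * (2 * √N * a + ν + c) + R * 5 := by
    unfold quantileBound
    rw [← hQ, ← hR, mul_comm R 5]
    have h1 : (m' s : ℝ) / (m s + 1) ≤ 2 := by
      rw [div_le_iff₀ (by positivity)]
      have := (hmk s).trans (hm s)
      have : (m' s : ℝ) ≤ 2 * m s + 1 := by exact_mod_cast this
      linarith
    have h2 := hu' s
    rw [← ha] at h2
    gcongr ?_ * ?_ + ?_ * ?_
    · linarith
    · linarith
  have hsum : ∑ s', (k s' : ℝ) / N * quantileBound b K L M (m s) (m' s')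
      ≤ ∑ s', (Q * ((k s' : ℝ) / N * (√N * a + ν + c) + ν)
          + R * ((k s' : ℝ) / N + 4 * a * (k s' : ℝ))) := by
    refine Finset.sum_le_sum fun s' _ => ?_
    unfold quantileBound
    rw [← hQ, ← hR]
    have hw0 : 0 ≤ (k s' : ℝ) / N := by positivity
    have h1 : (k s' : ℝ) / N * (√N * (1 / ((k s' : ℝ) + 1))) ≤ ν := by
      rw [← hνN]
      calc (k s' : ℝ) / N * (√N * (1 / ((k s' : ℝ) + 1)))
          = √N * (1 / N) * ((k s' : ℝ) / (k s' + 1)) := by ring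
        _ ≤ √N * (1 / N) * 1 := by
            gcongr
            rw [div_le_one (by positivity)]; linarith
        _ = _ := mul_one _
    have h2 : (k s' : ℝ) / N * (1 / √((m s : ℝ) + 1) + 1 / √((m' s' : ℝ) + 1) + c)
        ≤ (k s' : ℝ) / N * (√N * a + ν + c) + ν := by
      calc _ ≤ (k s' : ℝ) / N * ((√N * a + ν / 2) + (√N * (1 / ((k s' : ℝ) + 1)) + ν / 2) + c) := by
            have := hu' s'
            gcongr
        _ = (k s' : ℝ) / N * (√N * a + ν + c)
            + (k s' : ℝ) / N * (√N * (1 / ((k s' : ℝ) + 1))) := by ring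
        _ ≤ _ := by gcongr
    have h3 : (k s' : ℝ) / N * (1 + 2 * ((m' s' : ℝ) / (m s + 1)))
        ≤ (k s' : ℝ) / N + 4 * a * (k s' : ℝ) := by
      have h4 : (k s' : ℝ) / N ≤ 1 := by
        rw [div_le_one hN0, ← hkN]
        exact Finset.single_le_sum (f := fun s => (k s : ℝ)) (fun _ _ => by positivity)
          (Finset.mem_univ s')
      have h5 : (m' s' : ℝ) / (m s + 1) ≤ k s' * (2 * a) := by
        rw [div_eq_mul_one_div]
        have : (m' s' : ℝ) ≤ k s' := by exact_mod_cast hmk s'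
        gcongr
      calc _ = (k s' : ℝ) / N + (k s' : ℝ) / N * (2 * ((m' s' : ℝ) / (m s + 1))) := by ring
        _ ≤ (k s' : ℝ) / N + 1 * (2 * (k s' * (2 * a))) := by gcongr
        _ = _ := by ring
    calc _ = Q * ((k s' : ℝ) / N * (1 / √((m s : ℝ) + 1) + 1 / √((m' s' : ℝ) + 1) + c))
          + R * ((k s' : ℝ) / N * (1 + 2 * ((m' s' : ℝ) / (m s + 1)))) := by ring
      _ ≤ _ := by gcongr
  have hev : ∑ s', (Q * ((k s' : ℝ) / N * (√N * a + ν + c) + ν)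
          + R * ((k s' : ℝ) / N + 4 * a * (k s' : ℝ)))
      = Q * (√N * a + ν + c + Fintype.card S * ν) + R * (1 + 4 * a * N) := by
    rw [Finset.sum_add_distrib, ← Finset.mul_sum, ← Finset.mul_sum, Finset.sum_add_distrib,
      Finset.sum_add_distrib, ← Finset.sum_mul, ← Finset.mul_sum, hw1, hkN]
    simp
  rw [hev] at hsum
  have hfin : Q * (2 * √N * a + ν + c) + R * 5
      + (Q * (√N * a + ν + c + Fintype.card S * ν) + R * (1 + 4 * a * N))
      ≤ Q * (3 * √N * a + (3 + Fintype.card S) * ν + 2 * c) + R * (6 + 4 * N * a) := by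
    have : 0 ≤ Q * ν := by positivity
    linarith
  linarith

/-! ### Averaging over the group sizes -/

section Average

variable {S : Type*} [Fintype S] [DecidableEq S] [MeasurableSpace S] [MeasurableSingletonClass S]
  (G : Measure S) [IsProbabilityMeasure G] {N : ℕ}

theorem lintegral_labelCount_le (hN : 1 ≤ N) {π : S → ℝ} (hG : ∀ s, G.real {s} = π s)
    (hπ : ∀ s, 0 < π s) (hπ1 : ∑ s, π s = 1) {U V W : ℝ} (hU : 0 ≤ U) (hV : 0 ≤ V) (hW : 0 ≤ W) :
    ∫⁻ g, ∑ s, ENNReal.ofReal (π s) * ENNReal.ofReal (U + V * (1 / ((labelCount g s : ℝ) + 1))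
        + W * ∑ s', |(labelCount g s' : ℝ) / N - π s'|) ∂(Measure.pi fun _ : Fin N => G)
      ≤ ENNReal.ofReal (U + V * (Fintype.card S * (6 / N))
        + W * (Fintype.card S * √(1 / (N : ℝ)))) := by
  set γ := Measure.pi fun _ : Fin N => G
  have e1 : ∀ g : Fin N → S, ∑ s, ENNReal.ofReal (π s) *
      ENNReal.ofReal (U + V * (1 / ((labelCount g s : ℝ) + 1))
        + W * ∑ s', |(labelCount g s' : ℝ) / N - π s'|)
      = ENNReal.ofReal (U + V * (∑ s, π s * (1 / ((labelCount g s : ℝ) + 1)))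
        + W * ∑ s', |(labelCount g s' : ℝ) / N - π s'|) := by
    intro g
    have h0 : ∀ s, 0 ≤ U + V * (1 / ((labelCount g s : ℝ) + 1))
        + W * ∑ s', |(labelCount g s' : ℝ) / N - π s'| := fun s => by positivity
    simp_rw [← ENNReal.ofReal_mul (hπ _).le]
    rw [← ENNReal.ofReal_sum_of_nonneg fun s _ => mul_nonneg (hπ s).le (h0 s)]
    congr 1
    simp_rw [mul_add, Finset.sum_add_distrib]
    rw [← Finset.sum_mul, ← Finset.sum_mul, hπ1, one_mul, one_mul]
    congr 2
    rw [Finset.mul_sum]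
    exact Finset.sum_congr rfl fun s _ => by ring
  simp_rw [e1]
  rw [← ofReal_integral_eq_lintegral_ofReal Integrable.of_finite (ae_of_all _ fun g => by
    have : ∀ s, 0 ≤ π s * (1 / ((labelCount g s : ℝ) + 1)) := fun s =>
      mul_nonneg (hπ s).le (by positivity)
    have := Finset.sum_nonneg fun s (_ : s ∈ Finset.univ) => this s
    simp only [Pi.zero_apply]
    positivity)]
  refine ENNReal.ofReal_le_ofReal ?_
  rw [integral_add Integrable.of_finite Integrable.of_finite,
    integral_add Integrable.of_finite Integrable.of_finite, integral_const_mul,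
    integral_const_mul, integral_finsetSum _ (fun _ _ => Integrable.of_finite),
    integral_finsetSum _ (fun _ _ => Integrable.of_finite), integral_const, probReal_univ,
    one_smul]
  gcongr
  · rw [← nsmul_eq_mul, ← Finset.card_univ]
    refine Finset.sum_le_card_nsmul _ _ _ fun s _ => ?_
    have := integral_inv_labelCount_le G hN s (by rw [hG]; exact hπ s)
    rwa [hG] at this
  · rw [← nsmul_eq_mul, ← Finset.card_univ]
    refine Finset.sum_le_card_nsmul _ _ _ fun s _ => ?_
    have := integral_abs_labelCount_sub_le G hN s
    rwa [hG] at this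

end Average

/-! ### The risk bound -/

/-- The constant in the risk bound, for `q` groups. -/
def riskConst (q K L M A Kξ : ℝ) : ℝ :=
  M * (1 + 8 * Real.pi * √(ecdfConst K L)) * (3 + 19 * q) + K ^ 2 * Real.pi * (6 + 24 * q)
    + Kξ + 2 * (A + M) * (2 * Real.pi * √(ecdfConst K L)) * (1 + 6 * q) + M * q

section Risk

variable {d : ℕ} {S : Type*} [Fintype S] [DecidableEq S] [MeasurableSpace S]
  [MeasurableSingletonClass S] {P : Measure (Obs d S)} [IsProbabilityMeasure P]
  {f : Feature d → S → ℝ} {fhat : BaseEstimator d S} {b K L M : ℝ} {n N : ℕ}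
  {σ : (S → ℕ) → ℝ}

theorem lintegral_absError_le (hP : ∀ s, 0 < groupProb P s)
    [∀ s, IsProbabilityMeasure (condX P s)] (hN : 1 ≤ N)
    (h : ∀ g : Fin N → S, PluginSetting (Measure.pi fun _ : Fin n => P) (condX P) f
      (fhat.toFun n) (σ (labelCount g)) b K L M) (I : SplitRule S) {ξ α A Kξ : ℝ} (p : ℝ)
    (hξ : 0 ≤ ξ) (hKξ : ξ ≤ Kξ * √(1 / (N : ℝ))) (hα : |α| ≤ A) :
    Measurable (absError (n := n) (N := N) P f fhat σ I ξ α p) ∧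
    ∫⁻ w, ENNReal.ofReal (absError P f fhat σ I ξ α p w) ∂(sampleLaw P n N)
      ≤ ENNReal.ofReal (riskConst (Fintype.card S) K L M A Kξ * (√(1 / (N : ℝ)) + 1 / √b)) := by
  have hmeas : Measurable (absError (n := n) (N := N) P f fhat σ I ξ α p) := by
    refine measurable_of_forall_group fun g s => ?_
    simp only [absError_eq_plugError]
    exact (h g).measurable_plugError (firstHalf I g) (secondHalf I g) α ξ p _ _ s
  refine ⟨hmeas, ?_⟩
  have hN0 : (0 : ℝ) < N := by exact_mod_cast hN
  have hprob : IsProbabilityMeasure (P.map fun z : Obs d S => z.2.1) :=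
    Measure.isProbabilityMeasure_map (by fun_prop)
  obtain ⟨s₀⟩ : Nonempty S := by
    by_contra hS
    rw [not_nonempty_iff] at hS
    have := sum_groupProb (P := P)
    simp at this
  have hM : 0 ≤ M := (h fun _ => s₀).M_nonneg
  have hK : 1 ≤ K := (h fun _ => s₀).one_le_K
  have hA : 0 ≤ A := (abs_nonneg _).trans hα
  set E := √(ecdfConst K L) with hE
  have hE0 : 0 ≤ E := Real.sqrt_nonneg _
  set Q := M * (1 + 8 * Real.pi * E) with hQ
  have hQ0 : 0 ≤ Q := by positivity
  set R := K ^ 2 * Real.pi with hR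
  have hR0 : 0 ≤ R := by positivity
  set T := 2 * (A + M) * (2 * Real.pi * E) with hT
  have hT0 : 0 ≤ T := by positivity
  set c := 1 / √b with hc
  have hc0 : 0 ≤ c := by positivity
  set ν := √(1 / (N : ℝ)) with hν
  have hν0 : 0 ≤ ν := Real.sqrt_nonneg _
  set q := (Fintype.card S : ℝ) with hq
  have hq0 : 0 ≤ q := by positivity
  have hNν : √(N : ℝ) * (1 / N) = ν := by
    rw [hν, Real.sqrt_div zero_le_one, Real.sqrt_one, mul_one_div, Real.sqrt_div_self']
  have hKξ0 : 0 ≤ Kξ * ν := hξ.trans hKξ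
  set U := Q * ((3 + q) * ν + 2 * c) + 6 * (R * c) + Kξ * ν + T * (ν + c) with hU
  set V := 3 * Q * √(N : ℝ) + 4 * N * (R * c) + T * √(N : ℝ) with hV
  have hU0 : 0 ≤ U := by positivity
  have hV0 : 0 ≤ V := by positivity
  have hgroup : ∀ (g : Fin N → S) (s : S),
      ∫⁻ r, ENNReal.ofReal (absError P f fhat σ I ξ α p
          (r.1, g, r.2.1.1, r.2.2.1, r.2.2.2, (r.2.1.2, s)))
          ∂((Measure.pi fun _ : Fin n => P).prod (swapLaw (condX P) s))
        ≤ ENNReal.ofReal (U + V * (1 / ((labelCount g s : ℝ) + 1))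
          + M * ∑ s', |(labelCount g s' : ℝ) / N - groupProb P s'|) := by
    intro g s
    simp only [absError_eq_plugError]
    refine ((h g).lintegral_plugError_le (fun s => SplitRule.disjoint I N _ s) hξ hα
      (fun s => by positivity) (fun s => (hP s).le) sum_groupProb s).trans ?_
    refine ENNReal.ofReal_le_ofReal ?_
    have h1 := quantileBound_sum_le (b := b) (K := K) (L := L) hM hN (sum_labelCount g)
      (fun s => I.card_first_ge (labelCount_le g s) s)
      (fun s => (I.card_second (labelCount_le g s) s).1)
      (fun s => (I.card_second (labelCount_le g s) s).2) s
    have h2 := one_div_sqrt_succ_le hN0 (I.card_first_ge (labelCount_le g s) s)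
    rw [← hE, ← hQ, ← hR, ← hc, ← hν, ← hq] at h1
    rw [← hν] at h2
    set a := 1 / ((labelCount g s : ℝ) + 1) with ha
    have h3 : 2 * (A + M) * (2 * Real.pi *
        (E * (1 / √(((firstHalf I g s).card : ℝ) + 1) + c))) ≤ T * (√(N : ℝ) * a + ν + c) := by
      calc _ = T * (1 / √(((firstHalf I g s).card : ℝ) + 1) + c) := by rw [hT]; ring
        _ ≤ _ := by
          gcongr
          unfold firstHalf
          linarith
    unfold firstHalf at h3
    calc _ ≤ (Q * (3 * √(N : ℝ) * a + (3 + q) * ν + 2 * c) + R * c * (6 + 4 * N * a))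
          + M * ∑ s', |(labelCount g s' : ℝ) / N - groupProb P s'| + Kξ * ν
          + T * (√(N : ℝ) * a + ν + c) := by gcongr
      _ = _ := by rw [hU, hV]; ring
  rw [lintegral_sampleLaw hP n N hmeas.ennreal_ofReal]
  calc _ ≤ ∫⁻ g, ∑ s, ENNReal.ofReal (groupProb P s) *
        ENNReal.ofReal (U + V * (1 / ((labelCount g s : ℝ) + 1))
          + M * ∑ s', |(labelCount g s' : ℝ) / N - groupProb P s'|)
        ∂(Measure.pi fun _ : Fin N => P.map fun z : Obs d S => z.2.1) := by
        refine lintegral_mono fun g => Finset.sum_le_sum fun s _ => ?_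
        exact mul_le_mul_right (hgroup g s) _
    _ ≤ ENNReal.ofReal (U + V * (q * (6 / N)) + M * (q * ν)) :=
        lintegral_labelCount_le _ hN groupProb_eq_map hP sum_groupProb hU0 hV0 hM
    _ ≤ _ := by
        refine ENNReal.ofReal_le_ofReal ?_
        have e : V * (q * (6 / N)) = 18 * q * Q * ν + 24 * q * (R * c) + 6 * q * T * ν := by
          rw [hV, ← hNν]
          field_simp
          ring
        have e2 : riskConst q K L M A Kξ * (ν + c) - (U + V * (q * (6 / N)) + M * (q * ν))
            = Q * (1 + 19 * q) * c + R * (6 + 24 * q) * ν + Kξ * c + T * (6 * q) * c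
              + M * q * c := by
          rw [e, hU, riskConst, ← hE, ← hQ, ← hR, ← hT]
          ring
        have hKξ1 : 0 ≤ Kξ := by
          refine nonneg_of_mul_nonneg_left hKξ0 (Real.sqrt_pos.2 (by positivity))
        have : 0 ≤ Q * (1 + 19 * q) * c + R * (6 + 24 * q) * ν + Kξ * c + T * (6 * q) * c
              + M * q * c := by positivity
        linarith

end Risk

end DPTails

end

theorem theorem4 {S : Type*} [Fintype S] [DecidableEq S] [MeasurableSpace S]
    [MeasurableSingletonClass S]
    (lamLo lamHi : S → ℝ) (hlam : ∀ s, 0 < lamLo s ∧ lamLo s ≤ lamHi s)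
    (c C : ℝ) (hc : 0 < c) (hC : 0 < C) (Kσ Kξ M A : ℝ) :
    ∃ K : ℝ, 0 < K ∧
      ∀ (d : ℕ) (P : Measure (DPTails.Obs d S)) [IsProbabilityMeasure P]
        (f : DPTails.Feature d → S → ℝ) (fhat : DPTails.BaseEstimator d S) (b : ℕ → ℝ),
        (∀ s, 0 < DPTails.groupProb P s) →
        DPTails.RegressionModel P f →
        (∀ s, DPTails.HasBoundedDensity (DPTails.condLaw P f s) (lamLo s) (lamHi s)) →
        DPTails.FeatureRegularity P f →
        (∀ᵐ z ∂P, |f z.1 z.2.1| ≤ M) →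
        (∀ n, 0 < b n) →
        DPTails.PointwiseDeviation P f fhat b c C →
        ∀ (n N : ℕ), 2 ≤ n → 1 ≤ N →
        ∀ (I : DPTails.SplitRule S) (σ : (S → ℕ) → ℝ) (ξ α p : ℝ),
        (∀ k : S → ℕ, ∑ s, k s = N →
          0 < σ k ∧ σ k ≤ Kσ * (1 / √(b n)) ∧ ∀ s, 0 < k s → σ k ≤ Kσ * (1 / √(k s : ℝ))) →
        0 < ξ → ξ ≤ Kξ * √(1 / (N : ℝ)) →
        |α| ≤ A → p ∈ Set.Icc (0 : ℝ) 1 →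
        Integrable (DPTails.absError (n := n) (N := N) P f fhat σ I ξ α p)
            (DPTails.sampleLaw P n N) ∧
          ∫ w, DPTails.absError P f fhat σ I ξ α p w ∂(DPTails.sampleLaw P n N)
            ≤ K * (√(1 / (N : ℝ)) + Real.log n * (1 / √(b n))) := by
  set q : ℝ := (Fintype.card S : ℝ) with hq
  set T := DPTails.riskConst q (DPTails.tailConst c C Kσ) (∑ s, lamHi s) |M| |A| |Kξ| with hT
  have hT0 : 0 ≤ T := by
    rw [hT, DPTails.riskConst]; positivity
  have hlog2 : 0 < Real.log 2 := Real.log_pos (by norm_num)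
  refine ⟨T * (1 + 1 / Real.log 2) + 1, by positivity, ?_⟩
  intro d P _ f fhat b hP _ hdens hreg hM hb hdev n N hn hN I σ ξ α p hσ hξ hKξ hα _
  have hcond : ∀ s, IsProbabilityMeasure (DPTails.condX P s) := fun s =>
    DPTails.isProbabilityMeasure_condX (hP s)
  have hset : ∀ g : Fin N → S, DPTails.PluginSetting (Measure.pi fun _ : Fin n => P)
      (DPTails.condX P) f (fhat.toFun n) (σ (DPTails.labelCount g)) (b n)
      (DPTails.tailConst c C Kσ) (∑ s, lamHi s) |M| := by
    intro g
    obtain ⟨h1, h2, -⟩ := hσ (DPTails.labelCount g) (DPTails.sum_labelCount g)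
    refine DPTails.pluginSetting_of_regression (fun s => ((hlam s).1.trans_le (hlam s).2).le) hc hC
      hP hdens hreg (hM.mono fun z hz => hz.trans (le_abs_self M)) (hb n) hdev (by omega) h1 h2
  obtain ⟨hmeas, hle⟩ := DPTails.lintegral_absError_le hP hN hset I (A := |A|) (Kξ := |Kξ|) p hξ.le
    (hKξ.trans (by gcongr; exact le_abs_self Kξ)) (hα.trans (le_abs_self A))
  have h0 : ∀ w, 0 ≤ DPTails.absError (n := n) (N := N) P f fhat σ I ξ α p w := fun w =>
    abs_nonneg _
  have hfin : Integrable (DPTails.absError (n := n) (N := N) P f fhat σ I ξ α p)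
      (DPTails.sampleLaw P n N) := by
    refine ⟨hmeas.aestronglyMeasurable, ?_⟩
    rw [hasFiniteIntegral_iff_ofReal (ae_of_all _ h0)]
    exact hle.trans_lt ENNReal.ofReal_lt_top
  refine ⟨hfin, ?_⟩
  have hx0 : 0 ≤ √(1 / (N : ℝ)) := Real.sqrt_nonneg _
  have hy0 : 0 ≤ 1 / √(b n) := by positivity
  rw [← ofReal_integral_eq_lintegral_ofReal hfin (ae_of_all _ h0)] at hle
  rw [ENNReal.ofReal_le_ofReal_iff (by positivity)] at hle
  have hlogn : Real.log 2 ≤ Real.log n :=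
    Real.log_le_log (by norm_num) (by exact_mod_cast hn)
  have hlog : 1 ≤ 1 / Real.log 2 * Real.log n := by
    rw [one_div_mul_eq_div, one_le_div hlog2]; exact hlogn
  set x := √(1 / (N : ℝ))
  set y := 1 / √(b n)
  set l := Real.log n
  have hl0 : 0 ≤ l := hlog2.le.trans hlogn
  have hy : y ≤ 1 / Real.log 2 * l * y := le_mul_of_one_le_left hy0 hlog
  calc _ ≤ T * (x + y) := hle
    _ ≤ T * (x + 1 / Real.log 2 * l * y) := by gcongr
    _ ≤ T * (x + 1 / Real.log 2 * l * y) + T * (1 / Real.log 2 * x + l * y) + (x + l * y) := by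
        have : 0 ≤ T * (1 / Real.log 2 * x + l * y) + (x + l * y) := by positivity
        linarith
    _ = _ := by ring
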